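/- Let $(M,g_{ab})$ be a spacetime: a smooth, Hausdorff, second countable manifold (of any dimension $n$) with a smooth Lorentzian metric of signature $(+,-,\dots,-)$, Levi-Civita connection $\nabla$ and volume measure induced by $g_{ab}$. Two causal vectors (or covectors) at a point are co-oriented if they lie in the same half of the light cone. A tensor $T^{ab}$ at a point satisfies the dominant energy condition if $T^{ab}\xi_a\eta_b\ge 0$ for all co-oriented causal $\xi_a,\eta_b$. A tensor $x_{ab}$ at a point satisfies the dual energy condition if it is a finite sum of symmetrized outer products of co-oriented causal covectors, and it is generic if $T^{ab}x_{ab}>0$ for every non-zero symmetric $T^{ab}$ at that point satisfying the dominant energy condition. A test field is a smooth field $x_{ab}$ of compact support; a smooth field $T^{ab}$ acts on it by $\mathbf T\{x\}=\int_M T^{ab}x_{ab}$. Let $\gamma$ be a smooth curve in $M$ without self-intersections that is either a properly embedded arc (parametrized by any non-degenerate interval, with or without endpoints) or a simple closed curve. Let $\mathcal C$ be a collection of smooth, symmetric fields $T^{ab}$ on $M$, each divergence-free ($\nabla_aT^{ab}=0$) and each satisfying the dominant energy condition at every point. Suppose that $\mathcal C$ tracks $\gamma$: for every test field $x_{ab}$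 that satisfies the dual energy condition at all points of some neighborhood of $\gamma$ and is generic at some point of $\gamma$, there is a $T^{ab}\in\mathcal C$ with $\mathbf T\{x\}>0$. (1) If $\gamma$ is timelike, with proper time $\tau$ and unit tangent $u^a=(d\gamma/d\tau)^a$, then there are elements $T_k^{ab}$ of $\mathcal C$ and real numbers $a_k>0$, $k=0,1,2,\dots$, such that $a_kT_k^{ab}$ converges, in the sense of distributions, to $\boldsymbol\delta_\gamma u^au^b$; that is, for every test field $x_{ab}$, $$a_k\int_M T_k^{ab}x_{ab}\;\longrightarrow\;\int_\gamma x_{ab}u^au^b\,d\tau .$$ Moreover $\gamma$ is a geodesic: $u^n\nabla_nu^a=0$. (2) If $\gamma$ is null, then it has a smooth parameter $\lambda$ (for a simple closed curve: on the curve cut open at one point) such that, with $u^a=(d\gamma/d\lambda)^a$ and $\boldsymbol\delta_\gamma$ denoting integration along $\gamma$ with respect to $\lambda$, some sequence of positive multiples of elements of $\mathcal C$ converges, in the sense of distributions, to $\boldsymbol\delta_\gamma u^au^b$. Moreover $\gamma$ is a geodesic and $\lambda$ is an affine parameter: $u^n\nabla_nu^a=0$. -/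

import Mathlib

set_option maxSynthPendingDepth 3
open scoped Manifold ContDiff Topology
open MeasureTheory Set Filter

noncomputable section

namespace Tracking

/-! ### Tensors at a point and tensor fields -/

section Fields

variable (n : ℕ) (M : Type*) [TopologicalSpace M] [ChartedSpace (EuclideanSpace ℝ (Fin n)) M]

/-- Fields `x_{ab}` (not necessarily smooth): a bilinear form on each tangent space. -/
abbrev CovariantField : Type _ :=
  ∀ p : M, TangentSpace (𝓡 n) p →L[ℝ] TangentSpace (𝓡 n) p →L[ℝ] ℝ

/-- Fields `T^{ab}` (not necessarily smooth): a bilinear form on each cotangent space. -/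
abbrev ContravariantField : Type _ :=
  ∀ p : M, (TangentSpace (𝓡 n) p →L[ℝ] ℝ) →L[ℝ] (TangentSpace (𝓡 n) p →L[ℝ] ℝ) →L[ℝ] ℝ

variable {n M} [IsManifold (𝓡 n) ∞ M]

/-- `x_{ab}` is a smooth section of the bundle of bilinear forms on the tangent spaces. -/
def IsSmoothCov (x : CovariantField n M) : Prop :=
  ContMDiff (𝓡 n)
    ((𝓡 n).prod 𝓘(ℝ, EuclideanSpace ℝ (Fin n) →L[ℝ] EuclideanSpace ℝ (Fin n) →L[ℝ] ℝ)) ∞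
    (fun p ↦ Bundle.TotalSpace.mk'
      (EuclideanSpace ℝ (Fin n) →L[ℝ] EuclideanSpace ℝ (Fin n) →L[ℝ] ℝ)
      (E := fun p : M ↦ TangentSpace (𝓡 n) p →L[ℝ] TangentSpace (𝓡 n) p →L[ℝ] ℝ) p (x p))

/-- `T^{ab}` is a smooth section of the bundle of bilinear forms on the cotangent spaces. -/
def IsSmoothContra (T : ContravariantField n M) : Prop :=
  ContMDiff (𝓡 n)
    ((𝓡 n).prod 𝓘(ℝ, (EuclideanSpace ℝ (Fin n) →L[ℝ] ℝ) →L[ℝ]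
      (EuclideanSpace ℝ (Fin n) →L[ℝ] ℝ) →L[ℝ] ℝ)) ∞
    (fun p ↦ Bundle.TotalSpace.mk'
      ((EuclideanSpace ℝ (Fin n) →L[ℝ] ℝ) →L[ℝ] (EuclideanSpace ℝ (Fin n) →L[ℝ] ℝ) →L[ℝ] ℝ)
      (E := fun p : M ↦ (TangentSpace (𝓡 n) p →L[ℝ] ℝ) →L[ℝ]
        (TangentSpace (𝓡 n) p →L[ℝ] ℝ) →L[ℝ] ℝ) p (T p))

/-- The contraction `T^{ab} x_{ab}` at a point. The tangent space at `p` is (as a vector space) the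
model space `EuclideanSpace ℝ (Fin n)`, whose standard basis and dual basis are used for the trace;
the value does not depend on the basis. -/
def contract (T : (EuclideanSpace ℝ (Fin n) →L[ℝ] ℝ) →L[ℝ] (EuclideanSpace ℝ (Fin n) →L[ℝ] ℝ) →L[ℝ] ℝ)
    (x : EuclideanSpace ℝ (Fin n) →L[ℝ] EuclideanSpace ℝ (Fin n) →L[ℝ] ℝ) : ℝ :=
  ∑ i, ∑ j, T (EuclideanSpace.proj i) (EuclideanSpace.proj j) *
    x (EuclideanSpace.single i 1) (EuclideanSpace.single j 1)

end Fields

/-! ### Spacetimes -/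

section Spacetime

variable (n : ℕ) (M : Type*) [TopologicalSpace M] [ChartedSpace (EuclideanSpace ℝ (Fin n)) M]
  [IsManifold (𝓡 n) ∞ M]

/-- A smooth Lorentzian metric `g_{ab}`, with signature `(+, -, …, -)`. -/
structure LorentzMetric where
  /-- The metric as a bilinear form on each tangent space. -/
  val : CovariantField n M
  symm : ∀ p v w, val p v w = val p w v
  signature : ∀ p, ∃ t, 0 < val p t t ∧ ∀ w, w ≠ 0 → val p t w = 0 → val p w w < 0
  smooth : IsSmoothCov val

variable {n M}

/-- `v`, `w` are causal (timelike or null, non-zero) vectors at `p` that lie in the same half of the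
light cone. No time-orientation of the spacetime is involved. -/
def CoorientedCausal (g : LorentzMetric n M) (p : M) (v w : TangentSpace (𝓡 n) p) : Prop :=
  v ≠ 0 ∧ w ≠ 0 ∧ 0 ≤ g.val p v v ∧ 0 ≤ g.val p w w ∧
    ∃ t, 0 < g.val p t t ∧ 0 < g.val p t v ∧ 0 < g.val p t w

/-- The dominant energy condition for a tensor `T^{ab}` at `p`: `T^{ab} ξ_a η_b ≥ 0` for all
co-oriented causal `ξ`, `η` (whose indices are lowered with the metric). -/
def DominantEnergyAt (g : LorentzMetric n M) (p : M)
    (T : (TangentSpace (𝓡 n) p →L[ℝ] ℝ) →L[ℝ] (TangentSpace (𝓡 n) p →L[ℝ] ℝ) →L[ℝ] ℝ) : Prop :=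
  ∀ v w, CoorientedCausal g p v w → 0 ≤ T (g.val p v) (g.val p w)

/-- The dual energy condition for a tensor `x_{ab}` at `p`: `x_{ab}` is a finite sum of symmetrized
outer products `ξ_a η_b + η_a ξ_b` of co-oriented causal covectors. (Every causal covector is
`g_{ab} v^b` for a causal vector `v`.) -/
def DualEnergyAt (g : LorentzMetric n M) (p : M)
    (x : TangentSpace (𝓡 n) p →L[ℝ] TangentSpace (𝓡 n) p →L[ℝ] ℝ) : Prop :=
  x ∈ AddSubmonoid.closure
    {y : TangentSpace (𝓡 n) p →L[ℝ] TangentSpace (𝓡 n) p →L[ℝ] ℝ |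
      ∃ v w, CoorientedCausal g p v w ∧
        ∀ a b, y a b = g.val p v a * g.val p w b + g.val p w a * g.val p v b}

/-- `x_{ab}` is generic at `p`: it contracts to a positive number with every non-zero symmetric
tensor at `p` that satisfies the dominant energy condition. -/
def GenericAt (g : LorentzMetric n M) (p : M)
    (x : TangentSpace (𝓡 n) p →L[ℝ] TangentSpace (𝓡 n) p →L[ℝ] ℝ) : Prop :=
  ∀ T : (TangentSpace (𝓡 n) p →L[ℝ] ℝ) →L[ℝ] (TangentSpace (𝓡 n) p →L[ℝ] ℝ) →L[ℝ] ℝ,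
    (∀ ξ η, T ξ η = T η ξ) → T ≠ 0 → DominantEnergyAt g p T → 0 < contract T x

/-- A test field: a smooth field `x_{ab}` of compact support. -/
def IsTestField (x : CovariantField n M) : Prop :=
  IsSmoothCov x ∧ IsCompact (closure {p | x p ≠ 0})

/-! ### Local coordinates: Christoffel symbols, divergence, volume -/

/-- The coordinate vector field `∂_i` of the chart at `c`, at the point with coordinates `y`. -/
def coordVec (c : M) (y : EuclideanSpace ℝ (Fin n)) (i : Fin n) :
    TangentSpace (𝓡 n) ((extChartAt (𝓡 n) c).symm y) :=
  mfderiv 𝓘(ℝ, EuclideanSpace ℝ (Fin n)) (𝓡 n) (extChartAt (𝓡 n) c).symm y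
    (EuclideanSpace.single i (1 : ℝ) : EuclideanSpace ℝ (Fin n))

/-- The coordinate covector field `dy^i` of the chart at `c`, at the point with coordinates `y`. -/
def coordCovec (c : M) (y : EuclideanSpace ℝ (Fin n)) (i : Fin n) :
    TangentSpace (𝓡 n) ((extChartAt (𝓡 n) c).symm y) →L[ℝ] ℝ :=
  (EuclideanSpace.proj i : EuclideanSpace ℝ (Fin n) →L[ℝ] ℝ).comp
    (mfderiv (𝓡 n) 𝓘(ℝ, EuclideanSpace ℝ (Fin n)) (extChartAt (𝓡 n) c)
      ((extChartAt (𝓡 n) c).symm y))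

/-- The matrix `g_{ij}` of the metric in the chart at `c`. -/
def metricMatrix (g : LorentzMetric n M) (c : M) (y : EuclideanSpace ℝ (Fin n)) :
    Matrix (Fin n) (Fin n) ℝ :=
  Matrix.of fun i j ↦ g.val ((extChartAt (𝓡 n) c).symm y) (coordVec c y i) (coordVec c y j)

/-- The components `T^{ij}` of a field in the chart at `c`. -/
def components (T : ContravariantField n M) (c : M) (i j : Fin n)
    (y : EuclideanSpace ℝ (Fin n)) : ℝ :=
  T ((extChartAt (𝓡 n) c).symm y) (coordCovec c y i) (coordCovec c y j)

/-- The partial derivative `∂f/∂y^i`. -/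
def partialDeriv (i : Fin n) (f : EuclideanSpace ℝ (Fin n) → ℝ) (y : EuclideanSpace ℝ (Fin n)) : ℝ :=
  fderiv ℝ f y (EuclideanSpace.single i 1)

/-- The Christoffel symbols `Γ^k_{ij}` of the Levi-Civita connection in the chart at `c`. -/
def christoffel (g : LorentzMetric n M) (c : M) (k i j : Fin n)
    (y : EuclideanSpace ℝ (Fin n)) : ℝ :=
  2⁻¹ * ∑ l, (metricMatrix g c y)⁻¹ k l *
    (partialDeriv i (fun z ↦ metricMatrix g c z l j) y +
      partialDeriv j (fun z ↦ metricMatrix g c z l i) y -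
      partialDeriv l (fun z ↦ metricMatrix g c z i j) y)

/-- `T^{ab}` is divergence-free (conserved), `∇_a T^{ab} = 0`: in each chart
`∂_i T^{ij} + Γ^i_{ik} T^{kj} + Γ^j_{ik} T^{ik} = 0`. -/
def IsConserved (g : LorentzMetric n M) (T : ContravariantField n M) : Prop :=
  ∀ c : M, ∀ y ∈ (extChartAt (𝓡 n) c).target, ∀ j : Fin n,
    ∑ i, (partialDeriv i (components T c i j) y +
      ∑ k, (christoffel g c i i k y * components T c k j y +
        christoffel g c j i k y * components T c i k y)) = 0

variable [MeasurableSpace M]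

/-- The metric volume `√|det g_{ij}| dy` of the domain of the chart at `c`, as a measure on `M` that
is concentrated on that domain. -/
def chartVolume (g : LorentzMetric n M) (c : M) : Measure M :=
  (((volume : Measure (EuclideanSpace ℝ (Fin n))).restrict (extChartAt (𝓡 n) c).target).withDensity
      fun y ↦ ENNReal.ofReal √|(metricMatrix g c y).det|).map (extChartAt (𝓡 n) c).symm

/-- The volume measure of the metric. The measures of the charts agree on overlaps of chart domains,
and the volume measure is the least measure that dominates all of them. -/
def metricVolume (g : LorentzMetric n M) : Measure M := ⨆ c : M, chartVolume g c

/-- The action `∫_M T^{ab} x_{ab}` on `x` of the distribution associated with a field `T`. -/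
def action (g : LorentzMetric n M) (T : ContravariantField n M) (x : CovariantField n M) : ℝ :=
  ∫ p, contract (T p) (x p) ∂(metricVolume g)

end Spacetime

/-! ### Curves

A curve is given by a map `γ : ℝ → M` and the parameter set `J` on which it is considered; values of
`γ` outside `J` play no role, except that a loop is given by a periodic `γ`. -/

section Curves

variable {n : ℕ} {M : Type*} [TopologicalSpace M] [ChartedSpace (EuclideanSpace ℝ (Fin n)) M]

/-- A smooth arc without self-intersections, properly embedded in `M`, parametrized by a
non-degenerate interval `J` of any kind (open, closed, half-open, bounded or not). -/
def IsProperArc (γ : ℝ → M) (J : Set ℝ) : Prop :=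
  J.OrdConnected ∧ J.Nontrivial ∧ ContMDiffOn 𝓘(ℝ, ℝ) (𝓡 n) ∞ γ J ∧
    Topology.IsClosedEmbedding (fun s : J ↦ γ s)

/-- A smooth simple closed curve, parametrized by one period `J = [0, L)`. -/
def IsSimpleLoop (γ : ℝ → M) (J : Set ℝ) : Prop :=
  ∃ L : ℝ, 0 < L ∧ J = Ico 0 L ∧ ContMDiff 𝓘(ℝ, ℝ) (𝓡 n) ∞ γ ∧ Function.Periodic γ L ∧ InjOn γ J

/-- The velocity `dγ/ds`. -/
def velocity (γ : ℝ → M) (J : Set ℝ) (s : ℝ) : TangentSpace (𝓡 n) (γ s) :=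
  mfderivWithin 𝓘(ℝ, ℝ) (𝓡 n) γ J s (1 : ℝ)

variable [IsManifold (𝓡 n) ∞ M]

/-- The curve is timelike: its velocity is timelike everywhere. -/
def IsTimelike (g : LorentzMetric n M) (γ : ℝ → M) (J : Set ℝ) : Prop :=
  ∀ s ∈ J, 0 < g.val (γ s) (velocity γ J s) (velocity γ J s)

/-- The curve is null: its velocity is a non-zero null vector everywhere. -/
def IsNull (g : LorentzMetric n M) (γ : ℝ → M) (J : Set ℝ) : Prop :=
  ∀ s ∈ J, velocity (n := n) γ J s ≠ 0 ∧ g.val (γ s) (velocity γ J s) (velocity γ J s) = 0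

/-- The coordinates `y(s)` of the curve in the chart at `c`. -/
def coordCurve (γ : ℝ → M) (c : M) (s : ℝ) : EuclideanSpace ℝ (Fin n) := extChartAt (𝓡 n) c (γ s)

/-- The components `d²y^k/ds² + Γ^k_{ij} (dy^i/ds) (dy^j/ds)` of the covariant acceleration, in the
chart at `c`. -/
def acceleration (g : LorentzMetric n M) (γ : ℝ → M) (J : Set ℝ) (c : M) (s : ℝ) (k : Fin n) : ℝ :=
  derivWithin (derivWithin (coordCurve (n := n) γ c) J) J s k +
    ∑ i, ∑ j, christoffel g c k i j (coordCurve γ c s) *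
      derivWithin (coordCurve (n := n) γ c) J s i * derivWithin (coordCurve (n := n) γ c) J s j

/-- For a parameter `lam` of the curve with `d lam / ds = r > 0`: the geodesic equation holds with
respect to `lam`, that is, `lam` is an affine parameter of a geodesic. In terms of the given
parameter `s` this says that the covariant acceleration equals `(r' / r) dγ/ds`. -/
def IsAffineGeodesic (g : LorentzMetric n M) (γ : ℝ → M) (J : Set ℝ) (r : ℝ → ℝ) : Prop :=
  ∀ c : M, ∀ s ∈ J, γ s ∈ (extChartAt (𝓡 n) c).source → ∀ k : Fin n,
    acceleration g γ J c s k =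
      (derivWithin r J s / r s) * derivWithin (coordCurve (n := n) γ c) J s k

/-- For a parameter `lam` of the curve with `d lam / ds = r > 0`: the value on the test field `x` of
the distribution `δ_γ u^a u^b`, where `u = dγ / d lam` and `δ_γ` is integration along the curve with
respect to `lam`. -/
def deltaAction (γ : ℝ → M) (J : Set ℝ) (r : ℝ → ℝ) (x : CovariantField n M) : ℝ :=
  ∫ s in J, x (γ s) ((r s)⁻¹ • velocity γ J s) ((r s)⁻¹ • velocity γ J s) * r s

/-- The rate `dτ/ds` of proper time along a timelike curve. The tangent vector belonging to the
proper-time parameter is the unit tangent. -/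
def properTimeRate (g : LorentzMetric n M) (γ : ℝ → M) (J : Set ℝ) (s : ℝ) : ℝ :=
  √(g.val (γ s) (velocity γ J s) (velocity γ J s))

variable [MeasurableSpace M]

/-- The collection `C` tracks the curve: for every test field `x` that satisfies the dual energy
condition in a neighborhood of the curve and is generic at some point of the curve, some element
of `C` has positive action on `x`. -/
def Tracks (g : LorentzMetric n M) (C : Set (ContravariantField n M)) (γ : ℝ → M) (J : Set ℝ) :
    Prop :=
  ∀ x : CovariantField n M, IsTestField x →
    (∃ U : Set M, IsOpen U ∧ γ '' J ⊆ U ∧ ∀ p ∈ U, DualEnergyAt g p (x p)) →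
    (∃ s ∈ J, GenericAt g (γ s) (x (γ s))) →
    ∃ T ∈ C, 0 < action g T x

/-- Some sequence of positive multiples of elements of `C` converges, in the sense of distributions,
to the functional `D` on test fields. -/
def HasMultiplesConvergingTo (g : LorentzMetric n M) (C : Set (ContravariantField n M))
    (D : CovariantField n M → ℝ) : Prop :=
  ∃ (a : ℕ → ℝ) (T : ℕ → ContravariantField n M), (∀ k, 0 < a k ∧ T k ∈ C) ∧
    ∀ x : CovariantField n M, IsTestField x →
      Tendsto (fun k ↦ action g (a k • T k) x) atTop (𝓝 (D x))

end Curves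

end Tracking

end

/-!
The proof follows matter that concentrates on the curve.

*Concentration.* Let `e` be an energy density (a smooth multiple of `ℓ ⊗ ℓ` with a timelike covector
`ℓ`) near a point of `γ`, and let `E_i` be countably many energy densities that are supported off `γ`
and together dominate every test field with support off `γ`. The fields `e - (k + 1) ∑_{i ≤ k} E_i`
are test fields for the tracking hypothesis, and the resulting tensors `T_k`, normalized by
`T_k{e} = 1`, are `O(1 / k)` on each test field with support off `γ`
(`Tracks.exists_isConcentrating`). What makes energy densities useful is that the dominant energy
condition bounds every component of a tensor by `T(ℓ, ℓ)` (`exists_energy_domination`).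

*Propagation.* The functionals vanish on covariant derivatives of covector fields. Applied to a
barrier `-exp(-1 / (t₁ - t)) χ dt` with a time function `t`, whose derivative has positive energy where
the cutoff `χ` is constant, this shows that a bound that holds off `γ` and at an earlier (or later)
point of `γ` continues along `γ`, since `γ` is causal (`mem_boundedSet_of_cutoff`,
`IsEmbeddedCurve.boundedSet_eq_univ`). Hence the `T_k` are bounded on every test field. For the same
reason `γ` has no end points: at an end point the bound `O(1 / k)` would enter and spread to the
whole curve, against the normalization (`IsConcentrating.isOpen`).

*Limits.* A limit `Λ` of the sequence along an ultrafilter is positive, symmetric, conserved and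
supported on `γ`. By positivity it vanishes on fields that are zero on `γ`; by conservation, applied to
`v = X(z - y(S(z)), ·)`, where `S` extends the parameter of the curve, it only depends on the
component `x_{ab} u^a u^b` along the velocity (`IsStraightened.eq_tangential`). So `Λ` is a
distribution in one variable, and conservation becomes the differential equations
`(ρ u^k)' + ρ Γ^k_{ij} u^i u^j = 0` in the sense of distributions. Hence it has a smooth density `ρ`
that satisfies these equations (`exists_density`, `IsCurveFunctional.exists_global_density`); `ρ` is
positive because `Λ` is positive and `Λ e = 1`.

*Conclusion.* The equations determine `ρ` up to a factor, and `Λ e = 1` determines the factor, so all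
limits agree and the sequence converges to `∫ ρ x_{ab} u^a u^b`
(`IsConcentrating.exists_tendsto`). They also say that `γ` is a geodesic with the affine parameter of
rate `1 / ρ`. On a timelike curve `ρ² g(u, u)` is constant, so that proper time is affine.

A loop is treated as the periodic curve on the whole line, which has no end points and on which
densities are periodic.
-/

noncomputable section

namespace Tracking

/-! ### Tensors on the model space -/

/-- The model space of the charts. -/
abbrev Vec (n : ℕ) : Type := EuclideanSpace ℝ (Fin n)

/-- Covectors on the model space. -/
abbrev Covec (n : ℕ) : Type := Vec n →L[ℝ] ℝ

/-- Bilinear forms on the model space. -/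
abbrev Form (n : ℕ) : Type := Vec n →L[ℝ] Vec n →L[ℝ] ℝ

/-- Bilinear forms on the dual of the model space. -/
abbrev CoForm (n : ℕ) : Type := Covec n →L[ℝ] Covec n →L[ℝ] ℝ

/-- The outer product `α_a β_b` of two covectors. -/
def outer {n : ℕ} (α β : Covec n) : Form n := α.smulRight β

@[simp] lemma outer_apply {n : ℕ} (α β : Covec n) (v w : Vec n) : outer α β v w = α v * β w := by
  simp [outer]

section Pointwise

variable {n : ℕ}

/-- The pullback of a bilinear form by a linear map. -/
def Form.pull (x : Form n) (A : Vec n →L[ℝ] Vec n) : Form n := x.bilinearComp A A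

/-- The pushforward of a contravariant tensor by a linear map. -/
def CoForm.push (T : CoForm n) (A : Vec n →L[ℝ] Vec n) : CoForm n :=
  T.bilinearComp (ContinuousLinearMap.precomp ℝ A) (ContinuousLinearMap.precomp ℝ A)

@[simp] lemma Form.pull_apply (x : Form n) (A : Vec n →L[ℝ] Vec n) (v w : Vec n) :
    x.pull A v w = x (A v) (A w) := rfl

@[simp] lemma CoForm.push_apply (T : CoForm n) (A : Vec n →L[ℝ] Vec n) (α β : Covec n) :
    T.push A α β = T (α.comp A) (β.comp A) := rfl

lemma vec_eq_sum (v : Vec n) : v = ∑ i, v i • (EuclideanSpace.single i (1 : ℝ)) := by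
  ext j
  simp [Finset.sum_apply, Pi.single_apply]

lemma covec_eq_sum (α : Covec n) :
    α = ∑ i, α (EuclideanSpace.single i 1) • (EuclideanSpace.proj i : Covec n) := by
  ext v
  conv_lhs => rw [vec_eq_sum v]
  simp [mul_comm]

lemma form_eq_sum (x : Form n) :
    x = ∑ i, ∑ j, x (EuclideanSpace.single i 1) (EuclideanSpace.single j 1) •
      outer (EuclideanSpace.proj i) (EuclideanSpace.proj j) := by
  ext v w
  conv_lhs => rw [vec_eq_sum v, vec_eq_sum w]
  simp only [map_sum, map_smul, _root_.sum_apply, _root_.smul_apply,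
    outer_apply, smul_eq_mul]
  simp only [Finset.mul_sum]
  rw [Finset.sum_comm]
  refine Finset.sum_congr rfl fun i _ ↦ Finset.sum_congr rfl fun j _ ↦ ?_
  rw [PiLp.proj_apply, PiLp.proj_apply]
  ring

lemma contract_add (T : CoForm n) (x y : Form n) :
    contract T (x + y) = contract T x + contract T y := by
  simp [contract, mul_add, Finset.sum_add_distrib]

lemma contract_smul (T : CoForm n) (a : ℝ) (x : Form n) :
    contract T (a • x) = a * contract T x := by
  simp [contract, Finset.mul_sum, mul_left_comm]

@[simp] lemma contract_zero (T : CoForm n) : contract T 0 = 0 := by simp [contract]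

lemma contract_neg (T : CoForm n) (x : Form n) : contract T (-x) = -contract T x := by
  simp [contract]

lemma contract_sub (T : CoForm n) (x y : Form n) :
    contract T (x - y) = contract T x - contract T y := by
  rw [sub_eq_add_neg, contract_add, contract_neg]; ring

lemma contract_sum {ι : Type*} (T : CoForm n) (s : Finset ι) (x : ι → Form n) :
    contract T (∑ i ∈ s, x i) = ∑ i ∈ s, contract T (x i) := by
  classical
  induction s using Finset.induction_on with
  | empty => simp
  | insert a s ha ih => rw [Finset.sum_insert ha, Finset.sum_insert ha, contract_add, ih]

lemma smul_contract (T : CoForm n) (a : ℝ) (x : Form n) :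
    contract (a • T) x = a * contract T x := by
  simp [contract, Finset.mul_sum, mul_assoc]

lemma contract_outer (T : CoForm n) (α β : Covec n) : contract T (outer α β) = T α β := by
  conv_rhs => rw [covec_eq_sum α, covec_eq_sum β]
  simp only [contract, outer_apply, map_sum, map_smul, _root_.sum_apply,
    _root_.smul_apply, smul_eq_mul, Finset.mul_sum]
  rw [Finset.sum_comm]
  refine Finset.sum_congr rfl fun i _ ↦ Finset.sum_congr rfl fun j _ ↦ ?_
  ring

lemma contract_flip (T : CoForm n) (hT : ∀ α β, T α β = T β α) (x : Form n) :
    contract T x.flip = contract T x := by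
  simp only [contract, ContinuousLinearMap.flip_apply]
  rw [Finset.sum_comm]
  refine Finset.sum_congr rfl fun i _ ↦ Finset.sum_congr rfl fun j _ ↦ ?_
  rw [hT]

/-- The contraction of `T` with a pulled back form, through the components of the form. -/
lemma contract_pull (T : CoForm n) (x : Form n) (A : Vec n →L[ℝ] Vec n) :
    contract T (x.pull A) = contract (T.push A) x := by
  have h : x.pull A = ∑ i, ∑ j, x (EuclideanSpace.single i 1) (EuclideanSpace.single j 1) •
      outer ((EuclideanSpace.proj i : Covec n).comp A) ((EuclideanSpace.proj j : Covec n).comp A) := by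
    conv_lhs => rw [form_eq_sum x]
    ext v w
    simp [Form.pull_apply, _root_.sum_apply]
  rw [h]
  simp only [contract_sum, contract_smul, contract_outer]
  simp only [contract, CoForm.push_apply]
  refine Finset.sum_congr rfl fun i _ ↦ Finset.sum_congr rfl fun j _ ↦ ?_
  ring

end Pointwise

/-! ### Fields in charts -/

section Charts

variable {n : ℕ} {M : Type*} [TopologicalSpace M] [ChartedSpace (EuclideanSpace ℝ (Fin n)) M]

/-- The value of a field at a point, as a form on the model space. The tangent spaces are, by
definition, copies of the model space; this map, `coformAt` and `ofForm` only change the type. -/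
def formAt (x : CovariantField n M) (p : M) : Form n := x p

/-- The value of a contravariant field at a point, as a tensor on the model space. -/
def coformAt (T : ContravariantField n M) (p : M) : CoForm n := T p

/-- The field with given values. -/
def ofForm (X : M → Form n) : CovariantField n M := X

@[simp] lemma formAt_ofForm (X : M → Form n) (p : M) : formAt (ofForm X) p = X p := rfl

lemma field_ext {x y : CovariantField n M} (h : ∀ p, formAt x p = formAt y p) : x = y := funext h

/-- The derivative of the chart at `c`, at the point `p`. -/
def chartD (c p : M) : Vec n →L[ℝ] Vec n :=
  mfderiv (𝓡 n) 𝓘(ℝ, EuclideanSpace ℝ (Fin n)) (extChartAt (𝓡 n) c) p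

/-- The derivative of the inverse of the chart at `c`, at the coordinates `y`. -/
def chartDSymm (c : M) (y : Vec n) : Vec n →L[ℝ] Vec n :=
  mfderiv 𝓘(ℝ, EuclideanSpace ℝ (Fin n)) (𝓡 n) (extChartAt (𝓡 n) c).symm y

/-- A field `x_{ab}` in the chart at `c`, as a function of the coordinates. -/
def coordForm (c : M) (x : CovariantField n M) (y : Vec n) : Form n :=
  (formAt x ((extChartAt (𝓡 n) c).symm y)).pull (chartDSymm c y)

/-- A field `T^{ab}` in the chart at `c`, as a function of the coordinates. -/
def coordContra (c : M) (T : ContravariantField n M) (y : Vec n) : CoForm n :=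
  (coformAt T ((extChartAt (𝓡 n) c).symm y)).push (chartD c ((extChartAt (𝓡 n) c).symm y))

open Classical in
/-- The field with the coordinates `X` in the chart at `c`, extended by zero. -/
def chartField (c : M) (X : Vec n → Form n) : CovariantField n M := ofForm fun p ↦
  if p ∈ (extChartAt (𝓡 n) c).source then (X (extChartAt (𝓡 n) c p)).pull (chartD c p) else 0

variable [IsManifold (𝓡 n) ∞ M]

lemma isManifold_one : IsManifold (𝓡 n) 1 M := IsManifold.of_le (n := ∞) (by simp)

lemma chartDSymm_chartD {c p : M} (hp : p ∈ (extChartAt (𝓡 n) c).source) (v : Vec n) :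
    chartDSymm c (extChartAt (𝓡 n) c p) (chartD c p v) = v := by
  have := isManifold_one (n := n) (M := M)
  have h := mfderivWithin_extChartAt_symm_comp_mfderiv_extChartAt' (I := 𝓡 n) hp
  rw [ModelWithCorners.range_eq_univ, mfderivWithin_univ] at h
  exact DFunLike.congr_fun h v

lemma chartD_chartDSymm {c : M} {y : Vec n} (hy : y ∈ (extChartAt (𝓡 n) c).target) (v : Vec n) :
    chartD c ((extChartAt (𝓡 n) c).symm y) (chartDSymm c y v) = v := by
  have := isManifold_one (n := n) (M := M)
  have h := mfderiv_extChartAt_comp_mfderivWithin_extChartAt_symm (I := 𝓡 n) hy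
  rw [ModelWithCorners.range_eq_univ, mfderivWithin_univ] at h
  exact DFunLike.congr_fun h v

omit [IsManifold (𝓡 n) ∞ M] in
lemma chartField_apply {c p : M} (hp : p ∈ (extChartAt (𝓡 n) c).source) (X : Vec n → Form n) :
    formAt (chartField c X) p = (X (extChartAt (𝓡 n) c p)).pull (chartD c p) := by
  rw [chartField, formAt_ofForm, if_pos hp]

omit [IsManifold (𝓡 n) ∞ M] in
lemma chartField_apply_of_notMem {c p : M} (hp : p ∉ (extChartAt (𝓡 n) c).source)
    (X : Vec n → Form n) : formAt (chartField c X) p = 0 := by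
  rw [chartField, formAt_ofForm, if_neg hp]

lemma coordForm_chartField {c : M} {y : Vec n} (hy : y ∈ (extChartAt (𝓡 n) c).target)
    (X : Vec n → Form n) : coordForm c (chartField c X) y = X y := by
  have hs := (extChartAt (𝓡 n) c).map_target hy
  rw [coordForm, chartField_apply hs, (extChartAt (𝓡 n) c).right_inv hy]
  ext v w
  rw [Form.pull_apply, Form.pull_apply, chartD_chartDSymm hy, chartD_chartDSymm hy]

lemma chartField_coordForm {c p : M} (hp : p ∈ (extChartAt (𝓡 n) c).source)
    (x : CovariantField n M) : formAt (chartField c (coordForm c x)) p = formAt x p := by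
  rw [chartField_apply hp, coordForm, (extChartAt (𝓡 n) c).left_inv hp]
  ext v w
  rw [Form.pull_apply, Form.pull_apply, chartDSymm_chartD hp, chartDSymm_chartD hp]

/-- The contraction does not depend on the chart. -/
lemma contract_coord {c p : M} (hp : p ∈ (extChartAt (𝓡 n) c).source) (T : ContravariantField n M)
    (x : CovariantField n M) :
    contract (coordContra c T (extChartAt (𝓡 n) c p)) (coordForm c x (extChartAt (𝓡 n) c p)) =
      contract (coformAt T p) (formAt x p) := by
  conv_rhs => rw [← chartField_coordForm hp x, chartField_apply hp, contract_pull]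
  rw [coordContra, (extChartAt (𝓡 n) c).left_inv hp]

lemma trivializationAt_symm_eq {c p : M} (hp : p ∈ (extChartAt (𝓡 n) c).source) (v : Vec n) :
    ((trivializationAt (EuclideanSpace ℝ (Fin n)) (TangentSpace (𝓡 n) : M → Type _) c).symm p v)
      = chartDSymm c (extChartAt (𝓡 n) c p) v := by
  have := isManifold_one (n := n) (M := M)
  have hp' : p ∈ (chartAt (EuclideanSpace ℝ (Fin n)) c).source := by simpa using hp
  have h := TangentBundle.symmL_trivializationAt (I := 𝓡 n) hp'
  rw [ModelWithCorners.range_eq_univ, mfderivWithin_univ] at h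
  rw [← Bundle.Trivialization.symmL_apply (R := ℝ) _ (by simpa using hp'), h]
  rfl

/-- The local trivialization of a field `x_{ab}` is its expression in the chart. -/
lemma trivializationAt_cov {c p : M} (hp : p ∈ (extChartAt (𝓡 n) c).source)
    (x : CovariantField n M) :
    (trivializationAt (EuclideanSpace ℝ (Fin n) →L[ℝ] EuclideanSpace ℝ (Fin n) →L[ℝ] ℝ)
      (fun p : M ↦ TangentSpace (𝓡 n) p →L[ℝ] TangentSpace (𝓡 n) p →L[ℝ] ℝ) c ⟨p, x p⟩).2 =
      (formAt x p).pull (chartDSymm c (extChartAt (𝓡 n) c p)) := by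
  have := isManifold_one (n := n) (M := M)
  have hp' : p ∈ (chartAt (EuclideanSpace ℝ (Fin n)) c).source := by simpa using hp
  rw [hom_trivializationAt_apply]
  ext v w
  rw [inCoordinates_apply_eq₂ (by simpa using hp') (by simpa using hp') (by simp)]
  rw [trivializationAt_symm_eq hp, trivializationAt_symm_eq hp]
  exact DFunLike.congr_fun (Bundle.Trivial.linearMapAt_trivialization ℝ M ℝ p) _

lemma trivializationAt_dual {c p : M} (hp : p ∈ (extChartAt (𝓡 n) c).source) (α : Covec n) :
    ((trivializationAt (EuclideanSpace ℝ (Fin n) →L[ℝ] ℝ)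
      (fun p : M ↦ TangentSpace (𝓡 n) p →L[ℝ] ℝ) c).symm p α) = α.comp (chartD c p) := by
  have := isManifold_one (n := n) (M := M)
  have hp' : p ∈ (chartAt (EuclideanSpace ℝ (Fin n)) c).source := by simpa using hp
  have hb : p ∈ (trivializationAt (EuclideanSpace ℝ (Fin n)) (TangentSpace (𝓡 n) : M → Type _)
    c).baseSet := by simpa using hp'
  rw [hom_trivializationAt]
  have h := Bundle.Pretrivialization.continuousLinearMap_symm_apply' (σ := RingHom.id ℝ)
    (e₁ := trivializationAt (EuclideanSpace ℝ (Fin n)) (TangentSpace (𝓡 n) : M → Type _) c)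
    (e₂ := trivializationAt ℝ (Bundle.Trivial M ℝ) c) (b := p) ⟨hb, by simp⟩ α
  have h2 := TangentBundle.continuousLinearMapAt_trivializationAt (I := 𝓡 n) hp'
  rw [h2] at h
  refine Eq.trans ?_ (h.trans ?_)
  · rfl
  · ext v
    exact DFunLike.congr_fun (Bundle.Trivial.symmL_trivialization ℝ M ℝ p) _

/-- The local trivialization of a field `T^{ab}` is its expression in the chart. -/
lemma trivializationAt_contra {c p : M} (hp : p ∈ (extChartAt (𝓡 n) c).source)
    (T : ContravariantField n M) :
    (trivializationAt ((EuclideanSpace ℝ (Fin n) →L[ℝ] ℝ) →L[ℝ]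
      (EuclideanSpace ℝ (Fin n) →L[ℝ] ℝ) →L[ℝ] ℝ)
      (fun p : M ↦ (TangentSpace (𝓡 n) p →L[ℝ] ℝ) →L[ℝ]
        (TangentSpace (𝓡 n) p →L[ℝ] ℝ) →L[ℝ] ℝ) c ⟨p, T p⟩).2 =
      (coformAt T p).push (chartD c p) := by
  have := isManifold_one (n := n) (M := M)
  have hp' : p ∈ (chartAt (EuclideanSpace ℝ (Fin n)) c).source := by simpa using hp
  rw [hom_trivializationAt_apply]
  ext α β
  rw [inCoordinates_apply_eq₂ (by simpa using hp') (by simpa using hp') (by simp)]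
  refine (DFunLike.congr_fun (Bundle.Trivial.linearMapAt_trivialization ℝ M ℝ p) _).trans ?_
  have h1 := trivializationAt_dual hp α
  have h2 := trivializationAt_dual hp β
  exact congrArg₂ (fun a b ↦ coformAt T p a b) h1 h2

lemma contDiffOn_of_contMDiffOn {F : Type*} [NormedAddCommGroup F] [NormedSpace ℝ F] {c : M}
    {f : M → F} {h : Vec n → F}
    (hf : ContMDiffOn (𝓡 n) 𝓘(ℝ, F) ∞ f (extChartAt (𝓡 n) c).source)
    (hfh : ∀ p ∈ (extChartAt (𝓡 n) c).source, f p = h (extChartAt (𝓡 n) c p)) :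
    ContDiffOn ℝ ∞ h (extChartAt (𝓡 n) c).target := by
  rw [← contMDiffOn_iff_contDiffOn]
  refine (hf.comp (contMDiffOn_extChartAt_symm c) fun y hy ↦
    (extChartAt (𝓡 n) c).map_target hy).congr fun y hy ↦ ?_
  rw [Function.comp_apply, hfh _ ((extChartAt (𝓡 n) c).map_target hy),
    (extChartAt (𝓡 n) c).right_inv hy]

lemma IsSmoothCov.contDiffOn {x : CovariantField n M} (hx : IsSmoothCov x) (c : M) :
    ContDiffOn ℝ ∞ (coordForm c x) (extChartAt (𝓡 n) c).target := by
  refine contDiffOn_of_contMDiffOn (((Bundle.Trivialization.contMDiffOn_section_iff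
    (trivializationAt (EuclideanSpace ℝ (Fin n) →L[ℝ] EuclideanSpace ℝ (Fin n) →L[ℝ] ℝ)
      (fun p : M ↦ TangentSpace (𝓡 n) p →L[ℝ] TangentSpace (𝓡 n) p →L[ℝ] ℝ) c)
      (isOpen_extChartAt_source c) ?_)).1 hx.contMDiffOn) ?_
  · intro p hp
    simpa using hp
  · intro p hp
    rw [trivializationAt_cov hp, coordForm, (extChartAt (𝓡 n) c).left_inv hp]

lemma IsSmoothContra.contDiffOn {T : ContravariantField n M} (hT : IsSmoothContra T) (c : M) :
    ContDiffOn ℝ ∞ (coordContra c T) (extChartAt (𝓡 n) c).target := by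
  refine contDiffOn_of_contMDiffOn (((Bundle.Trivialization.contMDiffOn_section_iff
    (trivializationAt ((EuclideanSpace ℝ (Fin n) →L[ℝ] ℝ) →L[ℝ]
      (EuclideanSpace ℝ (Fin n) →L[ℝ] ℝ) →L[ℝ] ℝ)
      (fun p : M ↦ (TangentSpace (𝓡 n) p →L[ℝ] ℝ) →L[ℝ]
        (TangentSpace (𝓡 n) p →L[ℝ] ℝ) →L[ℝ] ℝ) c)
      (isOpen_extChartAt_source c) ?_)).1 hT.contMDiffOn) ?_
  · intro p hp
    simpa using hp
  · intro p hp
    rw [trivializationAt_contra hp, coordContra, (extChartAt (𝓡 n) c).left_inv hp]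

/-- A field that is smooth in one chart is smooth on the domain of that chart. -/
lemma contMDiffOn_of_coordForm {x : CovariantField n M} {c : M}
    (hx : ContDiffOn ℝ ∞ (coordForm c x) (extChartAt (𝓡 n) c).target) :
    ContMDiffOn (𝓡 n)
    ((𝓡 n).prod 𝓘(ℝ, EuclideanSpace ℝ (Fin n) →L[ℝ] EuclideanSpace ℝ (Fin n) →L[ℝ] ℝ)) ∞
    (fun p ↦ Bundle.TotalSpace.mk'
      (EuclideanSpace ℝ (Fin n) →L[ℝ] EuclideanSpace ℝ (Fin n) →L[ℝ] ℝ)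
      (E := fun p : M ↦ TangentSpace (𝓡 n) p →L[ℝ] TangentSpace (𝓡 n) p →L[ℝ] ℝ) p (x p))
      (extChartAt (𝓡 n) c).source := by
  refine (Bundle.Trivialization.contMDiffOn_section_iff
    (trivializationAt (EuclideanSpace ℝ (Fin n) →L[ℝ] EuclideanSpace ℝ (Fin n) →L[ℝ] ℝ)
      (fun p : M ↦ TangentSpace (𝓡 n) p →L[ℝ] TangentSpace (𝓡 n) p →L[ℝ] ℝ) c)
      (isOpen_extChartAt_source c) ?_).2 ?_
  · intro p hp
    simpa using hp
  · rw [← contMDiffOn_iff_contDiffOn] at hx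
    refine (hx.comp (contMDiffOn_extChartAt (x := c) |>.mono (by simp)) fun p hp ↦
      (extChartAt (𝓡 n) c).map_source hp).congr fun p hp ↦ ?_
    rw [trivializationAt_cov hp, Function.comp_apply, coordForm, (extChartAt (𝓡 n) c).left_inv hp]

/-- The closure of the set where a field does not vanish. -/
def fieldSupport (x : CovariantField n M) : Set M := closure {p | x p ≠ 0}

omit [IsManifold (𝓡 n) ∞ M] in
lemma formAt_eq_zero {x : CovariantField n M} {p : M} (h : p ∉ fieldSupport x) :
    formAt x p = 0 := by
  by_contra h'
  exact h (subset_closure h')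

omit [IsManifold (𝓡 n) ∞ M] in
lemma fieldSupport_chartField_subset [T2Space M] (c : M) {X : Vec n → Form n}
    (hX : HasCompactSupport X) (hs : tsupport X ⊆ (extChartAt (𝓡 n) c).target) :
    fieldSupport (chartField c X) ⊆ (extChartAt (𝓡 n) c).symm '' tsupport X := by
  have hK : IsCompact ((extChartAt (𝓡 n) c).symm '' tsupport X) :=
    hX.isCompact.image_of_continuousOn ((continuousOn_extChartAt_symm c).mono hs)
  refine closure_minimal (fun p hp ↦ ?_) hK.isClosed
  have hp' : formAt (chartField c X) p ≠ 0 := hp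
  by_cases h : p ∈ (extChartAt (𝓡 n) c).source
  · rw [chartField_apply h] at hp'
    refine ⟨extChartAt (𝓡 n) c p, ?_, (extChartAt (𝓡 n) c).left_inv h⟩
    by_contra hc
    rw [image_eq_zero_of_notMem_tsupport hc] at hp'
    exact hp' (by ext; simp)
  · exact absurd (chartField_apply_of_notMem h X) hp'

/-- Smooth functions of the coordinates with compact support in the chart give test fields. -/
lemma isTestField_chartField [T2Space M] (c : M) {X : Vec n → Form n} (hX : ContDiff ℝ ∞ X)
    (hc : HasCompactSupport X) (hs : tsupport X ⊆ (extChartAt (𝓡 n) c).target) :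
    IsTestField (chartField c X) := by
  have hK : IsCompact ((extChartAt (𝓡 n) c).symm '' tsupport X) :=
    hc.isCompact.image_of_continuousOn ((continuousOn_extChartAt_symm c).mono hs)
  have hsub := fieldSupport_chartField_subset c hc hs
  refine ⟨fun p ↦ ?_, hK.of_isClosed_subset isClosed_closure hsub⟩
  by_cases hp : p ∈ (extChartAt (𝓡 n) c).source
  · refine (contMDiffOn_of_coordForm ?_).contMDiffAt
      ((isOpen_extChartAt_source c).mem_nhds hp)
    exact hX.contDiffOn.congr fun y hy ↦ coordForm_chartField hy X
  · have hp' : p ∉ fieldSupport (chartField c X) := fun h ↦ by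
      obtain ⟨y, hy, rfl⟩ := hsub h
      exact hp ((extChartAt (𝓡 n) c).map_target (hs hy))
    refine ContMDiffAt.congr_of_eventuallyEq (f := fun p ↦ Bundle.TotalSpace.mk'
      (EuclideanSpace ℝ (Fin n) →L[ℝ] EuclideanSpace ℝ (Fin n) →L[ℝ] ℝ)
      (E := fun p : M ↦ TangentSpace (𝓡 n) p →L[ℝ] TangentSpace (𝓡 n) p →L[ℝ] ℝ) p 0)
      ((Bundle.contMDiff_zeroSection ℝ _).contMDiffAt) ?_
    filter_upwards [isClosed_closure.isOpen_compl.mem_nhds hp'] with q hq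
    have : (chartField c X) q = 0 := formAt_eq_zero hq
    rw [this]

end Charts

/-! ### Components as matrices -/

section Matrices

variable {n : ℕ}

/-- The matrix of components of a bilinear form. -/
def formMatrix (x : Form n) : Matrix (Fin n) (Fin n) ℝ :=
  Matrix.of fun i j ↦ x (EuclideanSpace.single i 1) (EuclideanSpace.single j 1)

/-- The matrix of a linear map in the standard basis. -/
def linMatrix (A : Vec n →L[ℝ] Vec n) : Matrix (Fin n) (Fin n) ℝ :=
  Matrix.of fun k i ↦ A (EuclideanSpace.single i 1) k

lemma det_linMatrix (A : Vec n →L[ℝ] Vec n) : (linMatrix A).det = A.det := by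
  have h : linMatrix A = LinearMap.toMatrix (EuclideanSpace.basisFun (Fin n) ℝ).toBasis
      (EuclideanSpace.basisFun (Fin n) ℝ).toBasis (A : Vec n →ₗ[ℝ] Vec n) := by
    ext k i
    simp [linMatrix, LinearMap.toMatrix_apply]
  rw [h, LinearMap.det_toMatrix]

lemma formMatrix_pull (x : Form n) (A : Vec n →L[ℝ] Vec n) :
    formMatrix (x.pull A) = (linMatrix A).transpose * formMatrix x * linMatrix A := by
  ext i j
  simp only [formMatrix, Matrix.of_apply, Form.pull_apply, Matrix.mul_apply, linMatrix,
    Matrix.transpose_apply, Finset.sum_mul]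
  conv_lhs => rw [vec_eq_sum (A (EuclideanSpace.single i 1)), vec_eq_sum (A (EuclideanSpace.single j 1))]
  simp only [map_sum, map_smul, _root_.sum_apply, _root_.smul_apply, smul_eq_mul]
  refine Finset.sum_congr rfl fun k _ ↦ ?_
  rw [Finset.mul_sum]
  refine Finset.sum_congr rfl fun l _ ↦ ?_
  ring

lemma formMatrix_mulVec (x : Form n) (v w : Vec n) :
    x v w = ∑ i, ∑ j, v i * w j * formMatrix x i j := by
  conv_lhs => rw [vec_eq_sum v, vec_eq_sum w]
  simp only [map_sum, map_smul, _root_.sum_apply, _root_.smul_apply, smul_eq_mul, formMatrix,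
    Matrix.of_apply, Finset.mul_sum]
  rw [Finset.sum_comm]
  refine Finset.sum_congr rfl fun i _ ↦ Finset.sum_congr rfl fun j _ ↦ ?_
  ring

lemma det_formMatrix_ne_zero {x : Form n} (hx : ∀ w, (∀ v, x v w = 0) → w = 0) :
    (formMatrix x).det ≠ 0 := by
  intro h
  obtain ⟨w, hw, hw0⟩ := Matrix.exists_mulVec_eq_zero_iff.2 h
  refine hw ?_
  have := hx (WithLp.toLp 2 w) fun v ↦ ?_
  · ext i
    exact congrFun (congrArg WithLp.ofLp this) i
  · rw [formMatrix_mulVec]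
    refine Finset.sum_eq_zero fun i _ ↦ ?_
    have h2 := congrFun hw0 i
    simp only [Matrix.mulVec, dotProduct, Pi.zero_apply] at h2
    simp only [mul_assoc, ← Finset.mul_sum]
    have h3 : ∑ j, w j * formMatrix x i j = 0 := by
      rw [← h2]
      exact Finset.sum_congr rfl fun j _ ↦ mul_comm _ _
    simp [h3]

end Matrices

/-! ### The metric volume in charts -/

section Volume

variable {n : ℕ} {M : Type*} [TopologicalSpace M] [ChartedSpace (EuclideanSpace ℝ (Fin n)) M]
  [IsManifold (𝓡 n) ∞ M]

lemma metricMatrix_eq (g : LorentzMetric n M) (c : M) (y : Vec n) :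
    metricMatrix g c y = formMatrix (coordForm c g.val y) := rfl

/-- A vector in the kernel of the metric is null and orthogonal to a timelike vector, hence zero. -/
lemma metric_nondegenerate (g : LorentzMetric n M) (p : M) (w : Vec n)
    (h : ∀ v, formAt g.val p v w = 0) : w = 0 := by
  obtain ⟨t, ht, hneg⟩ := g.signature p
  by_contra hw
  exact (hneg w hw (h t)).ne (h w)

lemma det_metricMatrix_ne_zero (g : LorentzMetric n M) {c : M} {y : Vec n}
    (hy : y ∈ (extChartAt (𝓡 n) c).target) : (metricMatrix g c y).det ≠ 0 := by
  rw [metricMatrix_eq]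
  refine det_formMatrix_ne_zero fun w hw ↦ ?_
  have h0 : chartDSymm c y w = 0 := by
    refine metric_nondegenerate g ((extChartAt (𝓡 n) c).symm y) _ fun v ↦ ?_
    have h1 := hw (chartD c ((extChartAt (𝓡 n) c).symm y) v)
    have h2 := chartDSymm_chartD ((extChartAt (𝓡 n) c).map_target hy) v
    rw [(extChartAt (𝓡 n) c).right_inv hy] at h2
    rwa [coordForm, Form.pull_apply, h2] at h1
  rw [← chartD_chartDSymm hy w, h0, map_zero]

/-- The density of the metric volume in a chart. -/
def volDensity (g : LorentzMetric n M) (c : M) (y : Vec n) : ℝ := √|(metricMatrix g c y).det|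

lemma volDensity_pos (g : LorentzMetric n M) {c : M} {y : Vec n}
    (hy : y ∈ (extChartAt (𝓡 n) c).target) : 0 < volDensity g c y :=
  Real.sqrt_pos.2 (abs_pos.2 (det_metricMatrix_ne_zero g hy))

lemma contDiffOn_metricMatrix (g : LorentzMetric n M) (c : M) (i j : Fin n) :
    ContDiffOn ℝ ∞ (fun y ↦ metricMatrix g c y i j) (extChartAt (𝓡 n) c).target := by
  have h := g.smooth.contDiffOn c
  exact (h.clm_apply contDiffOn_const).clm_apply contDiffOn_const

lemma contDiffOn_det {ι : Type*} [Fintype ι] [DecidableEq ι] {E : Type*} [NormedAddCommGroup E]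
    [NormedSpace ℝ E] {A : E → Matrix ι ι ℝ} {s : Set E}
    (h : ∀ i j, ContDiffOn ℝ ∞ (fun y ↦ A y i j) s) :
    ContDiffOn ℝ ∞ (fun y ↦ (A y).det) s := by
  simp only [Matrix.det_apply]
  refine ContDiffOn.sum fun σ _ ↦ ?_
  refine ContDiffOn.const_smul _ ?_
  exact contDiffOn_prod fun i _ ↦ h _ _

/-- Since `Real.log` is the logarithm of the absolute value, this displays the smoothness of the
density. -/
lemma volDensity_eq_exp (g : LorentzMetric n M) {c : M} {y : Vec n}
    (hy : y ∈ (extChartAt (𝓡 n) c).target) :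
    volDensity g c y = Real.exp (Real.log (metricMatrix g c y).det / 2) := by
  rw [volDensity, Real.sqrt_eq_rpow, Real.rpow_def_of_pos (abs_pos.2 (det_metricMatrix_ne_zero g hy)),
    Real.log_abs]
  ring_nf

lemma contDiffOn_volDensity (g : LorentzMetric n M) (c : M) :
    ContDiffOn ℝ ∞ (volDensity g c) (extChartAt (𝓡 n) c).target := by
  refine ContDiffOn.congr ?_ fun y hy ↦ volDensity_eq_exp g hy
  refine ContDiffOn.exp (ContDiffOn.div_const (ContDiffOn.log ?_ ?_) _)
  · exact contDiffOn_det fun i j ↦ contDiffOn_metricMatrix g c i j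
  · exact fun y hy ↦ det_metricMatrix_ne_zero g hy

lemma hasFDerivAt_chartChange {c c' : M} {y : Vec n} (hy : y ∈ (extChartAt (𝓡 n) c).target)
    (hy' : (extChartAt (𝓡 n) c).symm y ∈ (extChartAt (𝓡 n) c').source) :
    HasFDerivAt (fun z ↦ extChartAt (𝓡 n) c' ((extChartAt (𝓡 n) c).symm z))
      ((chartD c' ((extChartAt (𝓡 n) c).symm y)).comp (chartDSymm c y)) y := by
  have := isManifold_one (n := n) (M := M)
  have h1 := mdifferentiableWithinAt_extChartAt_symm (I := 𝓡 n) hy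
  rw [ModelWithCorners.range_eq_univ, mdifferentiableWithinAt_univ] at h1
  have h2 : MDifferentiableAt (𝓡 n) 𝓘(ℝ, EuclideanSpace ℝ (Fin n)) (extChartAt (𝓡 n) c')
    ((extChartAt (𝓡 n) c).symm y) := mdifferentiableAt_extChartAt (by simpa using hy')
  exact (h2.hasMFDerivAt.comp y h1.hasMFDerivAt).hasFDerivAt

lemma coordForm_change {c c' : M} {y : Vec n}
    (hy' : (extChartAt (𝓡 n) c).symm y ∈ (extChartAt (𝓡 n) c').source) (x : CovariantField n M) :
    coordForm c x y =
      (coordForm c' x (extChartAt (𝓡 n) c' ((extChartAt (𝓡 n) c).symm y))).pull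
        ((chartD c' ((extChartAt (𝓡 n) c).symm y)).comp (chartDSymm c y)) := by
  ext v w
  simp only [coordForm, Form.pull_apply, ContinuousLinearMap.comp_apply]
  rw [chartDSymm_chartD hy', chartDSymm_chartD hy', (extChartAt (𝓡 n) c').left_inv hy']

/-- The volume density is multiplied by the Jacobian determinant of the change of charts. -/
lemma volDensity_change (g : LorentzMetric n M) {c c' : M} {y : Vec n}
    (hy' : (extChartAt (𝓡 n) c).symm y ∈ (extChartAt (𝓡 n) c').source) :
    volDensity g c y =
      |((chartD c' ((extChartAt (𝓡 n) c).symm y)).comp (chartDSymm c y)).det| *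
      volDensity g c' (extChartAt (𝓡 n) c' ((extChartAt (𝓡 n) c).symm y)) := by
  rw [volDensity, metricMatrix_eq, coordForm_change hy', formMatrix_pull, Matrix.det_mul,
    Matrix.det_mul, Matrix.det_transpose, det_linMatrix, volDensity, metricMatrix_eq]
  set a := ((chartD c' ((extChartAt (𝓡 n) c).symm y)).comp (chartDSymm c y)).det
  rw [mul_right_comm, abs_mul, Real.sqrt_mul (abs_nonneg _), abs_mul, Real.sqrt_mul_self (abs_nonneg _)]

omit [IsManifold (𝓡 n) ∞ M] in
lemma measurableSet_chart_preimage [MeasurableSpace M] [BorelSpace M] (c : M) {A : Set M}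
    (hA : MeasurableSet A) :
    MeasurableSet ((extChartAt (𝓡 n) c).symm ⁻¹' A ∩ (extChartAt (𝓡 n) c).target) := by
  have h1 := (continuousOn_extChartAt_symm (I := 𝓡 n) c).domRestrict.measurable hA
  have h2 := (isOpen_extChartAt_target (I := 𝓡 n) c).measurableSet.subtype_image h1
  convert h2 using 1
  ext y
  simp [and_comm]

lemma chartVolume_apply [MeasurableSpace M] [BorelSpace M] (g : LorentzMetric n M) (c : M)
    {A : Set M} (hA : MeasurableSet A) :
    chartVolume g c A = ∫⁻ y in (extChartAt (𝓡 n) c).symm ⁻¹' A ∩ (extChartAt (𝓡 n) c).target,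
      ENNReal.ofReal (volDensity g c y) := by
  have hm : AEMeasurable (extChartAt (𝓡 n) c).symm
      ((volume : Measure (EuclideanSpace ℝ (Fin n))).restrict (extChartAt (𝓡 n) c).target) :=
    (continuousOn_extChartAt_symm c).aemeasurable (isOpen_extChartAt_target c).measurableSet
  rw [chartVolume, Measure.map_apply_of_aemeasurable (hm.mono_ac (withDensity_absolutelyContinuous _ _)) hA,
    withDensity_apply', Measure.restrict_restrict' (isOpen_extChartAt_target c).measurableSet]
  rfl

lemma chartVolume_compl_source [MeasurableSpace M] [BorelSpace M] (g : LorentzMetric n M) (c : M) :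
    chartVolume g c (extChartAt (𝓡 n) c).sourceᶜ = 0 := by
  rw [chartVolume_apply g c (isOpen_extChartAt_source c).measurableSet.compl]
  have : (extChartAt (𝓡 n) c).symm ⁻¹' (extChartAt (𝓡 n) c).sourceᶜ ∩ (extChartAt (𝓡 n) c).target
      = ∅ := by
    ext y
    simp only [mem_inter_iff, mem_preimage, mem_compl_iff, mem_empty_iff_false, iff_false, not_and]
    exact fun h hy ↦ h ((extChartAt (𝓡 n) c).map_target hy)
  rw [this]
  simp

lemma chartVolume_diff_source [MeasurableSpace M] [BorelSpace M] (g : LorentzMetric n M) (c : M)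
    (A : Set M) : chartVolume g c (A \ (extChartAt (𝓡 n) c).source) = 0 :=
  measure_mono_null (fun _ hx ↦ hx.2) (chartVolume_compl_source g c)

/-- The volumes of two charts agree where both are defined: the change of variables formula. -/
lemma chartVolume_eq [MeasurableSpace M] [BorelSpace M] (g : LorentzMetric n M) {c c' : M}
    {A : Set M} (hA : MeasurableSet A) (h : A ⊆ (extChartAt (𝓡 n) c).source)
    (h' : A ⊆ (extChartAt (𝓡 n) c').source) : chartVolume g c A = chartVolume g c' A := by
  rw [chartVolume_apply g c hA, chartVolume_apply g c' hA]
  set B := (extChartAt (𝓡 n) c).symm ⁻¹' A ∩ (extChartAt (𝓡 n) c).target with hB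
  have himg : (extChartAt (𝓡 n) c').symm ⁻¹' A ∩ (extChartAt (𝓡 n) c').target =
      (fun z ↦ extChartAt (𝓡 n) c' ((extChartAt (𝓡 n) c).symm z)) '' B := by
    ext y
    constructor
    · rintro ⟨hy, hy'⟩
      refine ⟨extChartAt (𝓡 n) c ((extChartAt (𝓡 n) c').symm y), ⟨?_, ?_⟩, ?_⟩
      · rw [mem_preimage, (extChartAt (𝓡 n) c).left_inv (h hy)]
        exact hy
      · exact (extChartAt (𝓡 n) c).map_source (h hy)
      · beta_reduce
        rw [(extChartAt (𝓡 n) c).left_inv (h hy), (extChartAt (𝓡 n) c').right_inv hy']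
    · rintro ⟨z, ⟨hz, hz'⟩, rfl⟩
      refine ⟨?_, (extChartAt (𝓡 n) c').map_source (h' hz)⟩
      rw [mem_preimage, (extChartAt (𝓡 n) c').left_inv (h' hz)]
      exact hz
  rw [himg, lintegral_image_eq_lintegral_abs_det_fderiv_mul volume
    (measurableSet_chart_preimage c hA) (fun y hy ↦
      (hasFDerivAt_chartChange hy.2 (h' hy.1)).hasFDerivWithinAt)]
  · refine setLIntegral_congr_fun (measurableSet_chart_preimage c hA) fun y hy ↦ ?_
    beta_reduce
    rw [volDensity_change g (h' hy.1), ENNReal.ofReal_mul (abs_nonneg _)]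
  · intro y hy z hz hyz
    have := (extChartAt (𝓡 n) c').injOn (h' hy.1) (h' hz.1) hyz
    exact (extChartAt (𝓡 n) c).symm.injOn hy.2 hz.2 this

/-- On the domain of a chart, the metric volume is the volume of the chart. -/
lemma metricVolume_restrict [MeasurableSpace M] [BorelSpace M] (g : LorentzMetric n M) (c : M) :
    (metricVolume g).restrict (extChartAt (𝓡 n) c).source = chartVolume g c := by
  have hS : MeasurableSet (extChartAt (𝓡 n) c).source := (isOpen_extChartAt_source c).measurableSet
  -- `chartVolume g c`, increased to infinity off the chart, bounds the volumes of all charts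
  have hle : metricVolume g ≤ chartVolume g c + (⊤ : Measure M).restrict (extChartAt (𝓡 n) c).sourceᶜ := by
    refine iSup_le fun c' ↦ Measure.le_iff.2 fun A hA ↦ ?_
    rw [← measure_inter_add_sdiff A hS, Measure.add_apply]
    refine add_le_add ?_ ?_
    · have hA' := hA.inter hS
      have hS' : MeasurableSet (extChartAt (𝓡 n) c').source :=
        (isOpen_extChartAt_source c').measurableSet
      rw [← measure_inter_add_sdiff (A ∩ (extChartAt (𝓡 n) c).source) hS',
        chartVolume_diff_source, add_zero,
        chartVolume_eq g (hA'.inter hS') (c := c') (c' := c) (fun x hx ↦ hx.2) (fun x hx ↦ hx.1.2)]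
      exact measure_mono fun x hx ↦ hx.1.1
    · rw [Measure.restrict_apply hA]
      exact Measure.le_iff'.1 le_top _
  refine le_antisymm (Measure.le_iff.2 fun A hA ↦ ?_) (Measure.le_iff.2 fun A hA ↦ ?_)
  · rw [Measure.restrict_apply hA]
    refine (Measure.le_iff'.1 hle _).trans ?_
    rw [Measure.add_apply, Measure.restrict_apply (hA.inter hS)]
    have : A ∩ (extChartAt (𝓡 n) c).source ∩ (extChartAt (𝓡 n) c).sourceᶜ = ∅ := by
      ext x; simp
    rw [this, measure_empty, add_zero]
    exact measure_mono inter_subset_left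
  · rw [Measure.restrict_apply hA, ← measure_inter_add_sdiff A hS, chartVolume_diff_source, add_zero]
    exact Measure.le_iff'.1 (le_iSup (fun c ↦ chartVolume g c) c) _

lemma contDiffOn_contract_coord {T : ContravariantField n M} (hT : IsSmoothContra T)
    {x : CovariantField n M} (hx : IsSmoothCov x) (c : M) :
    ContDiffOn ℝ ∞ (fun y ↦ contract (coordContra c T y) (coordForm c x y))
      (extChartAt (𝓡 n) c).target := by
  have h1 := hT.contDiffOn c
  have h2 := hx.contDiffOn c
  unfold contract
  refine ContDiffOn.sum fun i _ ↦ ContDiffOn.sum fun j _ ↦ ContDiffOn.mul ?_ ?_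
  · exact (h1.clm_apply contDiffOn_const).clm_apply contDiffOn_const
  · exact (h2.clm_apply contDiffOn_const).clm_apply contDiffOn_const

lemma continuous_contract {T : ContravariantField n M} (hT : IsSmoothContra T)
    {x : CovariantField n M} (hx : IsSmoothCov x) :
    Continuous fun p ↦ contract (coformAt T p) (formAt x p) := by
  rw [continuous_iff_continuousAt]
  intro p
  have h1 : ContinuousAt (fun y ↦ contract (coordContra p T y) (coordForm p x y))
      (extChartAt (𝓡 n) p p) :=
    (contDiffOn_contract_coord hT hx p).continuousOn.continuousAt (extChartAt_target_mem_nhds p)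
  refine (h1.comp (continuousAt_extChartAt p)).congr ?_
  filter_upwards [extChartAt_source_mem_nhds (I := 𝓡 n) p] with q hq
  rw [Function.comp_apply, contract_coord hq]

lemma action_eq [MeasurableSpace M] (g : LorentzMetric n M) (T : ContravariantField n M)
    (x : CovariantField n M) :
    action g T x = ∫ p, contract (coformAt T p) (formAt x p) ∂(metricVolume g) := rfl

instance isLocallyFinite_metricVolume [MeasurableSpace M] [BorelSpace M] (g : LorentzMetric n M) :
    IsLocallyFiniteMeasure (metricVolume g) := by
  refine ⟨fun p ↦ ?_⟩
  have ht := isOpen_extChartAt_target (I := 𝓡 n) p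
  obtain ⟨K, hK, hpK, hKt⟩ := exists_compact_subset ht (mem_extChartAt_target (I := 𝓡 n) p)
  have hcont : ContinuousOn (volDensity g p) K :=
    (contDiffOn_volDensity g p).continuousOn.mono hKt
  have hopen : IsOpen ((extChartAt (𝓡 n) p).source ∩ extChartAt (𝓡 n) p ⁻¹' interior K) :=
    isOpen_extChartAt_preimage' p isOpen_interior
  refine ⟨(extChartAt (𝓡 n) p).source ∩ extChartAt (𝓡 n) p ⁻¹' interior K, hopen.mem_nhds
    ⟨mem_extChartAt_source p, hpK⟩, ?_⟩
  rw [← inter_self (extChartAt (𝓡 n) p).source, inter_assoc, inter_comm,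
    ← Measure.restrict_apply hopen.measurableSet, metricVolume_restrict,
    chartVolume_apply g p hopen.measurableSet]
  have hint : IntegrableOn (volDensity g p) K := hcont.integrableOn_compact hK
  refine lt_of_le_of_lt (lintegral_mono_set (t := K) ?_) hint.setLIntegral_lt_top
  rintro y ⟨hy, hy'⟩
  have := interior_subset hy.2
  rwa [(extChartAt (𝓡 n) p).right_inv hy'] at this

lemma integrable_contract [T2Space M] [SecondCountableTopology M] [MeasurableSpace M] [BorelSpace M]
    (g : LorentzMetric n M) {T : ContravariantField n M} (hT : IsSmoothContra T)
    {x : CovariantField n M} (hx : IsTestField x) :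
    Integrable (fun p ↦ contract (coformAt T p) (formAt x p)) (metricVolume g) := by
  have := ChartedSpace.locallyCompactSpace (EuclideanSpace ℝ (Fin n)) M
  refine (continuous_contract hT hx.1).integrable_of_hasCompactSupport ?_
  refine HasCompactSupport.intro hx.2 fun p hp ↦ ?_
  rw [formAt_eq_zero hp, contract_zero]

lemma action_add [T2Space M] [SecondCountableTopology M] [MeasurableSpace M] [BorelSpace M]
    (g : LorentzMetric n M) {T : ContravariantField n M} (hT : IsSmoothContra T)
    {x y : CovariantField n M} (hx : IsTestField x) (hy : IsTestField y) :
    action g T (x + y) = action g T x + action g T y := by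
  simp only [action_eq]
  rw [← integral_add (integrable_contract g hT hx) (integrable_contract g hT hy)]
  exact integral_congr_ae (.of_forall fun p ↦ contract_add _ _ _)

lemma action_smul [MeasurableSpace M]
    (g : LorentzMetric n M) (T : ContravariantField n M) (a : ℝ) (x : CovariantField n M) :
    action g T (a • x) = a * action g T x := by
  simp only [action_eq]
  rw [← integral_const_mul]
  exact integral_congr_ae (.of_forall fun p ↦ contract_smul _ _ _)

lemma smul_action [MeasurableSpace M]
    (g : LorentzMetric n M) (T : ContravariantField n M) (a : ℝ) (x : CovariantField n M) :
    action g (a • T) x = a * action g T x := by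
  simp only [action_eq]
  rw [← integral_const_mul]
  exact integral_congr_ae (.of_forall fun p ↦ smul_contract _ _ _)

/-- The action of `T` on a field supported in a chart domain, as an integral over the coordinates. -/
lemma action_chart [T2Space M] [SecondCountableTopology M] [MeasurableSpace M] [BorelSpace M]
    (g : LorentzMetric n M) {T : ContravariantField n M} (hT : IsSmoothContra T)
    {x : CovariantField n M} (hx : IsTestField x) (c : M)
    (hs : fieldSupport x ⊆ (extChartAt (𝓡 n) c).source) :
    action g T x = ∫ y in (extChartAt (𝓡 n) c).target,
      volDensity g c y * contract (coordContra c T y) (coordForm c x y) := by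
  have ht := (isOpen_extChartAt_target (I := 𝓡 n) c).measurableSet
  have hm : AEMeasurable (extChartAt (𝓡 n) c).symm
      ((volume : Measure (EuclideanSpace ℝ (Fin n))).restrict (extChartAt (𝓡 n) c).target) :=
    (continuousOn_extChartAt_symm c).aemeasurable ht
  have hd : AEMeasurable (fun y ↦ ENNReal.ofReal (volDensity g c y))
      ((volume : Measure (EuclideanSpace ℝ (Fin n))).restrict (extChartAt (𝓡 n) c).target) :=
    ((contDiffOn_volDensity g c).continuousOn.aemeasurable ht).ennreal_ofReal
  rw [action_eq, ← setIntegral_eq_integral_of_forall_compl_eq_zero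
    (s := (extChartAt (𝓡 n) c).source) (fun p hp ↦ by
      rw [formAt_eq_zero (fun h ↦ hp (hs h)), contract_zero]), metricVolume_restrict]
  change ∫ p, _ ∂(Measure.map _ (Measure.withDensity _ fun y ↦ ENNReal.ofReal (volDensity g c y))) = _
  rw [integral_map (hm.mono_ac (withDensity_absolutelyContinuous _ _))
    (continuous_contract hT hx.1).aestronglyMeasurable,
    integral_withDensity_eq_integral_toReal_smul₀ hd (by simp)]
  refine setIntegral_congr_fun ht fun y hy ↦ ?_
  rw [ENNReal.toReal_ofReal (volDensity_pos g hy).le, smul_eq_mul]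
  have := contract_coord ((extChartAt (𝓡 n) c).map_target hy) T x
  rw [(extChartAt (𝓡 n) c).right_inv hy] at this
  rw [this]

end Volume

/-! ### Determinants and derivatives -/

section Analysis

lemma contDiff_of_tsupport_subset {E F : Type*} [NormedAddCommGroup E] [NormedSpace ℝ E]
    [NormedAddCommGroup F] [NormedSpace ℝ F] {f : E → F} {s : Set E} (hs : IsOpen s)
    (hf : ContDiffOn ℝ ∞ f s) (ht : tsupport f ⊆ s) : ContDiff ℝ ∞ f := by
  rw [contDiff_iff_contDiffAt]
  intro y
  by_cases hy : y ∈ tsupport f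
  · exact hf.contDiffAt (hs.mem_nhds (ht hy))
  · have : f =ᶠ[𝓝 y] fun _ ↦ 0 := notMem_tsupport_iff_eventuallyEq.1 hy
    exact contDiffAt_const.congr_of_eventuallyEq this

/-- Jacobi's formula for the derivative of a determinant. -/
lemma hasFDerivAt_det {ι : Type*} [Fintype ι] [DecidableEq ι] {E : Type*} [NormedAddCommGroup E]
    [NormedSpace ℝ E] {A : E → Matrix ι ι ℝ} {A' : ι → ι → E →L[ℝ] ℝ} {y : E}
    (h : ∀ i j, HasFDerivAt (fun z ↦ A z i j) (A' i j) y) :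
    HasFDerivAt (fun z ↦ (A z).det) (∑ i, ∑ k, (A y).adjugate i k • A' k i) y := by
  have h1 : HasFDerivAt (fun z ↦ ∑ σ : Equiv.Perm ι, ((Equiv.Perm.sign σ : ℤ) : ℝ) *
      ∏ i, A z (σ i) i) (∑ σ : Equiv.Perm ι, ((Equiv.Perm.sign σ : ℤ) : ℝ) •
        ∑ i, (∏ j ∈ Finset.univ.erase i, A y (σ j) j) • A' (σ i) i) y := by
    refine HasFDerivAt.fun_sum fun σ _ ↦ HasFDerivAt.const_mul ?_ _
    exact HasFDerivAt.finsetProd fun i _ ↦ h _ _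
  have h2 : (fun z ↦ (A z).det) = fun z ↦ ∑ σ : Equiv.Perm ι, ((Equiv.Perm.sign σ : ℤ) : ℝ) *
      ∏ i, A z (σ i) i := by
    funext z
    rw [Matrix.det_apply']
  rw [h2]
  convert h1 using 1
  ext v
  simp only [_root_.sum_apply, _root_.smul_apply, smul_eq_mul, Finset.mul_sum]
  rw [Finset.sum_comm]
  have h3 : ∀ i, ∑ k, (A y).adjugate i k * A' k i v =
      ((A y).updateCol i fun k ↦ A' k i v).det := by
    intro i
    rw [← Matrix.cramer_apply, Matrix.cramer_eq_adjugate_mulVec]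
    rfl
  rw [Finset.sum_comm]
  conv_lhs => enter [2, i]; rw [h3 i, Matrix.det_apply']
  rw [Finset.sum_comm]
  refine Finset.sum_congr rfl fun σ _ ↦ Finset.sum_congr rfl fun i _ ↦ ?_
  rw [← Finset.mul_prod_erase _ _ (Finset.mem_univ i)]
  rw [Matrix.updateCol_self]
  have h4 : ∏ x ∈ Finset.univ.erase i, ((A y).updateCol i fun k ↦ A' k i v) (σ x) x =
      ∏ x ∈ Finset.univ.erase i, A y (σ x) x :=
    Finset.prod_congr rfl fun x hx ↦ by rw [Matrix.updateCol_ne (Finset.ne_of_mem_erase hx)]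
  rw [h4]
  ring

lemma integral_fderiv_eq_zero {n : ℕ} {W : Vec n → ℝ} (hW : ContDiff ℝ ∞ W)
    (hc : HasCompactSupport W) (v : Vec n) : ∫ y, fderiv ℝ W y v = 0 := by
  have hd : Continuous fun y ↦ fderiv ℝ W y v :=
    (hW.continuous_fderiv (by simp)).clm_apply continuous_const
  have hi : Integrable fun y ↦ fderiv ℝ W y v :=
    hd.integrable_of_hasCompactSupport ((hc.fderiv ℝ).comp_left (g := fun L : Vec n →L[ℝ] ℝ ↦ L v) rfl)
  have := integral_mul_fderiv_eq_neg_fderiv_mul_of_integrable (μ := (volume : Measure (Vec n)))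
    (f := fun _ : Vec n ↦ (1 : ℝ)) (g := W) (v := v) (by simp) (by simpa using hi)
    (by simpa using hW.continuous.integrable_of_hasCompactSupport hc) (by simp)
    (fun y _ ↦ (hW.differentiable (by simp)) y)
  simpa using this

lemma contDiffOn_inv_matrix {ι : Type*} [Fintype ι] [DecidableEq ι] {E : Type*}
    [NormedAddCommGroup E] [NormedSpace ℝ E] {A : E → Matrix ι ι ℝ} {s : Set E}
    (h : ∀ i j, ContDiffOn ℝ ∞ (fun y ↦ A y i j) s) (h0 : ∀ y ∈ s, (A y).det ≠ 0) (i j : ι) :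
    ContDiffOn ℝ ∞ (fun y ↦ (A y)⁻¹ i j) s := by
  have h1 : ∀ y, (A y)⁻¹ i j = ((A y).det)⁻¹ * ((A y).updateRow j (Pi.single i 1)).det := by
    intro y
    rw [Matrix.inv_def, Matrix.smul_apply, smul_eq_mul, Ring.inverse_eq_inv', Matrix.adjugate_apply]
  simp only [h1]
  refine ((contDiffOn_det h).inv h0).mul (contDiffOn_det fun k l ↦ ?_)
  by_cases hk : k = j
  · subst hk
    simp only [Matrix.updateRow_self]
    exact contDiffOn_const
  · simp only [Matrix.updateRow_ne hk]
    exact h k l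

lemma contDiffOn_partialDeriv {n : ℕ} {f : Vec n → ℝ} {s : Set (Vec n)} (hs : IsOpen s)
    (hf : ContDiffOn ℝ ∞ f s) (i : Fin n) : ContDiffOn ℝ ∞ (partialDeriv i f) s :=
  (hf.fderiv_of_isOpen hs (by simp)).clm_apply contDiffOn_const

end Analysis

/-! ### The covariant derivative and integration by parts -/

section Divergence

variable {n : ℕ} {M : Type*} [TopologicalSpace M] [ChartedSpace (EuclideanSpace ℝ (Fin n)) M]
  [IsManifold (𝓡 n) ∞ M]

lemma contDiffOn_christoffel (g : LorentzMetric n M) (c : M) (k i j : Fin n) :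
    ContDiffOn ℝ ∞ (christoffel g c k i j) (extChartAt (𝓡 n) c).target := by
  have ht := isOpen_extChartAt_target (I := 𝓡 n) c
  have hp : ∀ i j k, ContDiffOn ℝ ∞ (partialDeriv i fun z ↦ metricMatrix g c z j k)
      (extChartAt (𝓡 n) c).target :=
    fun i j k ↦ contDiffOn_partialDeriv ht (contDiffOn_metricMatrix g c j k) i
  unfold christoffel
  refine contDiffOn_const.mul (ContDiffOn.sum fun l _ ↦ ContDiffOn.mul ?_ ?_)
  · exact contDiffOn_inv_matrix (contDiffOn_metricMatrix g c)
      (fun y hy ↦ det_metricMatrix_ne_zero g hy) k l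
  · exact ((hp i l j).add (hp j l i)).sub (hp l i j)

/-- The form `Γ^k_{ij} ξ_k`. -/
def gammaForm (g : LorentzMetric n M) (c : M) (y : Vec n) (ξ : Covec n) : Form n :=
  ∑ i, ∑ j, (∑ k, christoffel g c k i j y * ξ (EuclideanSpace.single k 1)) •
    outer (EuclideanSpace.proj i) (EuclideanSpace.proj j)

/-- The covariant derivative `∇_i v_j = ∂_i v_j - Γ^k_{ij} v_k` in the chart at `c`; the first
argument of the form is the direction of differentiation. -/
def covDeriv (g : LorentzMetric n M) (c : M) (v : Vec n → Covec n) (y : Vec n) : Form n :=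
  fderiv ℝ v y - gammaForm g c y (v y)

lemma gammaForm_apply (g : LorentzMetric n M) (c : M) (y : Vec n) (ξ : Covec n) (a b : Vec n) :
    gammaForm g c y ξ a b = ∑ i, ∑ j, (∑ k, christoffel g c k i j y *
      ξ (EuclideanSpace.single k 1)) * (a i * b j) := by
  simp only [gammaForm, _root_.sum_apply, _root_.smul_apply, outer_apply, smul_eq_mul]
  rfl

lemma gammaForm_single (g : LorentzMetric n M) (c : M) (y : Vec n) (ξ : Covec n) (i j : Fin n) :
    gammaForm g c y ξ (EuclideanSpace.single i 1) (EuclideanSpace.single j 1) =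
      ∑ k, christoffel g c k i j y * ξ (EuclideanSpace.single k 1) := by
  rw [gammaForm_apply]
  simp

lemma contDiffOn_gammaForm (g : LorentzMetric n M) (c : M) {v : Vec n → Covec n} {s : Set (Vec n)}
    (hs : s ⊆ (extChartAt (𝓡 n) c).target)
    (hv : ContDiffOn ℝ ∞ v s) :
    ContDiffOn ℝ ∞ (fun y ↦ gammaForm g c y (v y)) s := by
  unfold gammaForm
  refine ContDiffOn.sum fun i _ ↦ ContDiffOn.sum fun j _ ↦ ContDiffOn.fun_smul ?_ contDiffOn_const
  refine ContDiffOn.sum fun k _ ↦ ((contDiffOn_christoffel g c k i j).mono hs).mul ?_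
  exact hv.clm_apply contDiffOn_const

lemma gammaForm_zero (g : LorentzMetric n M) (c : M) (y : Vec n) : gammaForm g c y 0 = 0 := by
  simp [gammaForm]

lemma gammaForm_smul (g : LorentzMetric n M) (c : M) (y : Vec n) (a : ℝ) (ξ : Covec n) :
    gammaForm g c y (a • ξ) = a • gammaForm g c y ξ := by
  simp only [gammaForm, Finset.smul_sum, smul_smul]
  refine Finset.sum_congr rfl fun i _ ↦ Finset.sum_congr rfl fun j _ ↦ ?_
  rw [Finset.mul_sum]
  congr 1
  refine Finset.sum_congr rfl fun k _ ↦ ?_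
  rw [_root_.smul_apply, smul_eq_mul]
  ring

lemma tsupport_covDeriv_subset (g : LorentzMetric n M) (c : M) (v : Vec n → Covec n) :
    tsupport (covDeriv g c v) ⊆ tsupport v := by
  refine closure_minimal (fun y hy ↦ ?_) (isClosed_tsupport v)
  by_contra h
  refine hy ?_
  rw [covDeriv, image_eq_zero_of_notMem_tsupport h, gammaForm_zero,
    (notMem_tsupport_iff_eventuallyEq.1 h).fderiv_eq]
  simp

lemma contDiff_covDeriv (g : LorentzMetric n M) (c : M) {v : Vec n → Covec n}
    (hv : ContDiff ℝ ∞ v) (hs : tsupport v ⊆ (extChartAt (𝓡 n) c).target) :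
    ContDiff ℝ ∞ (covDeriv g c v) := by
  refine contDiff_of_tsupport_subset (isOpen_extChartAt_target (I := 𝓡 n) c) ?_
    ((tsupport_covDeriv_subset g c v).trans hs)
  exact (hv.fderiv_right (by simp)).contDiffOn.sub
    (contDiffOn_gammaForm g c subset_rfl hv.contDiffOn)

lemma hasCompactSupport_covDeriv (g : LorentzMetric n M) (c : M) {v : Vec n → Covec n}
    (hv : HasCompactSupport v) : HasCompactSupport (covDeriv g c v) :=
  hv.of_isClosed_subset (isClosed_tsupport _) (tsupport_covDeriv_subset g c v)

lemma metricMatrix_symm (g : LorentzMetric n M) (c : M) (y : Vec n) (i j : Fin n) :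
    metricMatrix g c y i j = metricMatrix g c y j i := g.symm _ _ _

/-- The derivative of the volume density: `∂_i √|det g| = √|det g| Γ^k_{ki}`. -/
lemma partialDeriv_volDensity (g : LorentzMetric n M) {c : M} {y : Vec n}
    (hy : y ∈ (extChartAt (𝓡 n) c).target) (i : Fin n) :
    partialDeriv i (volDensity g c) y = volDensity g c y * ∑ k, christoffel g c k k i y := by
  have ht := isOpen_extChartAt_target (I := 𝓡 n) c
  have hG : ∀ j k, HasFDerivAt (fun z ↦ metricMatrix g c z j k)
      (fderiv ℝ (fun z ↦ metricMatrix g c z j k) y) y := fun j k ↦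
    (((contDiffOn_metricMatrix g c j k).contDiffAt (ht.mem_nhds hy)).differentiableAt
      (by simp)).hasFDerivAt
  have hdet := hasFDerivAt_det hG
  have h0 := det_metricMatrix_ne_zero g hy
  have hexp := ((hdet.log h0).mul_const (2⁻¹ : ℝ)).exp
  have heq : volDensity g c =ᶠ[𝓝 y] fun z ↦
      Real.exp (Real.log (metricMatrix g c z).det * 2⁻¹) := by
    filter_upwards [ht.mem_nhds hy] with z hz
    rw [volDensity_eq_exp g hz, div_eq_mul_inv]
  rw [partialDeriv, heq.fderiv_eq, hexp.fderiv, heq.self_of_nhds]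
  simp only [_root_.smul_apply, smul_eq_mul, _root_.sum_apply]
  congr 1
  have hinv : ∀ a b, (metricMatrix g c y)⁻¹ a b =
      (metricMatrix g c y).det⁻¹ * (metricMatrix g c y).adjugate a b := fun a b ↦ by
    rw [Matrix.inv_def, Matrix.smul_apply, smul_eq_mul, Ring.inverse_eq_inv']
  have hsymmG : (metricMatrix g c y).transpose = metricMatrix g c y := by
    ext a b; exact metricMatrix_symm g c y b a
  have hinvsymm : ∀ a b, (metricMatrix g c y)⁻¹ a b = (metricMatrix g c y)⁻¹ b a := fun a b ↦ by
    conv_lhs => rw [← hsymmG, ← Matrix.transpose_nonsing_inv, Matrix.transpose_apply]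
  have hflip : ∀ a b, (fun z ↦ metricMatrix g c z a b) = fun z ↦ metricMatrix g c z b a :=
    fun a b ↦ funext fun z ↦ metricMatrix_symm g c z a b
  simp only [christoffel]
  rw [← Finset.mul_sum]
  congr 1
  simp only [mul_sub, mul_add, Finset.sum_sub_distrib, Finset.sum_add_distrib]
  have h1 : ∑ k, ∑ l, (metricMatrix g c y)⁻¹ k l * partialDeriv k (fun z ↦ metricMatrix g c z l i) y
      = ∑ k, ∑ l, (metricMatrix g c y)⁻¹ k l * partialDeriv l (fun z ↦ metricMatrix g c z k i) y := by
    rw [Finset.sum_comm]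
    refine Finset.sum_congr rfl fun k _ ↦ Finset.sum_congr rfl fun l _ ↦ ?_
    rw [hinvsymm]
  rw [h1, add_sub_cancel_left, Finset.mul_sum]
  refine Finset.sum_congr rfl fun k _ ↦ ?_
  rw [Finset.mul_sum]
  refine Finset.sum_congr rfl fun l _ ↦ ?_
  rw [hinv, partialDeriv]
  ring

omit [IsManifold (𝓡 n) ∞ M] in
lemma components_eq (T : ContravariantField n M) (c : M) (i j : Fin n) (y : Vec n) :
    components T c i j y = coordContra c T y (EuclideanSpace.proj i) (EuclideanSpace.proj j) := rfl

/-- The pointwise product rule behind the integration by parts: `d` is the density, `t`, `t'` are the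
components of the tensor and their derivatives, and `G` are the Christoffel symbols. -/
lemma divergence_sum_identity (d : ℝ) (t t' D : Fin n → Fin n → ℝ) (v : Fin n → ℝ)
    (G : Fin n → Fin n → Fin n → ℝ) :
    d * ∑ i, ∑ j, t i j * (D i j - ∑ k, G k i j * v k) -
      ∑ i, ∑ j, (d * t i j * D i j + (d * t' i j + d * (∑ k, G k k i) * t i j) * v j) =
    -∑ j, d * v j * ∑ i, (t' i j + ∑ k, (G i i k * t k j + G j i k * t i k)) := by
  have hA : ∑ j, ∑ i, ∑ k, d * v j * (G j i k * t i k) =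
      ∑ i, ∑ j, ∑ k, d * t i j * (G k i j * v k) := by
    rw [Finset.sum_comm]
    refine Finset.sum_congr rfl fun i _ ↦ ?_
    rw [Finset.sum_comm]
    refine Finset.sum_congr rfl fun j _ ↦ Finset.sum_congr rfl fun k _ ↦ ?_
    ring
  have hB : ∑ j, ∑ i, ∑ k, d * v j * (G i i k * t k j) =
      ∑ i, ∑ j, ∑ k, d * G k k i * t i j * v j := by
    conv_rhs => rw [Finset.sum_comm]
    refine Finset.sum_congr rfl fun j _ ↦ ?_
    rw [Finset.sum_comm]
    refine Finset.sum_congr rfl fun i _ ↦ Finset.sum_congr rfl fun k _ ↦ ?_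
    ring
  have hC : ∑ j, ∑ i, d * v j * t' i j = ∑ i, ∑ j, d * t' i j * v j := by
    rw [Finset.sum_comm]
    refine Finset.sum_congr rfl fun i _ ↦ Finset.sum_congr rfl fun j _ ↦ ?_
    ring
  simp only [mul_sub, mul_add, add_mul, Finset.mul_sum, Finset.sum_mul, Finset.sum_add_distrib,
    Finset.sum_sub_distrib] at hA hB hC ⊢
  rw [hA, hB, hC]
  simp only [mul_assoc]
  ring

/-- A conserved field annihilates the covariant derivatives of covector fields with compact
support in a chart: integrate by parts. -/
lemma action_covDeriv [T2Space M] [SecondCountableTopology M] [MeasurableSpace M] [BorelSpace M]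
    (g : LorentzMetric n M) {T : ContravariantField n M} (hT : IsSmoothContra T)
    (hcons : IsConserved g T) (c : M) {v : Vec n → Covec n} (hv : ContDiff ℝ ∞ v)
    (hc : HasCompactSupport v) (hs : tsupport v ⊆ (extChartAt (𝓡 n) c).target) :
    action g T (chartField c (covDeriv g c v)) = 0 := by
  have ht := isOpen_extChartAt_target (I := 𝓡 n) c
  have hX := contDiff_covDeriv g c hv hs
  have hXc := hasCompactSupport_covDeriv g c hc
  have hXs := (tsupport_covDeriv_subset g c v).trans hs
  have hsupp : fieldSupport (chartField c (covDeriv g c v)) ⊆ (extChartAt (𝓡 n) c).source := by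
    refine (fieldSupport_chartField_subset c hXc hXs).trans ?_
    rintro _ ⟨y, hy, rfl⟩
    exact (extChartAt (𝓡 n) c).map_target (hXs hy)
  rw [action_chart g hT (isTestField_chartField c hX hXc hXs) c hsupp]
  have hTs : ∀ i j, ContDiffOn ℝ ∞ (components T c i j) (extChartAt (𝓡 n) c).target := fun i j ↦
    ((hT.contDiffOn c).clm_apply contDiffOn_const).clm_apply contDiffOn_const
  set W : Fin n → Vec n → ℝ := fun i y ↦
    ∑ j, volDensity g c y * components T c i j y * v y (EuclideanSpace.single j 1) with hWdef
  have hWsupp : ∀ i, tsupport (W i) ⊆ tsupport v := fun i ↦ by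
    refine closure_minimal (fun y hy ↦ ?_) (isClosed_tsupport v)
    by_contra h
    refine hy ?_
    simp [hWdef, image_eq_zero_of_notMem_tsupport h]
  have hW : ∀ i, ContDiff ℝ ∞ (W i) := fun i ↦ by
    refine contDiff_of_tsupport_subset ht ?_ ((hWsupp i).trans hs)
    exact ContDiffOn.sum fun j _ ↦ ((contDiffOn_volDensity g c).mul (hTs i j)).mul
      (hv.clm_apply contDiff_const).contDiffOn
  have hWc : ∀ i, HasCompactSupport (W i) := fun i ↦
    hc.of_isClosed_subset (isClosed_tsupport _) (hWsupp i)
  have hpt : ∀ y ∈ (extChartAt (𝓡 n) c).target, volDensity g c y *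
      contract (coordContra c T y) (coordForm c (chartField c (covDeriv g c v)) y) =
      ∑ i, fderiv ℝ (W i) y (EuclideanSpace.single i 1) := by
    intro y hy
    rw [coordForm_chartField hy]
    have hdv : HasFDerivAt v (fderiv ℝ v y) y := (hv.differentiable (by simp) y).hasFDerivAt
    have hder : ∀ i, fderiv ℝ (W i) y (EuclideanSpace.single i 1) = ∑ j,
        (volDensity g c y * components T c i j y *
            fderiv ℝ v y (EuclideanSpace.single i 1) (EuclideanSpace.single j 1) +
          (volDensity g c y * partialDeriv i (components T c i j) y +
            partialDeriv i (volDensity g c) y * components T c i j y) *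
            v y (EuclideanSpace.single j 1)) := by
      intro i
      have h1 : ∀ j, HasFDerivAt (fun y ↦ v y (EuclideanSpace.single j 1))
          ((fderiv ℝ v y).flip (EuclideanSpace.single j 1)) y := fun j ↦ by
        have := hdv.clm_apply (hasFDerivAt_const (EuclideanSpace.single j (1 : ℝ)) y)
        simpa using this
      have h2 : ∀ j, HasFDerivAt (components T c i j) (fderiv ℝ (components T c i j) y) y :=
        fun j ↦ (((hTs i j).contDiffAt (ht.mem_nhds hy)).differentiableAt (by simp)).hasFDerivAt
      have h3 : HasFDerivAt (volDensity g c) (fderiv ℝ (volDensity g c) y) y :=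
        (((contDiffOn_volDensity g c).contDiffAt (ht.mem_nhds hy)).differentiableAt
          (by simp)).hasFDerivAt
      have h4 := HasFDerivAt.fun_sum (u := Finset.univ) fun j _ ↦ (h3.mul (h2 j)).mul (h1 j)
      have h5 : fderiv ℝ (W i) y = _ := h4.fderiv
      rw [h5, _root_.sum_apply]
      refine Finset.sum_congr rfl fun j _ ↦ ?_
      simp only [_root_.add_apply, _root_.smul_apply, smul_eq_mul, partialDeriv,
        ContinuousLinearMap.flip_apply, Pi.mul_apply]
      ring
    simp only [hder]
    have hc' := hcons c y hy
    have hexp : ∀ i j, covDeriv g c v y (EuclideanSpace.single i 1) (EuclideanSpace.single j 1) =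
        fderiv ℝ v y (EuclideanSpace.single i 1) (EuclideanSpace.single j 1) -
          ∑ k, christoffel g c k i j y * v y (EuclideanSpace.single k 1) := by
      intro i j
      rw [covDeriv, _root_.sub_apply, _root_.sub_apply, gammaForm_single]
    simp only [contract, hexp, partialDeriv_volDensity g hy, ← components_eq]
    have key : ∑ j, volDensity g c y * v y (EuclideanSpace.single j 1) *
        ∑ i, (partialDeriv i (components T c i j) y + ∑ k, (christoffel g c i i k y *
          components T c k j y + christoffel g c j i k y * components T c i k y)) = 0 :=
      Finset.sum_eq_zero fun j _ ↦ by rw [hc' j, mul_zero]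
    rw [← sub_eq_zero, divergence_sum_identity, key, neg_zero]
  rw [setIntegral_congr_fun ht.measurableSet hpt,
    setIntegral_eq_integral_of_forall_compl_eq_zero, integral_finsetSum]
  · exact Finset.sum_eq_zero fun i _ ↦ integral_fderiv_eq_zero (hW i) (hWc i) _
  · intro i _
    exact (((hW i).continuous_fderiv (by simp)).clm_apply
      continuous_const).integrable_of_hasCompactSupport
      (((hWc i).fderiv ℝ).comp_left (g := fun L : Vec n →L[ℝ] ℝ ↦ L (EuclideanSpace.single i 1)) rfl)
  · intro y hy
    refine Finset.sum_eq_zero fun i _ ↦ ?_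
    have : y ∉ tsupport (W i) := fun h ↦ hy (hs (hWsupp i h))
    rw [(notMem_tsupport_iff_eventuallyEq.1 this).fderiv_eq]
    simp

end Divergence

lemma sigmaCompactSpace_of_chartedSpace (n : ℕ) (M : Type*) [TopologicalSpace M]
    [ChartedSpace (EuclideanSpace ℝ (Fin n)) M] [SecondCountableTopology M] :
    SigmaCompactSpace M := by
  have := ChartedSpace.locallyCompactSpace (EuclideanSpace ℝ (Fin n)) M
  infer_instance

/-! ### Test fields -/

section TestFields

variable {n : ℕ} {M : Type*} [TopologicalSpace M] [ChartedSpace (EuclideanSpace ℝ (Fin n)) M]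
  [IsManifold (𝓡 n) ∞ M]

omit [IsManifold (𝓡 n) ∞ M] in
@[simp] lemma formAt_add (x y : CovariantField n M) (p : M) :
    formAt (x + y) p = formAt x p + formAt y p := rfl

omit [IsManifold (𝓡 n) ∞ M] in
@[simp] lemma formAt_smul (a : ℝ) (x : CovariantField n M) (p : M) :
    formAt (a • x) p = a • formAt x p := rfl

omit [IsManifold (𝓡 n) ∞ M] in
@[simp] lemma formAt_zero (p : M) : formAt (0 : CovariantField n M) p = 0 := rfl

/-- The product of a field with a scalar function. -/
def smulField (f : M → ℝ) (x : CovariantField n M) : CovariantField n M :=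
  ofForm fun p ↦ f p • formAt x p

omit [IsManifold (𝓡 n) ∞ M] in
@[simp] lemma formAt_smulField (f : M → ℝ) (x : CovariantField n M) (p : M) :
    formAt (smulField f x) p = f p • formAt x p := rfl

omit [IsManifold (𝓡 n) ∞ M] in
lemma fieldSupport_subset_of {x : CovariantField n M} {s : Set M} (hs : IsClosed s)
    (h : ∀ p ∉ s, formAt x p = 0) : fieldSupport x ⊆ s := by
  refine closure_minimal (fun p hp ↦ ?_) hs
  by_contra hps
  exact hp (h p hps)

omit [IsManifold (𝓡 n) ∞ M] in
lemma isClosed_fieldSupport (x : CovariantField n M) : IsClosed (fieldSupport x) := isClosed_closure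

omit [IsManifold (𝓡 n) ∞ M] in
lemma fieldSupport_smulField_subset (f : M → ℝ) (x : CovariantField n M) :
    fieldSupport (smulField f x) ⊆ tsupport f ∩ fieldSupport x := by
  refine fieldSupport_subset_of ((isClosed_tsupport f).inter (isClosed_fieldSupport x)) fun p hp ↦ ?_
  rw [formAt_smulField]
  by_cases h : p ∈ tsupport f
  · rw [formAt_eq_zero (fun h' ↦ hp ⟨h, h'⟩), smul_zero]
  · rw [image_eq_zero_of_notMem_tsupport h, zero_smul]

omit [IsManifold (𝓡 n) ∞ M] in
lemma fieldSupport_add_subset (x y : CovariantField n M) :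
    fieldSupport (x + y) ⊆ fieldSupport x ∪ fieldSupport y := by
  refine fieldSupport_subset_of ((isClosed_fieldSupport x).union (isClosed_fieldSupport y))
    fun p hp ↦ ?_
  rw [formAt_add, formAt_eq_zero (fun h ↦ hp (.inl h)), formAt_eq_zero (fun h ↦ hp (.inr h)),
    add_zero]

lemma IsTestField.of_smooth {x : CovariantField n M} (hx : IsSmoothCov x) {K : Set M}
    (hK : IsCompact K) (h : fieldSupport x ⊆ K) : IsTestField x :=
  ⟨hx, hK.of_isClosed_subset (isClosed_fieldSupport x) h⟩

lemma IsTestField.isCompact {x : CovariantField n M} (hx : IsTestField x) :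
    IsCompact (fieldSupport x) := hx.2

lemma isTestField_zero : IsTestField (0 : CovariantField n M) :=
  .of_smooth (Bundle.contMDiff_zeroSection ℝ _) isCompact_empty
    (fieldSupport_subset_of isClosed_empty fun _ _ ↦ rfl)

lemma IsTestField.add {x y : CovariantField n M} (hx : IsTestField x) (hy : IsTestField y) :
    IsTestField (x + y) :=
  .of_smooth (hx.1.add_section hy.1) (hx.isCompact.union hy.isCompact) (fieldSupport_add_subset x y)

lemma IsTestField.smulField {x : CovariantField n M} (hx : IsTestField x) {f : M → ℝ}
    (hf : ContMDiff (𝓡 n) 𝓘(ℝ, ℝ) ∞ f) : IsTestField (smulField f x) :=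
  .of_smooth (hf.smul_section hx.1) hx.isCompact
    ((fieldSupport_smulField_subset f x).trans inter_subset_right)

lemma IsTestField.const_smul {x : CovariantField n M} (hx : IsTestField x) (a : ℝ) :
    IsTestField (a • x) := hx.smulField (contMDiff_const (c := a))

lemma IsTestField.neg {x : CovariantField n M} (hx : IsTestField x) : IsTestField (-x) := by
  have : -x = (-1 : ℝ) • x := by simp
  rw [this]
  exact hx.const_smul _

lemma IsTestField.sub {x y : CovariantField n M} (hx : IsTestField x) (hy : IsTestField y) :
    IsTestField (x - y) := by
  rw [sub_eq_add_neg]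
  exact hx.add hy.neg

lemma IsTestField.sum {ι : Type*} {s : Finset ι} {x : ι → CovariantField n M}
    (hx : ∀ i ∈ s, IsTestField (x i)) : IsTestField (∑ i ∈ s, x i) :=
  Finset.sum_induction _ _ (fun _ _ ↦ IsTestField.add) isTestField_zero hx

omit [IsManifold (𝓡 n) ∞ M] in
lemma formAt_sum {ι : Type*} (s : Finset ι) (x : ι → CovariantField n M) (p : M) :
    formAt (∑ i ∈ s, x i) p = ∑ i ∈ s, formAt (x i) p := by
  classical
  induction s using Finset.induction_on with
  | empty => simp
  | insert a s ha ih => rw [Finset.sum_insert ha, Finset.sum_insert ha, formAt_add, ih]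

variable [T2Space M] [SecondCountableTopology M]

variable (n) in
/-- Smooth cutoff functions. -/
lemma exists_smooth_cutoff {K O : Set M} (hK : IsClosed K) (hO : IsOpen O) (h : K ⊆ O) :
    ∃ f : M → ℝ, ContMDiff (𝓡 n) 𝓘(ℝ, ℝ) ∞ f ∧ (∀ p, 0 ≤ f p ∧ f p ≤ 1) ∧
      (∀ p ∈ K, ∀ᶠ q in 𝓝 p, f q = 1) ∧ tsupport f ⊆ O := by
  have := sigmaCompactSpace_of_chartedSpace n M
  have := ChartedSpace.locallyCompactSpace (EuclideanSpace ℝ (Fin n)) M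
  obtain ⟨U, hU, hKU, hUO⟩ := normal_exists_closure_subset hK hO h
  obtain ⟨f, hf1, hf0, hf⟩ := exists_contMDiffMap_one_nhds_of_subset_interior (𝓡 n) (n := ⊤) hK
    (t := U) (by rwa [hU.interior_eq])
  refine ⟨f, f.contMDiff, hf, fun p hp ↦ ?_, ?_⟩
  · exact (hf1.filter_mono (nhds_le_nhdsSet hp))
  · refine (closure_mono fun p hp ↦ ?_).trans hUO
    by_contra hpU
    exact hp (hf0 p hpU)

/-- Additive properties of test fields are local: decompose with a partition of unity. -/
theorem IsTestField.local_induction {P : CovariantField n M → Prop} (h0 : P 0)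
    (hadd : ∀ x y, IsTestField x → IsTestField y → P x → P y → P (x + y))
    {x : CovariantField n M} (hx : IsTestField x)
    (hloc : ∀ p ∈ fieldSupport x, ∃ N ∈ 𝓝 p, ∀ y, IsTestField y → fieldSupport y ⊆ N → P y) :
    P x := by
  have := sigmaCompactSpace_of_chartedSpace n M
  have := ChartedSpace.locallyCompactSpace (EuclideanSpace ℝ (Fin n)) M
  choose! N hN hP using hloc
  obtain ⟨t, htK, ht⟩ := hx.isCompact.elim_nhds_subcover (fun p ↦ interior (N p))
    fun p hp ↦ interior_mem_nhds.2 (hN p hp)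
  obtain ⟨f, hf⟩ := SmoothPartitionOfUnity.exists_isSubordinate (𝓡 n) (isClosed_fieldSupport x)
    (fun p : t ↦ interior (N p)) (fun _ ↦ isOpen_interior) (by
      intro p hp
      obtain ⟨q, hq, hpq⟩ := mem_iUnion₂.1 (ht hp)
      exact mem_iUnion.2 ⟨⟨q, hq⟩, hpq⟩)
  have hsum : x = ∑ i : t, Tracking.smulField (f i) x := by
    refine field_ext fun p ↦ ?_
    rw [formAt_sum]
    simp only [formAt_smulField]
    rw [← Finset.sum_smul]
    by_cases hp : p ∈ fieldSupport x
    · have := f.sum_eq_one hp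
      rw [finsum_eq_sum_of_fintype] at this
      rw [this, one_smul]
    · rw [formAt_eq_zero hp, smul_zero]
  have hPi : ∀ i : t, P (Tracking.smulField (f i) x) := fun i ↦
    hP i (htK i i.2) _ (hx.smulField (f i).contMDiff)
      ((fieldSupport_smulField_subset _ _).trans (inter_subset_left.trans
        ((hf i).trans interior_subset)))
  rw [hsum]
  have h2 : IsTestField (∑ i : t, Tracking.smulField (f i) x) ∧ P (∑ i : t, Tracking.smulField (f i) x) :=
    Finset.sum_induction _ (fun y ↦ IsTestField y ∧ P y)
      (fun y z hy hz ↦ ⟨hy.1.add hz.1, hadd y z hy.1 hz.1 hy.2 hz.2⟩) ⟨isTestField_zero, h0⟩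
      fun i _ ↦ ⟨hx.smulField (f i).contMDiff, hPi i⟩
  exact h2.2

end TestFields

/-! ### Conserved positive functionals -/

section Functionals

variable {n : ℕ} {M : Type*} [TopologicalSpace M] [ChartedSpace (EuclideanSpace ℝ (Fin n)) M]
  [IsManifold (𝓡 n) ∞ M]

/-- A field whose contraction with each tensor that satisfies the dominant energy condition is
non-negative. -/
def IsEnergyNonneg (g : LorentzMetric n M) (x : CovariantField n M) : Prop :=
  ∀ p, ∀ T : CoForm n, DominantEnergyAt g p T → 0 ≤ contract T (formAt x p)

/-- The properties of the distributions `x ↦ ∫ T^{ab} x_{ab}` with a symmetric, conserved `T` that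
satisfies the dominant energy condition. They are stable under pointwise limits. -/
structure IsStressFunctional (g : LorentzMetric n M) (L : CovariantField n M → ℝ) : Prop where
  map_add : ∀ x y, IsTestField x → IsTestField y → L (x + y) = L x + L y
  map_smul : ∀ (a : ℝ) x, IsTestField x → L (a • x) = a * L x
  nonneg : ∀ x, IsTestField x → IsEnergyNonneg g x → 0 ≤ L x
  map_flip : ∀ (c : M) (X : Vec n → Form n), ContDiff ℝ ∞ X → HasCompactSupport X →
    tsupport X ⊆ (extChartAt (𝓡 n) c).target →
    L (chartField c fun y ↦ (X y).flip) = L (chartField c X)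
  map_covDeriv : ∀ (c : M) (v : Vec n → Covec n), ContDiff ℝ ∞ v → HasCompactSupport v →
    tsupport v ⊆ (extChartAt (𝓡 n) c).target → L (chartField c (covDeriv g c v)) = 0

namespace IsStressFunctional

variable {g : LorentzMetric n M} {L : CovariantField n M → ℝ} (hL : IsStressFunctional g L)
include hL

lemma map_zero : L 0 = 0 := by
  have := hL.map_smul 0 0 isTestField_zero
  simpa using this

lemma map_neg {x : CovariantField n M} (hx : IsTestField x) : L (-x) = -L x := by
  have := hL.map_smul (-1) x hx
  simpa using this

lemma map_sub {x y : CovariantField n M} (hx : IsTestField x) (hy : IsTestField y) :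
    L (x - y) = L x - L y := by
  rw [sub_eq_add_neg, hL.map_add x _ hx hy.neg, hL.map_neg hy, sub_eq_add_neg]

lemma map_sum {ι : Type*} {s : Finset ι} {x : ι → CovariantField n M}
    (hx : ∀ i ∈ s, IsTestField (x i)) : L (∑ i ∈ s, x i) = ∑ i ∈ s, L (x i) := by
  classical
  induction s using Finset.induction_on with
  | empty => simpa using hL.map_zero
  | insert a s ha ih =>
    rw [Finset.sum_insert ha, Finset.sum_insert ha, hL.map_add, ih]
    · exact fun i hi ↦ hx i (Finset.mem_insert_of_mem hi)
    · exact hx a (Finset.mem_insert_self _ _)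
    · exact .sum fun i hi ↦ hx i (Finset.mem_insert_of_mem hi)

/-- A field that is dominated by a second one, when contracted with tensors that satisfy the dominant
energy condition, is dominated for the functional. -/
lemma abs_le {x e : CovariantField n M} (hx : IsTestField x) (he : IsTestField e)
    (h : ∀ p, ∀ T : CoForm n, DominantEnergyAt g p T →
      |contract T (formAt x p)| ≤ contract T (formAt e p)) : |L x| ≤ L e := by
  rw [_root_.abs_le]
  constructor
  · have := hL.nonneg (e + x) (he.add hx) fun p T hT ↦ by
      have := (_root_.abs_le.1 (h p T hT)).1
      rw [formAt_add, contract_add]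
      linarith
    rw [hL.map_add _ _ he hx] at this
    linarith
  · have := hL.nonneg (e - x) (he.sub hx) fun p T hT ↦ by
      have := (_root_.abs_le.1 (h p T hT)).2
      have h2 : formAt (e - x) p = formAt e p - formAt x p := rfl
      rw [h2, contract_sub]
      linarith
    rw [hL.map_sub he hx] at this
    linarith

end IsStressFunctional

variable [T2Space M] [SecondCountableTopology M] [MeasurableSpace M] [BorelSpace M]

lemma isStressFunctional_action (g : LorentzMetric n M) {T : ContravariantField n M}
    (hT : IsSmoothContra T) (hsymm : ∀ p ξ η, T p ξ η = T p η ξ)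
    (hdec : ∀ p, DominantEnergyAt g p (T p)) (hcons : IsConserved g T) {a : ℝ} (ha : 0 ≤ a) :
    IsStressFunctional g fun x ↦ a * action g T x where
  map_add x y hx hy := by rw [action_add g hT hx hy, mul_add]
  map_smul b x _ := by rw [action_smul]; ring
  nonneg x _ hpos := by
    refine mul_nonneg ha ?_
    rw [action_eq]
    exact integral_nonneg fun p ↦ hpos p _ (hdec p)
  map_flip c X _ _ _ := by
    congr 1
    rw [action_eq, action_eq]
    refine integral_congr_ae (.of_forall fun p ↦ ?_)
    by_cases hp : p ∈ (extChartAt (𝓡 n) c).source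
    · beta_reduce
      rw [chartField_apply hp, chartField_apply hp,
        ← contract_flip (coformAt T p) (fun α β ↦ hsymm p α β)]
      congr 1
    · beta_reduce
      rw [chartField_apply_of_notMem hp, chartField_apply_of_notMem hp]
  map_covDeriv c v hv hc hs := by rw [action_covDeriv g hT hcons c hv hc hs, mul_zero]

end Functionals

/-! ### Domination by energy densities -/

section Cone

variable {n : ℕ}

lemma continuousAt_inverse_apply {X E F : Type*} [TopologicalSpace X] [NormedAddCommGroup E]
    [NormedSpace ℝ E] [CompleteSpace E] [NormedAddCommGroup F] [NormedSpace ℝ F]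
    {G : X → E →L[ℝ] F} {x : X} (hG : ContinuousAt G x) (hx : (G x).IsInvertible) (α : F) :
    ContinuousAt (fun z : X × F ↦ (G z.1).inverse z.2) (x, α) := by
  have h2 : ContinuousAt (ContinuousLinearMap.inverse : (E →L[ℝ] F) → _) (G x) := by
    obtain ⟨e, he⟩ := hx
    rw [← he]
    exact (contDiffAt_map_inverse (𝕜 := ℝ) (n := 0) e).continuousAt
  have h3 : ContinuousAt (fun z ↦ (G z).inverse) x := ContinuousAt.comp h2 hG
  have h1 : ContinuousAt (fun z : X × F ↦ (G z.1).inverse) (x, α) :=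
    ContinuousAt.comp (f := fun z : X × F ↦ z.1) (x := (x, α)) h3 continuousAt_fst
  exact h1.clm_apply continuousAt_snd

/-- Timelike vectors that depend continuously on a parameter stay in one half of the light cone, for
nearby parameters. -/
lemma eventually_cone {X E F : Type*} [TopologicalSpace X] [NormedAddCommGroup E]
    [NormedSpace ℝ E] [TopologicalSpace F] {G : X → E →L[ℝ] E →L[ℝ] ℝ} {a : X × F → E} {x : X}
    {α : F} (hG : ContinuousAt G x) (ha : ContinuousAt a (x, α))
    (h : 0 < G x (a (x, α)) (a (x, α))) :
    ∀ᶠ z in 𝓝 (x, α), 0 < G z.1 (a z) (a z) ∧ 0 < G z.1 (a (x, α)) (a z) ∧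
      0 < G z.1 (a (x, α)) (a (x, α)) := by
  have hG' : ContinuousAt (fun z : X × F ↦ G z.1) (x, α) :=
    hG.comp (x := (x, α)) continuousAt_fst
  have e1 : ContinuousAt (fun z ↦ G z.1 (a z) (a z)) (x, α) := (hG'.clm_apply ha).clm_apply ha
  have e2 : ContinuousAt (fun z ↦ G z.1 (a (x, α)) (a z)) (x, α) :=
    (hG'.clm_apply continuousAt_const).clm_apply ha
  have e3 : ContinuousAt (fun z : X × F ↦ G z.1 (a (x, α)) (a (x, α))) (x, α) :=
    (hG'.clm_apply continuousAt_const).clm_apply continuousAt_const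
  exact (e1.eventually_const_lt h).and ((e2.eventually_const_lt h).and (e3.eventually_const_lt h))

/-- If a bilinear form is non-negative near the point `(ℓ, ℓ)`, then its value there bounds the
whole form: add the inequalities at `(ℓ + α, ℓ + β)` and `(ℓ - α, ℓ - β)`. -/
lemma abs_le_of_nonneg_near {B : CoForm n} {ℓ : Covec n} {δ : ℝ} (hδ : 0 < δ)
    (h : ∀ α β : Covec n, ‖α - ℓ‖ < δ → ‖β - ℓ‖ < δ → 0 ≤ B α β) (α β : Covec n) :
    |B α β| ≤ 4 / δ ^ 2 * ‖α‖ * ‖β‖ * B ℓ ℓ := by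
  have key : ∀ α β : Covec n, ‖α‖ < δ → ‖β‖ < δ → -B ℓ ℓ ≤ B α β := by
    intro α β hα hβ
    have h1 := h (ℓ + α) (ℓ + β) (by simpa using hα) (by simpa using hβ)
    have h2 := h (ℓ - α) (ℓ - β) (by simpa using hα) (by simpa using hβ)
    simp only [map_add, map_sub, _root_.add_apply, _root_.sub_apply] at h1 h2
    linarith
  have key2 : ∀ α β : Covec n, ‖α‖ < δ → ‖β‖ < δ → |B α β| ≤ B ℓ ℓ := by
    intro α β hα hβ
    rw [abs_le]
    refine ⟨key α β hα hβ, ?_⟩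
    have := key (-α) β (by simpa using hα) hβ
    simp only [map_neg, _root_.neg_apply] at this
    linarith
  rcases eq_or_ne α 0 with rfl | hα
  · simp
  rcases eq_or_ne β 0 with rfl | hβ
  · simp
  have hα' := norm_pos_iff.2 hα
  have hβ' := norm_pos_iff.2 hβ
  have h3 := key2 ((δ / 2 / ‖α‖) • α) ((δ / 2 / ‖β‖) • β)
    (by rw [norm_smul, Real.norm_of_nonneg (by positivity), div_mul_cancel₀ _ hα'.ne']; linarith)
    (by rw [norm_smul, Real.norm_of_nonneg (by positivity), div_mul_cancel₀ _ hβ'.ne']; linarith)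
  simp only [map_smul, _root_.smul_apply, smul_eq_mul] at h3
  rw [← mul_assoc, abs_mul, abs_of_nonneg (by positivity)] at h3
  have h4 : δ / 2 / ‖α‖ * (δ / 2 / ‖β‖) = (4 / δ ^ 2 * ‖α‖ * ‖β‖)⁻¹ := by
    field_simp
    norm_num
  rw [show δ / 2 / ‖β‖ * (δ / 2 / ‖α‖) = δ / 2 / ‖α‖ * (δ / 2 / ‖β‖) by ring, h4,
    inv_mul_le_iff₀ (by positivity)] at h3
  exact h3

/-- The constant in the bound `abs_contract_le` of a contraction by the norms of its factors. -/
def contractConst (n : ℕ) : ℝ := ∑ i : Fin n, ∑ j : Fin n,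
  ‖(EuclideanSpace.proj i : Covec n)‖ * ‖(EuclideanSpace.proj j : Covec n)‖ *
    (‖(EuclideanSpace.single i 1 : Vec n)‖ * ‖(EuclideanSpace.single j 1 : Vec n)‖)

lemma abs_contract_le {B : CoForm n} {K : ℝ}
    (h : ∀ α β : Covec n, |B α β| ≤ K * ‖α‖ * ‖β‖) (X : Form n) :
    |contract B X| ≤ K * contractConst n * ‖X‖ := by
  unfold contract contractConst
  rw [Finset.mul_sum, Finset.sum_mul]
  refine (Finset.abs_sum_le_sum_abs _ _).trans (Finset.sum_le_sum fun i _ ↦ ?_)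
  rw [Finset.mul_sum, Finset.sum_mul]
  refine (Finset.abs_sum_le_sum_abs _ _).trans (Finset.sum_le_sum fun j _ ↦ ?_)
  rw [abs_mul]
  have h1 := h (EuclideanSpace.proj i) (EuclideanSpace.proj j)
  have h2 : |X (EuclideanSpace.single i 1) (EuclideanSpace.single j 1)| ≤
      ‖X‖ * ‖(EuclideanSpace.single i 1 : Vec n)‖ * ‖(EuclideanSpace.single j 1 : Vec n)‖ :=
    X.le_opNorm₂ _ _
  refine (mul_le_mul h1 h2 (abs_nonneg _) ((abs_nonneg _).trans h1)).trans (le_of_eq ?_)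
  ring

end Cone

section Domination

variable {n : ℕ} {M : Type*} [TopologicalSpace M] [ChartedSpace (EuclideanSpace ℝ (Fin n)) M]
  [IsManifold (𝓡 n) ∞ M]

lemma isInvertible_form {x : Form n} (hx : ∀ w, (∀ v, x w v = 0) → w = 0) : x.IsInvertible := by
  have hinj : Function.Injective (x : Vec n →ₗ[ℝ] Covec n) := by
    rw [injective_iff_map_eq_zero]
    intro w hw
    exact hx w fun v ↦ DFunLike.congr_fun hw v
  have hfin : Module.finrank ℝ (Vec n) = Module.finrank ℝ (Covec n) := by
    rw [← LinearEquiv.finrank_eq (LinearMap.toContinuousLinearMap (𝕜 := ℝ) (E := Vec n) (F' := ℝ))]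
    exact (Subspace.dual_finrank_eq (K := ℝ) (V := Vec n)).symm
  refine ⟨(LinearEquiv.ofInjectiveOfFinrankEq (x : Vec n →ₗ[ℝ] Covec n) hinj hfin).toContinuousLinearEquiv, ?_⟩
  ext v w
  rfl

lemma coordForm_metric_nondegenerate (g : LorentzMetric n M) {c : M} {y : Vec n}
    (hy : y ∈ (extChartAt (𝓡 n) c).target) (w : Vec n)
    (hw : ∀ v, coordForm c g.val y w v = 0) : w = 0 := by
  have h0 : chartDSymm c y w = 0 := by
    refine metric_nondegenerate g ((extChartAt (𝓡 n) c).symm y) _ fun v ↦ ?_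
    have h1 := hw (chartD c ((extChartAt (𝓡 n) c).symm y) v)
    have h2 := chartDSymm_chartD ((extChartAt (𝓡 n) c).map_target hy) v
    rw [(extChartAt (𝓡 n) c).right_inv hy] at h2
    rw [coordForm, Form.pull_apply, h2] at h1
    exact (g.symm _ _ _).trans h1
  rw [← chartD_chartDSymm hy w, h0, map_zero]

/-- The metric at `p`, lowering the index of the vector with coordinates `a`. -/
lemma lower_index (g : LorentzMetric n M) {c p : M} (hp : p ∈ (extChartAt (𝓡 n) c).source)
    (a : Vec n) : formAt g.val p (chartDSymm c (extChartAt (𝓡 n) c p) a) =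
      (coordForm c g.val (extChartAt (𝓡 n) c p) a).comp (chartD c p) := by
  ext w
  rw [ContinuousLinearMap.comp_apply, coordForm, (extChartAt (𝓡 n) c).left_inv hp, Form.pull_apply,
    chartDSymm_chartD hp]

/-- The coordinate covector of the vector `t` at `p`, for the chart at `c`. -/
def lowered (g : LorentzMetric n M) (c p : M) (t : Vec n) : Covec n :=
  (formAt g.val p t).comp (chartDSymm c (extChartAt (𝓡 n) c p))

/-- Near a point where `t` is timelike, the covector `ℓ` with the constant components of `t`
stays timelike, and each tensor `T` that satisfies the dominant energy condition is bounded by the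
energy density `T(ℓ, ℓ)`. -/
lemma exists_energy_domination (g : LorentzMetric n M) {c p₀ : M}
    (hp₀ : p₀ ∈ (extChartAt (𝓡 n) c).source) {t : Vec n} (ht : 0 < formAt g.val p₀ t t) :
    ∃ N : Set M, IsOpen N ∧ p₀ ∈ N ∧ N ⊆ (extChartAt (𝓡 n) c).source ∧ ∃ K > 0, ∀ p ∈ N,
      (∀ T : CoForm n, DominantEnergyAt g p T → ∀ X : Form n,
        |contract T (X.pull (chartD c p))| ≤ K * ‖X‖ *
          contract T ((outer (lowered g c p₀ t) (lowered g c p₀ t)).pull (chartD c p))) ∧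
      ∃ w : Vec n, 0 < formAt g.val p w w ∧
        formAt g.val p w = (lowered g c p₀ t).comp (chartD c p) := by
  set ℓ := lowered g c p₀ t with hℓ
  set y₀ := extChartAt (𝓡 n) c p₀ with hy₀
  have hyt : y₀ ∈ (extChartAt (𝓡 n) c).target := (extChartAt (𝓡 n) c).map_source hp₀
  have hopen := isOpen_extChartAt_target (I := 𝓡 n) c
  set G := coordForm c g.val with hG
  set v := chartD c p₀ t with hv
  have hGinv : ∀ y ∈ (extChartAt (𝓡 n) c).target, (G y).IsInvertible := fun y hy ↦
    isInvertible_form (coordForm_metric_nondegenerate g hy)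
  have hDv : chartDSymm c y₀ v = t := chartDSymm_chartD hp₀ t
  have hGv : G y₀ v = ℓ := by
    ext w
    rw [hG, coordForm, Form.pull_apply, hDv, (extChartAt (𝓡 n) c).left_inv hp₀]
    rfl
  have hGvv : 0 < G y₀ v v := by
    rw [hG, coordForm, Form.pull_apply, hDv, (extChartAt (𝓡 n) c).left_inv hp₀]
    exact ht
  have hGc : ContinuousAt G y₀ := ((g.smooth.contDiffOn c).continuousOn).continuousAt
    (hopen.mem_nhds hyt)
  -- raising the index of a covector
  set a : Vec n × Covec n → Vec n := fun z ↦ (G z.1).inverse z.2 with ha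
  have hac : ContinuousAt a (y₀, ℓ) := continuousAt_inverse_apply hGc (hGinv y₀ hyt) ℓ
  have haG : ∀ y ∈ (extChartAt (𝓡 n) c).target, ∀ α, G y (a (y, α)) = α := fun y hy α ↦
    (hGinv y hy).self_apply_inverse α
  have ha0 : a (y₀, ℓ) = v := by
    rw [ha, ← hGv]
    exact (hGinv y₀ hyt).inverse_apply_self v
  -- covectors near `ℓ` are timelike, and in the same half of the cone as `v`
  have hev : ∀ᶠ z in 𝓝 (y₀, ℓ), (0 < G z.1 (a z) (a z) ∧ 0 < G z.1 v (a z) ∧ 0 < G z.1 v v) ∧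
      z.1 ∈ (extChartAt (𝓡 n) c).target := by
    have h1 := eventually_cone hGc hac (by rw [ha0]; exact hGvv)
    rw [ha0] at h1
    exact h1.and (continuousAt_fst.eventually (hopen.mem_nhds hyt))
  obtain ⟨N₁, hN₁, N₂, hN₂, hN⟩ := mem_nhds_prod_iff.1 hev
  obtain ⟨N₁', hN₁', hN₁o, hyN₁⟩ := mem_nhds_iff.1 hN₁
  obtain ⟨δ, hδ, hball⟩ := Metric.mem_nhds_iff.1 hN₂
  refine ⟨(extChartAt (𝓡 n) c).source ∩ extChartAt (𝓡 n) c ⁻¹' N₁', isOpen_extChartAt_preimage' c hN₁o,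
    ⟨hp₀, hyN₁⟩, inter_subset_left, 4 / δ ^ 2 * |contractConst n| + 1, by positivity, ?_⟩
  rintro p ⟨hp, hpN⟩
  set y := extChartAt (𝓡 n) c p with hy
  have hcone : ∀ α : Covec n, ‖α - ℓ‖ < δ → 0 < G y (a (y, α)) (a (y, α)) ∧
      0 < G y v (a (y, α)) ∧ 0 < G y v v := fun α hα ↦
    (hN (mk_mem_prod (hN₁' hpN) (hball (by rwa [mem_ball_iff_norm])))).1
  have hyt' : y ∈ (extChartAt (𝓡 n) c).target := (extChartAt (𝓡 n) c).map_source hp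
  have hGp : ∀ b b' : Vec n, formAt g.val p (chartDSymm c y b) (chartDSymm c y b') = G y b b' := by
    intro b b'
    rw [hG, coordForm, (extChartAt (𝓡 n) c).left_inv hp, Form.pull_apply]
  have hlow : ∀ α : Covec n, formAt g.val p (chartDSymm c y (a (y, α))) = α.comp (chartD c p) := by
    intro α
    have h5 : coordForm c g.val y (a (y, α)) = α := haG y hyt' α
    rw [hy, lower_index g hp, ← hy, h5]
  have hℓ0 : ‖ℓ - ℓ‖ < δ := by simpa using hδ
  refine ⟨fun T hT X ↦ ?_, chartDSymm c y (a (y, ℓ)), by rw [hGp]; exact (hcone ℓ hℓ0).1, hlow ℓ⟩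
  have hB : ∀ α β : Covec n, ‖α - ℓ‖ < δ → ‖β - ℓ‖ < δ → 0 ≤ T.push (chartD c p) α β := by
    intro α β hα hβ
    rw [CoForm.push_apply, ← hlow α, ← hlow β]
    have hne : ∀ α : Covec n, ‖α - ℓ‖ < δ → chartDSymm c y (a (y, α)) ≠ 0 := fun α hα h0 ↦ by
      have := (hcone α hα).1
      rw [← hGp, h0, map_zero] at this
      exact lt_irrefl _ this
    refine hT _ _ ⟨hne α hα, hne β hβ, ?_, ?_, chartDSymm c y v, ?_, ?_, ?_⟩
    · exact ((hcone α hα).1.trans_eq (hGp _ _).symm).le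
    · exact ((hcone β hβ).1.trans_eq (hGp _ _).symm).le
    · exact (hcone α hα).2.2.trans_eq (hGp _ _).symm
    · exact (hcone α hα).2.1.trans_eq (hGp _ _).symm
    · exact (hcone β hβ).2.1.trans_eq (hGp _ _).symm
  have hB0 : 0 ≤ T.push (chartD c p) ℓ ℓ := hB ℓ ℓ hℓ0 hℓ0
  have h1 := abs_le_of_nonneg_near hδ hB
  rw [contract_pull, contract_pull, contract_outer]
  have h2 := abs_contract_le (B := T.push (chartD c p))
    (K := 4 / δ ^ 2 * T.push (chartD c p) ℓ ℓ) (fun α β ↦ (h1 α β).trans (le_of_eq (by ring))) X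
  refine h2.trans ?_
  have h3 : contractConst n ≤ |contractConst n| := le_abs_self _
  have h4 : 0 ≤ ‖X‖ * T.push (chartD c p) ℓ ℓ := by positivity
  calc 4 / δ ^ 2 * (T.push (chartD c p)) ℓ ℓ * contractConst n * ‖X‖
      = 4 / δ ^ 2 * contractConst n * (‖X‖ * T.push (chartD c p) ℓ ℓ) := by ring
    _ ≤ (4 / δ ^ 2 * |contractConst n| + 1) * (‖X‖ * T.push (chartD c p) ℓ ℓ) := by
        refine mul_le_mul_of_nonneg_right ?_ h4
        have : 4 / δ ^ 2 * contractConst n ≤ 4 / δ ^ 2 * |contractConst n| :=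
          mul_le_mul_of_nonneg_left h3 (by positivity)
        linarith
    _ = _ := by ring

/-- `x` is dominated by `e`, up to a constant, for each tensor that satisfies the dominant energy
condition. -/
def IsDominatedBy (g : LorentzMetric n M) (x e : CovariantField n M) : Prop :=
  ∃ K : ℝ, ∀ p, ∀ T : CoForm n, DominantEnergyAt g p T →
    |contract T (formAt x p)| ≤ K * contract T (formAt e p)

lemma IsStressFunctional.abs_le_of_dominated {g : LorentzMetric n M} {L : CovariantField n M → ℝ}
    (hL : IsStressFunctional g L) {x e : CovariantField n M} (hx : IsTestField x)
    (he : IsTestField e) {K : ℝ} (h : ∀ p, ∀ T : CoForm n, DominantEnergyAt g p T →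
    |contract T (formAt x p)| ≤ K * contract T (formAt e p)) : |L x| ≤ K * L e := by
  rw [← hL.map_smul K e he]
  refine hL.abs_le hx (he.const_smul K) fun p T hT ↦ ?_
  rw [formAt_smul, contract_smul]
  exact h p T hT

/-- A field `e` dominates all test fields supported where it bounds the components of the tensors. -/
lemma isDominatedBy_of_nhds {g : LorentzMetric n M} {c : M} {N : Set M} {K : ℝ}
    (hK : 0 ≤ K) {e : CovariantField n M} (he : IsEnergyNonneg g e)
    (hNs : N ⊆ (extChartAt (𝓡 n) c).source)
    (hdom : ∀ p ∈ N, ∀ T : CoForm n, DominantEnergyAt g p T → ∀ X : Form n,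
      |contract T (X.pull (chartD c p))| ≤ K * ‖X‖ * contract T (formAt e p))
    {x : CovariantField n M} (hx : IsTestField x) (hxN : fieldSupport x ⊆ N) :
    IsDominatedBy g x e := by
  have hcont : ContinuousOn (fun p ↦ ‖coordForm c x (extChartAt (𝓡 n) c p)‖) (fieldSupport x) := by
    refine ContinuousOn.norm ?_
    refine (hx.1.contDiffOn c).continuousOn.comp ((continuousOn_extChartAt c).mono ?_) ?_
    · exact fun p hp ↦ hNs (hxN hp)
    · exact fun p hp ↦ (extChartAt (𝓡 n) c).map_source (hNs (hxN hp))
  obtain ⟨K₁, hK₁⟩ := hx.isCompact.bddAbove_image hcont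
  refine ⟨K * |K₁|, fun p T hT ↦ ?_⟩
  have h4 := he p T hT
  by_cases hp : p ∈ fieldSupport x
  · have hp' := hNs (hxN hp)
    have h1 : ‖coordForm c x (extChartAt (𝓡 n) c p)‖ ≤ |K₁| :=
      (hK₁ (mem_image_of_mem _ hp)).trans (le_abs_self _)
    have h2 := hdom p (hxN hp) T hT (coordForm c x (extChartAt (𝓡 n) c p))
    rw [← chartField_apply hp', chartField_coordForm hp'] at h2
    refine h2.trans ?_
    gcongr
  · rw [formAt_eq_zero hp, contract_zero, abs_zero]
    positivity

variable [T2Space M]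

omit [IsManifold (𝓡 n) ∞ M] [T2Space M] in
lemma exists_chart_bump {c p : M} (hp : p ∈ (extChartAt (𝓡 n) c).source) {W : Set M} (hW : IsOpen W)
    (hpW : p ∈ W) : ∃ ψ : Vec n → ℝ, ContDiff ℝ ∞ ψ ∧ HasCompactSupport ψ ∧
      tsupport ψ ⊆ (extChartAt (𝓡 n) c).target ∩ (extChartAt (𝓡 n) c).symm ⁻¹' W ∧
      (∀ y, 0 ≤ ψ y ∧ ψ y ≤ 1) ∧ ∀ᶠ y in 𝓝 (extChartAt (𝓡 n) c p), ψ y = 1 := by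
  have ho : IsOpen ((extChartAt (𝓡 n) c).target ∩ (extChartAt (𝓡 n) c).symm ⁻¹' W) :=
    (continuousOn_extChartAt_symm c).isOpen_inter_preimage (isOpen_extChartAt_target c) hW
  have hmem : extChartAt (𝓡 n) c p ∈
      (extChartAt (𝓡 n) c).target ∩ (extChartAt (𝓡 n) c).symm ⁻¹' W :=
    ⟨(extChartAt (𝓡 n) c).map_source hp, by
      rw [mem_preimage, (extChartAt (𝓡 n) c).left_inv hp]; exact hpW⟩
  obtain ⟨r, hr, hball⟩ := Metric.isOpen_iff.1 ho _ hmem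
  let b : ContDiffBump (extChartAt (𝓡 n) c p) := ⟨r / 4, r / 2, by positivity, by linarith⟩
  refine ⟨b, b.contDiff, b.hasCompactSupport, ?_, fun y ↦ ⟨b.nonneg, b.le_one⟩, b.eventuallyEq_one⟩
  rw [b.tsupport_eq]
  exact (Metric.closedBall_subset_ball (by change r / 2 < r; linarith)).trans hball

/-- Localized energy densities: fields that satisfy the dual energy condition, dominate every
test field close to a point, and are generic at that point. -/
lemma exists_energyBump (g : LorentzMetric n M) {c p₀ : M} (hp₀ : p₀ ∈ (extChartAt (𝓡 n) c).source)
    {W : Set M} (hW : IsOpen W) (hpW : p₀ ∈ W) :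
    ∃ e : CovariantField n M, IsTestField e ∧ fieldSupport e ⊆ W ∧ IsEnergyNonneg g e ∧
      (∀ p, DualEnergyAt g p (e p)) ∧ GenericAt g p₀ (e p₀) ∧
      (∃ N ∈ 𝓝 p₀, N ⊆ (extChartAt (𝓡 n) c).source ∧ ∃ K : ℝ, 0 ≤ K ∧ ∀ p ∈ N, ∀ T : CoForm n,
        DominantEnergyAt g p T → ∀ X : Form n,
          |contract T (X.pull (chartD c p))| ≤ K * ‖X‖ * contract T (formAt e p)) ∧
      (∀ p u, 0 ≤ formAt e p u u) ∧
      ∀ u : Vec n, u ≠ 0 → 0 ≤ formAt g.val p₀ u u → 0 < formAt e p₀ u u := by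
  obtain ⟨t, ht, hneg⟩ : ∃ t : Vec n, 0 < formAt g.val p₀ t t ∧ ∀ w : Vec n, w ≠ 0 →
    formAt g.val p₀ t w = 0 → formAt g.val p₀ w w < 0 := g.signature p₀
  obtain ⟨N, hNo, hpN, hNs, K, hK, hN⟩ := exists_energy_domination g hp₀ (t := t) ht
  set ℓ := lowered g c p₀ t with hℓ
  obtain ⟨ψ, hψ, hψc, hψs, hψ01, hψ1⟩ := exists_chart_bump hp₀ (hW.inter hNo) ⟨hpW, hpN⟩
  set X : Vec n → Form n := fun y ↦ ψ y • outer ℓ ℓ with hX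
  have hXs : ContDiff ℝ ∞ X := hψ.smul contDiff_const
  have hXt : tsupport X ⊆ tsupport ψ := by
    refine closure_minimal (fun y hy ↦ ?_) (isClosed_tsupport ψ)
    by_contra h
    exact hy (by simp [hX, image_eq_zero_of_notMem_tsupport h])
  have hXc : HasCompactSupport X := hψc.of_isClosed_subset (isClosed_tsupport _) hXt
  have hXt' : tsupport X ⊆ (extChartAt (𝓡 n) c).target := fun y hy ↦ (hψs (hXt hy)).1
  set e := chartField c X with he
  have hsupp := fieldSupport_chartField_subset c hXc hXt'
  have hsuppWN : fieldSupport e ⊆ W ∩ N := fun p hp ↦ by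
    obtain ⟨y, hy, rfl⟩ := hsupp hp
    exact (hψs (hXt hy)).2
  have heN : ∀ p ∈ N, formAt e p = ψ (extChartAt (𝓡 n) c p) • (outer ℓ ℓ).pull (chartD c p) := by
    intro p hp
    rw [he, chartField_apply (hNs hp)]
    ext; simp [hX]
  have he0 : ∀ p ∉ N, formAt e p = 0 := fun p hp ↦ formAt_eq_zero fun h ↦ hp (hsuppWN h).2
  have hpos : ∀ p ∈ N, ∀ T : CoForm n, DominantEnergyAt g p T →
      0 ≤ contract T ((outer ℓ ℓ).pull (chartD c p)) := by
    intro p hp T hT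
    obtain ⟨w, hw, hwℓ⟩ := (hN p hp).2
    rw [contract_pull, contract_outer, CoForm.push_apply, ← hwℓ]
    have hw0 : w ≠ 0 := fun h ↦ by rw [h, map_zero] at hw; exact lt_irrefl _ hw
    exact hT w w ⟨hw0, hw0, hw.le, hw.le, w, hw, hw, hw⟩
  have hψp : ψ (extChartAt (𝓡 n) c p₀) = 1 := hψ1.self_of_nhds
  have hℓD : ∀ u, ℓ (chartD c p₀ u) = formAt g.val p₀ t u := by
    intro u
    rw [hℓ, lowered, ContinuousLinearMap.comp_apply, chartDSymm_chartD hp₀]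
  have hpn : IsEnergyNonneg g e := by
    intro p T hT
    by_cases hp : p ∈ N
    · rw [heN p hp, contract_smul]
      exact mul_nonneg (hψ01 _).1 (hpos p hp T hT)
    · rw [he0 p hp, contract_zero]
  refine ⟨e, isTestField_chartField c hXs hXc hXt', hsuppWN.trans inter_subset_left, hpn, ?_, ?_,
    ?_, ?_, ?_⟩
  · intro p
    by_cases hp : p ∈ N
    · obtain ⟨w, hw, hwℓ⟩ := (hN p hp).2
      have hform := heN p hp
      rcases (hψ01 (extChartAt (𝓡 n) c p)).1.eq_or_lt with h0 | h0
      · rw [← h0, zero_smul] at hform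
        have : e p = 0 := hform
        rw [this]
        exact zero_mem _
      · set s : ℝ := √(ψ (extChartAt (𝓡 n) c p) / 2) with hs
        have hs0 : 0 < s := Real.sqrt_pos.2 (by positivity)
        have hss : s * s = ψ (extChartAt (𝓡 n) c p) / 2 := Real.mul_self_sqrt (by positivity)
        have hw0 : w ≠ 0 := fun h ↦ by rw [h, map_zero] at hw; exact lt_irrefl _ hw
        have hsw : formAt g.val p (s • w) = s • (ℓ.comp (chartD c p)) := by rw [map_smul, hwℓ]
        have hsww : 0 < formAt g.val p (s • w) (s • w) := by
          rw [map_smul, map_smul, _root_.smul_apply]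
          exact mul_pos hs0 (mul_pos hs0 hw)
        have hsw0 : s • w ≠ 0 := smul_ne_zero hs0.ne' hw0
        have hsum : ∀ a b : Vec n, formAt e p a b =
            formAt g.val p (s • w) a * formAt g.val p (s • w) b +
              formAt g.val p (s • w) a * formAt g.val p (s • w) b := by
          intro a b
          rw [hsw, hform]
          simp only [_root_.smul_apply, Form.pull_apply, outer_apply, smul_eq_mul,
            ContinuousLinearMap.comp_apply]
          linear_combination (-2 * ℓ (chartD c p a) * ℓ (chartD c p b)) * hss
        exact AddSubmonoid.subset_closure ⟨s • w, s • w,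
          ⟨hsw0, hsw0, hsww.le, hsww.le, s • w, hsww, hsww, hsww⟩, fun a b ↦ hsum a b⟩
    · have : e p = 0 := he0 p hp
      rw [this]
      exact zero_mem _
  · have hgen : ∀ T : CoForm n, T ≠ 0 → DominantEnergyAt g p₀ T → 0 < contract T (formAt e p₀) := by
      intro T hT0 hT
      rw [heN p₀ hpN, hψp, one_smul]
      refine lt_of_le_of_ne (hpos p₀ hpN T hT) fun h ↦ hT0 ?_
      have hz : ∀ Y : Form n, contract T (Y.pull (chartD c p₀)) = 0 := fun Y ↦ by
        have := (hN p₀ hpN).1 T hT Y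
        rw [← h, mul_zero] at this
        exact abs_eq_zero.1 (le_antisymm this (abs_nonneg _))
      refine ContinuousLinearMap.ext fun α ↦ ContinuousLinearMap.ext fun β ↦ ?_
      have h2 := hz (outer (α.comp (chartDSymm c (extChartAt (𝓡 n) c p₀)))
        (β.comp (chartDSymm c (extChartAt (𝓡 n) c p₀))))
      rw [contract_pull, contract_outer, CoForm.push_apply] at h2
      have h3 : ∀ α : Covec n,
          (α.comp (chartDSymm c (extChartAt (𝓡 n) c p₀))).comp (chartD c p₀) = α := by
        intro α
        refine ContinuousLinearMap.ext fun u ↦ ?_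
        simp only [ContinuousLinearMap.comp_apply]
        rw [chartDSymm_chartD hp₀]
      rw [h3, h3] at h2
      exact h2
    exact fun T _ hT0 hT ↦ hgen T hT0 hT
  · obtain ⟨N', hN'o, hN'⟩ : ∃ N' ∈ 𝓝 p₀, ∀ p ∈ N', p ∈ N ∧ ψ (extChartAt (𝓡 n) c p) = 1 := by
      have := (continuousAt_extChartAt' hp₀).eventually hψ1
      exact ⟨_, Filter.inter_mem (hNo.mem_nhds hpN) this, fun p hp ↦ hp⟩
    refine ⟨N', hN'o, fun p hp ↦ hNs (hN' p hp).1, K, hK.le, fun p hp T hT X ↦ ?_⟩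
    rw [heN p (hN' p hp).1, (hN' p hp).2, one_smul]
    exact (hN p (hN' p hp).1).1 T hT X
  · intro p u
    by_cases hp : p ∈ N
    · rw [heN p hp]
      simp only [_root_.smul_apply, Form.pull_apply, outer_apply, smul_eq_mul]
      exact mul_nonneg (hψ01 _).1 (mul_self_nonneg _)
    · rw [he0 p hp]
      simp
  · intro u hu0 hu
    rw [heN p₀ hpN, hψp]
    simp only [_root_.smul_apply, Form.pull_apply, outer_apply, smul_eq_mul, one_mul, hℓD]
    refine mul_self_pos.2 fun h ↦ ?_
    exact absurd hu (not_le.2 (hneg u hu0 h))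

end Domination

open Asymptotics

/-! ### Concentrating sequences -/

section Sequence

variable {n : ℕ} {M : Type*} [TopologicalSpace M] [ChartedSpace (EuclideanSpace ℝ (Fin n)) M]
  [IsManifold (𝓡 n) ∞ M] [T2Space M] [SecondCountableTopology M]

/-- Countably many localized energy densities dominate all test fields supported in an open set. -/
lemma exists_countable_energyBumps (g : LorentzMetric n M) {W : Set M} (hW : IsOpen W) :
    ∃ E : ℕ → CovariantField n M,
      (∀ i, IsTestField (E i) ∧ fieldSupport (E i) ⊆ W ∧ IsEnergyNonneg g (E i)) ∧
      ∀ p ∈ W, ∃ i, ∃ N ∈ 𝓝 p, ∀ x, IsTestField x → fieldSupport x ⊆ N →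
        IsDominatedBy g x (E i) := by
  have h : ∀ p ∈ W, ∃ e : CovariantField n M, IsTestField e ∧ fieldSupport e ⊆ W ∧
      IsEnergyNonneg g e ∧ ∃ N ∈ 𝓝 p, ∀ x, IsTestField x → fieldSupport x ⊆ N →
        IsDominatedBy g x e := fun p hp ↦ by
    obtain ⟨e, h1, h2, h3, -, -, ⟨N, hN, hNs, K, hK, h4⟩, -⟩ :=
      exists_energyBump g (mem_extChartAt_source (I := 𝓡 n) p) hW hp
    exact ⟨e, h1, h2, h3, N, hN, fun x ↦ isDominatedBy_of_nhds hK h3 hNs h4⟩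
  choose! e he hes hen N hN hdom using h
  obtain ⟨t, htW, htc, htN⟩ := TopologicalSpace.countable_cover_nhdsWithin (s := W)
    (f := fun p ↦ interior (N p)) fun p hp ↦ nhdsWithin_le_nhds (interior_mem_nhds.2 (hN p hp))
  rcases t.eq_empty_or_nonempty with rfl | hne
  · refine ⟨fun _ ↦ 0, fun _ ↦ ⟨isTestField_zero, ?_, fun p T _ ↦ ?_⟩, fun p hp ↦ ?_⟩
    · exact (fieldSupport_subset_of isClosed_empty fun _ _ ↦ rfl).trans (empty_subset _)
    · rw [formAt_zero, contract_zero]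
    · simpa using htN hp
  · obtain ⟨q, rfl⟩ := htc.exists_eq_range hne
    have hq : ∀ i, q i ∈ W := fun i ↦ htW (mem_range_self i)
    refine ⟨fun i ↦ e (q i), fun i ↦ ⟨he _ (hq i), hes _ (hq i), hen _ (hq i)⟩, fun p hp ↦ ?_⟩
    obtain ⟨_, ⟨i, rfl⟩, hi⟩ := mem_iUnion₂.1 (htN hp)
    exact ⟨i, N (q i), mem_interior_iff_mem_nhds.1 hi, hdom _ (hq i)⟩

/-- A sequence of functionals, normalized by a field `e`, that tends to zero away from `Γ`. -/
structure IsConcentrating (g : LorentzMetric n M) (L : ℕ → CovariantField n M → ℝ) (Γ : Set M)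
    (e : CovariantField n M) : Prop where
  stress : ∀ k, IsStressFunctional g (L k)
  isTestField : IsTestField e
  eq_one : ∀ k, L k e = 1
  isBigO : ∀ x, IsTestField x → Disjoint (fieldSupport x) Γ →
    (fun k ↦ L k x) =O[atTop] fun k : ℕ ↦ ((k : ℝ) + 1)⁻¹

/-- If `C` tracks a curve, then the test fields `e - (k + 1) ∑_{i ≤ k} E_i`, where `e` is an energy
density at a point of the curve and the `E_i` dominate everything off the curve, yield tensors of `C`
that concentrate on the curve. -/
theorem Tracks.exists_isConcentrating [MeasurableSpace M] [BorelSpace M] {g : LorentzMetric n M}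
    {γ : ℝ → M} {J : Set ℝ} {C : Set (ContravariantField n M)}
    (hsmooth : ∀ T ∈ C, IsSmoothContra T) (hsymm : ∀ T ∈ C, ∀ p ξ η, T p ξ η = T p η ξ)
    (hdec : ∀ T ∈ C, ∀ p, DominantEnergyAt g p (T p)) (hcons : ∀ T ∈ C, IsConserved g T)
    (htracks : Tracks g C γ J) (hΓ : IsClosed (γ '' J)) {s : ℝ} (hs : s ∈ J) :
    ∃ (e : CovariantField n M) (T : ℕ → ContravariantField n M),
      (∀ k, T k ∈ C ∧ 0 < action g (T k) e) ∧
      IsConcentrating g (fun k x ↦ (action g (T k) e)⁻¹ * action g (T k) x) (γ '' J) e ∧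
      IsEnergyNonneg g e ∧
      (∃ N ∈ 𝓝 (γ s), ∀ x, IsTestField x → fieldSupport x ⊆ N → IsDominatedBy g x e) := by
  obtain ⟨e, he, -, hen, hed, heg, ⟨N, hN, hNs, K, hK, hedom⟩, -⟩ :=
    exists_energyBump g (mem_extChartAt_source (I := 𝓡 n) (γ s)) isOpen_univ (mem_univ _)
  obtain ⟨E, hE, hEdom⟩ := exists_countable_energyBumps g hΓ.isOpen_compl
  have hS : ∀ k : ℕ, IsTestField (∑ i ∈ Finset.range (k + 1), E i) := fun k ↦
    .sum fun i _ ↦ (hE i).1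
  -- the test fields to which the tracking hypothesis is applied
  have hT : ∀ k : ℕ, ∃ T ∈ C,
      0 < action g T (e - ((k : ℝ) + 1) • ∑ i ∈ Finset.range (k + 1), E i) := by
    intro k
    have hagree : ∀ p ∈ (⋃ i ∈ Finset.range (k + 1), fieldSupport (E i))ᶜ,
        (e - ((k : ℝ) + 1) • ∑ i ∈ Finset.range (k + 1), E i) p = e p := by
      intro p hp
      have h1 : formAt (∑ i ∈ Finset.range (k + 1), E i) p = 0 := by
        rw [formAt_sum]
        refine Finset.sum_eq_zero fun i hi ↦ formAt_eq_zero fun h ↦ hp ?_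
        exact mem_biUnion (Finset.mem_coe.2 hi) h
      have h2 : formAt (e - ((k : ℝ) + 1) • ∑ i ∈ Finset.range (k + 1), E i) p = formAt e p := by
        change formAt e p - ((k : ℝ) + 1) • formAt (∑ i ∈ Finset.range (k + 1), E i) p = formAt e p
        rw [h1, smul_zero, sub_zero]
      exact h2
    have hsub : γ '' J ⊆ (⋃ i ∈ Finset.range (k + 1), fieldSupport (E i))ᶜ := by
      intro p hp hp'
      obtain ⟨i, _, hi⟩ := mem_iUnion₂.1 hp'
      exact (hE i).2.1 hi hp
    refine htracks _ (he.sub ((hS k).const_smul _)) ⟨_, ?_, hsub, fun p hp ↦ ?_⟩ ⟨s, hs, ?_⟩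
    · exact (isClosed_biUnion_finset fun i _ ↦ isClosed_fieldSupport _).isOpen_compl
    · rw [hagree p hp]
      exact hed p
    · rw [hagree _ (hsub (mem_image_of_mem γ hs))]
      exact heg
  choose T hTC hTpos using hT
  have hst : ∀ k {a : ℝ}, 0 ≤ a → IsStressFunctional g fun x ↦ a * action g (T k) x := fun k _ ha ↦
    isStressFunctional_action g (hsmooth _ (hTC k)) (hsymm _ (hTC k)) (hdec _ (hTC k))
      (hcons _ (hTC k)) ha
  have hEn : ∀ k i, 0 ≤ action g (T k) (E i) := fun k i ↦ by
    simpa using (hst k zero_le_one).nonneg _ (hE i).1 (hE i).2.2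
  -- the energy on each `E i` is small compared with the energy on `e`
  have hlt : ∀ k i : ℕ, i ≤ k → ((k : ℝ) + 1) * action g (T k) (E i) < action g (T k) e := by
    intro k i hik
    have h1 := hTpos k
    have hst1 := hst k zero_le_one
    have h2 := hst1.map_sub he ((hS k).const_smul ((k : ℝ) + 1))
    rw [hst1.map_smul _ _ (hS k), hst1.map_sum fun i _ ↦ (hE i).1] at h2
    simp only [one_mul] at h2
    rw [h2] at h1
    have h3 : action g (T k) (E i) ≤ ∑ i ∈ Finset.range (k + 1), action g (T k) (E i) :=
      Finset.single_le_sum (fun i _ ↦ hEn k i) (Finset.mem_range_succ_iff.2 hik)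
    have h4 := mul_le_mul_of_nonneg_left h3 (by positivity : (0 : ℝ) ≤ (k : ℝ) + 1)
    linarith
  have hpos : ∀ k, 0 < action g (T k) e := fun k ↦
    (mul_nonneg (by positivity) (hEn k 0)).trans_lt (hlt k 0 (Nat.zero_le k))
  have hst' := fun k ↦ hst k (inv_nonneg.2 (hpos k).le)
  refine ⟨e, T, fun k ↦ ⟨hTC k, hpos k⟩, ⟨hst', he, fun k ↦ inv_mul_cancel₀ (hpos k).ne', ?_⟩, hen,
    ⟨N, hN, fun x ↦ isDominatedBy_of_nhds hK hen hNs hedom⟩⟩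
  intro x hx hxΓ
  refine hx.local_induction (P := fun x ↦ (fun k ↦ (action g (T k) e)⁻¹ * action g (T k) x) =O[atTop]
    fun k : ℕ ↦ ((k : ℝ) + 1)⁻¹) ?_ (fun x y hx hy h1 h2 ↦ ?_) fun p hp ↦ ?_
  · simp only [fun k ↦ (hst' k).map_zero]
    exact isBigO_zero _ _
  · simp only [fun k ↦ (hst' k).map_add x y hx hy]
    exact h1.add h2
  · obtain ⟨i, N, hN, hdom⟩ := hEdom p fun h ↦ disjoint_left.1 hxΓ hp h
    refine ⟨N, hN, fun y hy hyN ↦ ?_⟩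
    obtain ⟨K, hK⟩ := hdom y hy hyN
    refine IsBigO.of_bound |K| ?_
    filter_upwards [eventually_ge_atTop i] with k hk
    have h1 := (hst' k).abs_le_of_dominated hy (hE i).1 hK
    have h2 : (action g (T k) e)⁻¹ * action g (T k) (E i) ≤ ((k : ℝ) + 1)⁻¹ := by
      rw [inv_mul_le_iff₀ (hpos k), ← div_eq_mul_inv, le_div_iff₀' (by positivity)]
      exact (hlt k i hk).le
    have h3 : 0 ≤ (action g (T k) e)⁻¹ * action g (T k) (E i) :=
      mul_nonneg (inv_nonneg.2 (hpos k).le) (hEn k i)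
    rw [Real.norm_eq_abs, Real.norm_of_nonneg (by positivity)]
    calc _ ≤ _ := h1
      _ ≤ |K| * ((action g (T k) e)⁻¹ * action g (T k) (E i)) :=
        mul_le_mul_of_nonneg_right (le_abs_self K) h3
      _ ≤ _ := mul_le_mul_of_nonneg_left h2 (abs_nonneg K)

end Sequence

/-! ### The set where functionals are bounded -/

section BoundedSet

variable {n : ℕ} {M : Type*} [TopologicalSpace M] [ChartedSpace (EuclideanSpace ℝ (Fin n)) M]
  [IsManifold (𝓡 n) ∞ M]

/-- The points near which a sequence of functionals grows at most like the sequence `b`. -/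
def boundedSet (L : ℕ → CovariantField n M → ℝ) (b : ℕ → ℝ) : Set M :=
  {p | ∃ N ∈ 𝓝 p, ∀ x, IsTestField x → fieldSupport x ⊆ N → (fun k ↦ L k x) =O[atTop] b}

lemma isOpen_boundedSet (L : ℕ → CovariantField n M → ℝ) (b : ℕ → ℝ) : IsOpen (boundedSet L b) := by
  rw [isOpen_iff_mem_nhds]
  rintro p ⟨N, hN, h⟩
  filter_upwards [eventually_mem_nhds_iff.2 hN] with q hq using ⟨N, hq, h⟩

lemma isBigO_of_subset_boundedSet [T2Space M] [SecondCountableTopology M] {g : LorentzMetric n M}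
    {L : ℕ → CovariantField n M → ℝ} {b : ℕ → ℝ} (hL : ∀ k, IsStressFunctional g (L k))
    {x : CovariantField n M} (hx : IsTestField x) (h : fieldSupport x ⊆ boundedSet L b) :
    (fun k ↦ L k x) =O[atTop] b := by
  refine hx.local_induction (P := fun x ↦ (fun k ↦ L k x) =O[atTop] b) ?_
    (fun x y hx hy h1 h2 ↦ ?_) fun p hp ↦ h hp
  · simp only [fun k ↦ (hL k).map_zero]
    exact isBigO_zero _ _
  · simp only [fun k ↦ (hL k).map_add x y hx hy]
    exact h1.add h2

lemma mem_boundedSet_of_dominated {g : LorentzMetric n M}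
    {L : ℕ → CovariantField n M → ℝ} {b : ℕ → ℝ} (hL : ∀ k, IsStressFunctional g (L k))
    {e : CovariantField n M} (he : IsTestField e) (hen : IsEnergyNonneg g e)
    (heb : (fun k ↦ L k e) =O[atTop] b) {p : M} {N : Set M} (hN : N ∈ 𝓝 p)
    (h : ∀ x, IsTestField x → fieldSupport x ⊆ N → IsDominatedBy g x e) : p ∈ boundedSet L b := by
  refine ⟨N, hN, fun x hx hxN ↦ IsBigO.trans ?_ heb⟩
  obtain ⟨K, hK⟩ := h x hx hxN
  refine IsBigO.of_bound |K| (.of_forall fun k ↦ ?_)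
  have h1 := (hL k).abs_le_of_dominated hx he hK
  have h2 := (hL k).nonneg e he hen
  rw [Real.norm_eq_abs, Real.norm_of_nonneg h2]
  exact h1.trans (mul_le_mul_of_nonneg_right (le_abs_self K) h2)

end BoundedSet

open Asymptotics

/-! ### The barrier -/

section Propagation

variable {n : ℕ} {M : Type*} [TopologicalSpace M] [ChartedSpace (EuclideanSpace ℝ (Fin n)) M]
  [IsManifold (𝓡 n) ∞ M]

lemma hasDerivAt_expNegInvGlue (s : ℝ) :
    HasDerivAt expNegInvGlue (s⁻¹ ^ 2 * expNegInvGlue s) s := by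
  have := expNegInvGlue.hasDerivAt_polynomial_eval_inv_mul 1 s
  simpa using this

/-- The covector field `-exp(-1 / (t₁ - ℓ(y - y₀))) χ(y) ℓ`, extended by zero beyond the hyperplane
`ℓ(y - y₀) = t₁`. Where `χ` is constant, its covariant derivative is dominated by the positive
multiple of `ℓ ⊗ ℓ` that comes from the exponential. -/
def barrier (ℓ : Covec n) (y₀ : Vec n) (t₁ : ℝ) (χ : Vec n → ℝ) (y : Vec n) : Covec n :=
  (-(expNegInvGlue (t₁ - ℓ (y - y₀)) * χ y)) • ℓ

lemma contDiff_barrier (ℓ : Covec n) (y₀ : Vec n) (t₁ : ℝ) {χ : Vec n → ℝ} (hχ : ContDiff ℝ ∞ χ) :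
    ContDiff ℝ ∞ (barrier ℓ y₀ t₁ χ) := by
  unfold barrier
  have h1 : ContDiff ℝ ∞ expNegInvGlue := expNegInvGlue.contDiff
  have h2 : ContDiff ℝ ∞ fun y : Vec n ↦ t₁ - ℓ (y - y₀) := by fun_prop
  exact ((h1.comp h2).mul hχ).neg.smul contDiff_const

lemma tsupport_barrier_subset (ℓ : Covec n) (y₀ : Vec n) (t₁ : ℝ) (χ : Vec n → ℝ) :
    tsupport (barrier ℓ y₀ t₁ χ) ⊆ tsupport χ ∩ {y | ℓ (y - y₀) ≤ t₁} := by
  refine closure_minimal (fun y hy ↦ ?_)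
    ((isClosed_tsupport χ).inter (isClosed_le (by fun_prop) continuous_const))
  by_contra h
  refine hy ?_
  rw [mem_inter_iff, not_and_or, mem_ofPred_eq, not_le] at h
  unfold barrier
  rcases h with h | h
  · rw [image_eq_zero_of_notMem_tsupport h, mul_zero, neg_zero, zero_smul]
  · rw [expNegInvGlue.zero_of_nonpos (by linarith), zero_mul, neg_zero, zero_smul]

lemma covDeriv_barrier (g : LorentzMetric n M) (c : M) (ℓ : Covec n) (y₀ : Vec n) (t₁ : ℝ)
    {χ : Vec n → ℝ} {y : Vec n} (hχ : ∀ᶠ z in 𝓝 y, χ z = 1) :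
    covDeriv g c (barrier ℓ y₀ t₁ χ) y = expNegInvGlue (t₁ - ℓ (y - y₀)) •
      (((t₁ - ℓ (y - y₀))⁻¹ ^ 2) • outer ℓ ℓ + gammaForm g c y ℓ) := by
  have h1 : HasFDerivAt (fun z : Vec n ↦ t₁ - ℓ (z - y₀)) (-ℓ) y := by
    have := ((ℓ.hasFDerivAt (x := y - y₀)).comp y ((hasFDerivAt_id y).sub_const y₀)).const_sub t₁
    simpa using this
  have h2 := (hasDerivAt_expNegInvGlue (t₁ - ℓ (y - y₀))).comp_hasFDerivAt y h1
  have h3 := h2.neg.smul_const ℓ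
  have h4 : barrier ℓ y₀ t₁ χ =ᶠ[𝓝 y] fun z ↦ (-(expNegInvGlue (t₁ - ℓ (z - y₀)))) • ℓ := by
    filter_upwards [hχ] with z hz
    rw [barrier, hz, mul_one]
  have h5 := h3.congr_of_eventuallyEq h4
  rw [covDeriv, h5.fderiv, h4.self_of_nhds, gammaForm_smul]
  ext a b
  simp [outer_apply]
  ring

/-- Where the cutoff of the barrier is constant, its covariant derivative has a positive energy
density. -/
lemma contract_covDeriv_barrier (g : LorentzMetric n M) {c p : M}
    (hp : p ∈ (extChartAt (𝓡 n) c).source) {ℓ : Covec n} {y₀ : Vec n} {t₁ K B : ℝ} {χ : Vec n → ℝ}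
    (hχ : ∀ᶠ z in 𝓝 (extChartAt (𝓡 n) c p), χ z = 1) (hK : 0 ≤ K) (hB : 0 ≤ B)
    (hs : t₁ - ℓ (extChartAt (𝓡 n) c p - y₀) ≤ (K * B + 1)⁻¹)
    (hΓ : ‖gammaForm g c (extChartAt (𝓡 n) c p) ℓ‖ ≤ B) {T : CoForm n}
    (hT : ∀ X : Form n, |contract T (X.pull (chartD c p))| ≤
      K * ‖X‖ * contract T ((outer ℓ ℓ).pull (chartD c p)))
    (hT0 : 0 ≤ contract T ((outer ℓ ℓ).pull (chartD c p))) :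
    expNegInvGlue (t₁ - ℓ (extChartAt (𝓡 n) c p - y₀)) *
        contract T ((outer ℓ ℓ).pull (chartD c p)) ≤
      contract T (formAt (chartField c (covDeriv g c (barrier ℓ y₀ t₁ χ))) p) := by
  rw [chartField_apply hp, covDeriv_barrier g c ℓ y₀ t₁ hχ]
  set s := t₁ - ℓ (extChartAt (𝓡 n) c p - y₀)
  have h1 : (expNegInvGlue s • ((s⁻¹ ^ 2) • outer ℓ ℓ +
      gammaForm g c (extChartAt (𝓡 n) c p) ℓ)).pull (chartD c p) =
      expNegInvGlue s • ((s⁻¹ ^ 2) • (outer ℓ ℓ).pull (chartD c p) +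
      (gammaForm g c (extChartAt (𝓡 n) c p) ℓ).pull (chartD c p)) := by
    ext a b
    simp
  rw [h1, contract_smul, contract_add, contract_smul]
  rcases le_or_gt s 0 with h0 | h0
  · rw [expNegInvGlue.zero_of_nonpos h0, zero_mul, zero_mul]
  · refine mul_le_mul_of_nonneg_left ?_ (expNegInvGlue.nonneg s)
    have h2 := (abs_le.1 (hT (gammaForm g c (extChartAt (𝓡 n) c p) ℓ))).1
    have h3 : K * ‖gammaForm g c (extChartAt (𝓡 n) c p) ℓ‖ *
        contract T ((outer ℓ ℓ).pull (chartD c p)) ≤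
        K * B * contract T ((outer ℓ ℓ).pull (chartD c p)) := by gcongr
    have h4 : K * B + 1 ≤ s⁻¹ := by
      rw [le_inv_comm₀ (by positivity) h0]
      exact hs
    have h5 : K * B + 1 ≤ s⁻¹ ^ 2 := by
      have : 0 ≤ K * B := mul_nonneg hK hB
      nlinarith
    have h6 := mul_le_mul_of_nonneg_right h5 hT0
    linarith

variable [T2Space M] [SecondCountableTopology M]

/-- Propagation of bounds. Suppose that a function `χ` has been chosen that localizes near `p₀`, and
that, in the half space `ℓ ≤ t₁`, with `p₀` in its interior, `χ` is cut off only where the functionals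
are known to be bounded by `b`. Then, since the functionals vanish on the derivative of the barrier
and are positive, they are bounded by `b` near `p₀`. -/
theorem mem_boundedSet_of_cutoff (g : LorentzMetric n M) {c p₀ : M}
    (hp₀ : p₀ ∈ (extChartAt (𝓡 n) c).source) {t : Vec n} (ht : 0 < formAt g.val p₀ t t) :
    ∃ V ∈ 𝓝 p₀, ∃ δ > 0, ∀ (L : ℕ → CovariantField n M → ℝ) (b : ℕ → ℝ),
      (∀ k, IsStressFunctional g (L k)) → ∀ t₁, 0 < t₁ → t₁ < δ → ∀ χ : Vec n → ℝ, ContDiff ℝ ∞ χ →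
      HasCompactSupport χ →
      tsupport χ ⊆ (extChartAt (𝓡 n) c).target ∩ (extChartAt (𝓡 n) c).symm ⁻¹' V →
      (∀ᶠ y in 𝓝 (extChartAt (𝓡 n) c p₀), χ y = 1) →
      (∀ y ∈ tsupport χ, lowered g c p₀ t (y - extChartAt (𝓡 n) c p₀) ≤ t₁ →
        (∀ᶠ z in 𝓝 y, χ z = 1) ∨ (extChartAt (𝓡 n) c).symm y ∈ boundedSet L b) →
      p₀ ∈ boundedSet L b := by
  obtain ⟨N, hNo, hpN, hNs, K, hK, hN⟩ := exists_energy_domination g hp₀ (t := t) ht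
  set ℓ := lowered g c p₀ t with hℓ
  set y₀ := extChartAt (𝓡 n) c p₀ with hy₀
  have hpos : ∀ p ∈ N, ∀ T : CoForm n, DominantEnergyAt g p T →
      0 ≤ contract T ((outer ℓ ℓ).pull (chartD c p)) := by
    intro p hp T hT
    obtain ⟨w, hw, hwℓ⟩ := (hN p hp).2
    rw [contract_pull, contract_outer, CoForm.push_apply, ← hwℓ]
    have hw0 : w ≠ 0 := fun h ↦ by rw [h, map_zero] at hw; exact lt_irrefl _ hw
    exact hT w w ⟨hw0, hw0, hw.le, hw.le, w, hw, hw, hw⟩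
  have hyt : y₀ ∈ (extChartAt (𝓡 n) c).target := (extChartAt (𝓡 n) c).map_source hp₀
  obtain ⟨B, hB⟩ : ∃ B, ∀ᶠ p in 𝓝 p₀, ‖gammaForm g c (extChartAt (𝓡 n) c p) ℓ‖ < B := by
    have h1 : ContinuousAt (fun y ↦ ‖gammaForm g c y ℓ‖) y₀ :=
      ((contDiffOn_gammaForm g c subset_rfl (contDiffOn_const (c := ℓ))).continuousOn.continuousAt
        ((isOpen_extChartAt_target c).mem_nhds hyt)).norm
    exact ⟨‖gammaForm g c y₀ ℓ‖ + 1,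
      (continuousAt_extChartAt' hp₀).eventually (h1.eventually_lt_const (lt_add_one _))⟩
  have hB0 : 0 ≤ B := (norm_nonneg _).trans hB.self_of_nhds.le
  -- for `t₁ < δ` and `ℓ > -δ`, the factor `(t₁ - ℓ)⁻²` from the exponential exceeds `K B + 1`, so that
  -- this term outweighs the Christoffel symbols
  set δ : ℝ := (K * B + 1)⁻¹ / 2 with hδ
  have hδ0 : 0 < δ := by positivity
  have htc : ContinuousAt (fun p ↦ ℓ (extChartAt (𝓡 n) c p - y₀)) p₀ :=
    ℓ.continuous.continuousAt.comp ((continuousAt_extChartAt' hp₀).sub continuousAt_const)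
  have htδ : ∀ᶠ p in 𝓝 p₀, -δ < ℓ (extChartAt (𝓡 n) c p - y₀) :=
    htc.eventually_const_lt (by beta_reduce; rw [← hy₀, sub_self, map_zero]; exact neg_lt_zero.2 hδ0)
  refine ⟨{p | p ∈ N ∧ ‖gammaForm g c (extChartAt (𝓡 n) c p) ℓ‖ < B ∧
    -δ < ℓ (extChartAt (𝓡 n) c p - y₀)}, Filter.inter_mem (hNo.mem_nhds hpN) (hB.and htδ), δ, hδ0, ?_⟩
  intro L b hL t₁ ht₁ ht₁δ χ hχ hχc hχs hχ1 hχb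
  set v := barrier ℓ y₀ t₁ χ with hv
  have hvs : ContDiff ℝ ∞ v := contDiff_barrier ℓ y₀ t₁ hχ
  have hvt : tsupport v ⊆ tsupport χ ∩ {y | ℓ (y - y₀) ≤ t₁} := tsupport_barrier_subset ℓ y₀ t₁ χ
  have hvc : HasCompactSupport v :=
    hχc.of_isClosed_subset (isClosed_tsupport _) (hvt.trans inter_subset_left)
  have hvtt : tsupport v ⊆ (extChartAt (𝓡 n) c).target := fun y hy ↦ (hχs (hvt hy).1).1
  set x := chartField c (covDeriv g c v) with hx
  have hxc := contDiff_covDeriv g c hvs hvtt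
  have hxt := tsupport_covDeriv_subset g c v
  have hxtest : IsTestField x :=
    isTestField_chartField c hxc (hasCompactSupport_covDeriv g c hvc) (hxt.trans hvtt)
  have hxsupp : ∀ p ∈ fieldSupport x, ∃ y ∈ tsupport v, (extChartAt (𝓡 n) c).symm y = p := by
    intro p hp
    obtain ⟨y, hy, rfl⟩ := fieldSupport_chartField_subset c (hasCompactSupport_covDeriv g c hvc)
      (hxt.trans hvtt) hp
    exact ⟨y, hxt hy, rfl⟩
  -- the part of the support of `x` where `χ` is cut off
  set Z : Set M := (extChartAt (𝓡 n) c).symm ''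
    (tsupport χ ∩ ({y | ℓ (y - y₀) ≤ t₁} ∩ {y | ∀ᶠ z in 𝓝 y, χ z = 1}ᶜ)) with hZ
  have hZc : IsClosed Z := by
    refine IsCompact.isClosed (IsCompact.image_of_continuousOn ?_ ?_)
    · exact hχc.isCompact.inter_right ((isClosed_le (by fun_prop) continuous_const).inter
        isOpen_setOfPred_eventually_nhds.isClosed_compl)
    · exact (continuousOn_extChartAt_symm c).mono fun y hy ↦ (hχs hy.1).1
  have hZb : Z ⊆ boundedSet L b := by
    rintro _ ⟨y, hy, rfl⟩
    exact (hχb y hy.1 hy.2.1).resolve_left hy.2.2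
  obtain ⟨β, hβ, hβ01, hβ1, hβs⟩ := exists_smooth_cutoff n hZc (isOpen_boundedSet L b) hZb
  have hβx : IsTestField (smulField β x) := hxtest.smulField hβ
  have hdiff : ∀ p, formAt (x - smulField β x) p = (1 - β p) • formAt x p := by
    intro p
    change formAt x p - β p • formAt x p = _
    rw [sub_smul, one_smul]
  have hgood : ∀ p ∈ N, ‖gammaForm g c (extChartAt (𝓡 n) c p) ℓ‖ < B →
      -δ < ℓ (extChartAt (𝓡 n) c p - y₀) → (∀ᶠ z in 𝓝 (extChartAt (𝓡 n) c p), χ z = 1) →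
      ∀ T : CoForm n, DominantEnergyAt g p T → expNegInvGlue (t₁ - ℓ (extChartAt (𝓡 n) c p - y₀)) *
        contract T ((outer ℓ ℓ).pull (chartD c p)) ≤ contract T (formAt x p) := by
    intro p hp hpB hpδ hpχ T hT
    refine contract_covDeriv_barrier g (hNs hp) hpχ hK.le hB0 ?_ hpB.le ((hN p hp).1 T hT)
      (hpos p hp T hT)
    have : δ + δ = (K * B + 1)⁻¹ := by rw [hδ]; ring
    linarith
  -- `x - β x` has non-negative energy, and the functionals take the value `-L k (β x) = O(b)` there
  have hnn : IsEnergyNonneg g (x - smulField β x) := by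
    intro p T hT
    rw [hdiff, contract_smul]
    by_cases hpx : p ∈ fieldSupport x
    · by_cases hpZ : p ∈ Z
      · rw [(hβ1 p hpZ).self_of_nhds, sub_self, zero_mul]
      · refine mul_nonneg (sub_nonneg.2 (hβ01 p).2) ?_
        obtain ⟨y, hy, rfl⟩ := hxsupp p hpx
        have hyV := (hχs (hvt hy).1)
        obtain ⟨h1, h2, h3⟩ := hyV.2
        refine le_trans ?_ (hgood _ h1 h2 h3 ?_ T hT)
        · exact mul_nonneg (expNegInvGlue.nonneg _) (hpos _ h1 T hT)
        · rw [(extChartAt (𝓡 n) c).right_inv hyV.1]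
          by_contra h
          exact hpZ ⟨y, ⟨(hvt hy).1, (hvt hy).2, h⟩, rfl⟩
    · rw [formAt_eq_zero hpx, contract_zero, mul_zero]
  have hbound : (fun k ↦ L k (x - smulField β x)) =O[atTop] b := by
    have h1 : ∀ k, L k (x - smulField β x) = -L k (smulField β x) := fun k ↦ by
      rw [(hL k).map_sub hxtest hβx, (hL k).map_covDeriv c v hvs hvc hvtt, zero_sub]
    simp only [h1]
    exact (isBigO_of_subset_boundedSet hL hβx
      ((fieldSupport_smulField_subset β x).trans (inter_subset_left.trans hβs))).neg_left
  by_contra hp₀b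
  have hβ0 : ∀ᶠ p in 𝓝 p₀, β p = 0 := by
    filter_upwards [(isClosed_tsupport β).isOpen_compl.mem_nhds fun h ↦ hp₀b (hβs h)] with p hp
    exact image_eq_zero_of_notMem_tsupport hp
  have htt : ∀ᶠ p in 𝓝 p₀, ℓ (extChartAt (𝓡 n) c p - y₀) < t₁ / 2 :=
    htc.eventually_lt_const (by beta_reduce; rw [← hy₀, sub_self, map_zero]; exact half_pos ht₁)
  -- the energy of `x - β x` is bounded below near `p₀`, so that it dominates all fields there
  have hev : ∀ᶠ p in 𝓝 p₀, p ∈ N ∧ ∀ T : CoForm n, DominantEnergyAt g p T →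
      expNegInvGlue (t₁ / 2) * contract T ((outer ℓ ℓ).pull (chartD c p)) ≤
        contract T (formAt (x - smulField β x) p) := by
    filter_upwards [hβ0, htt, hNo.mem_nhds hpN, hB, htδ, (continuousAt_extChartAt' hp₀).eventually
      (eventually_eventually_nhds.2 hχ1)] with p h1 h2 h3 h4 h5 h6
    refine ⟨h3, fun T hT ↦ ?_⟩
    rw [hdiff, h1, sub_zero, one_smul]
    refine le_trans ?_ (hgood p h3 h4 h5 h6 T hT)
    exact mul_le_mul_of_nonneg_right (expNegInvGlue.monotone (by linarith)) (hpos p h3 T hT)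
  refine hp₀b (mem_boundedSet_of_dominated hL (hxtest.sub hβx) hnn hbound hev fun y hy hyN ↦ ?_)
  have hG := expNegInvGlue.pos_of_pos (half_pos ht₁)
  refine isDominatedBy_of_nhds (c := c) (K := K / expNegInvGlue (t₁ / 2)) (by positivity) hnn
    (fun p hp ↦ hNs hp.1) (fun p hp T hT X ↦ ((hN p hp.1).1 T hT X).trans ?_) hy hyN
  have h1 := hp.2 T hT
  rw [← le_div_iff₀' hG] at h1
  calc _ ≤ K * ‖X‖ * (contract T (formAt (x - smulField β x) p) / expNegInvGlue (t₁ / 2)) := by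
        gcongr
    _ = _ := by ring

end Propagation

/-! ### Functions on intervals -/

section Interval

lemma uniqueDiffOn_of_ordConnected {J : Set ℝ} (hJ : J.OrdConnected) (hn : J.Nontrivial) :
    UniqueDiffOn ℝ J := by
  obtain ⟨a, ha, b, hb, hab⟩ := hn.exists_lt
  refine uniqueDiffOn_convex hJ.convex ⟨(a + b) / 2, ?_⟩
  rw [mem_interior_iff_mem_nhds]
  exact mem_of_superset (Icc_mem_nhds (by linarith) (by linarith)) (hJ.out ha hb)

lemma nontrivial_inter_Ioo {J : Set ℝ} (hJ : J.OrdConnected) (hn : J.Nontrivial) {s ε : ℝ}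
    (hs : s ∈ J) (hε : 0 < ε) : (J ∩ Ioo (s - ε) (s + ε)).Nontrivial := by
  obtain ⟨r, hr, hrs⟩ := hn.exists_ne s
  rcases hrs.lt_or_gt with h | h
  · refine ⟨s, ⟨hs, by constructor <;> linarith⟩, max r (s - ε / 2), ⟨hJ.out hr hs ⟨le_max_left _ _, ?_⟩,
      ?_, ?_⟩, ?_⟩
    · exact max_le h.le (by linarith)
    · exact lt_max_of_lt_right (by linarith)
    · exact max_lt (by linarith) (by linarith)
    · exact (max_lt h (by linarith)).ne'
  · refine ⟨s, ⟨hs, by constructor <;> linarith⟩, min r (s + ε / 2), ⟨hJ.out hs hr ⟨?_, min_le_left _ _⟩,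
      ?_, ?_⟩, ?_⟩
    · exact le_min h.le (by linarith)
    · exact lt_min (by linarith) (by linarith)
    · exact min_lt_of_right_lt (by linarith)
    · exact (lt_min h (by linarith)).ne

/-- A function with positive derivative at a point of an interval is increasing nearby. -/
lemma exists_strictMonoOn_of_derivWithin_pos {J : Set ℝ} (hJ : J.OrdConnected) (hn : J.Nontrivial)
    {f : ℝ → ℝ} {s a : ℝ} (hs : s ∈ J) (ha : 0 < a)
    (hf : ContDiffOn ℝ 1 f (J ∩ Ioo (s - a) (s + a))) (hpos : 0 < derivWithin f J s) :
    ∃ ε > 0, ε ≤ a ∧ StrictMonoOn f (J ∩ Ioo (s - ε) (s + ε)) := by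
  have hu : UniqueDiffOn ℝ (J ∩ Ioo (s - a) (s + a)) :=
    uniqueDiffOn_of_ordConnected (hJ.inter ordConnected_Ioo) (nontrivial_inter_Ioo hJ hn hs ha)
  have hc := hf.continuousOn_derivWithin hu le_rfl
  have hsm : s ∈ J ∩ Ioo (s - a) (s + a) := ⟨hs, by constructor <;> linarith⟩
  have hpos' : 0 < derivWithin f (J ∩ Ioo (s - a) (s + a)) s := by
    rwa [derivWithin_inter (Ioo_mem_nhds hsm.2.1 hsm.2.2)]
  obtain ⟨ε, hε, hball⟩ := Metric.mem_nhdsWithin_iff.1 ((hc s hsm).eventually_const_lt hpos')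
  refine ⟨min ε a, lt_min hε ha, min_le_right _ _, ?_⟩
  have hsub : J ∩ Ioo (s - min ε a) (s + min ε a) ⊆ J ∩ Ioo (s - a) (s + a) :=
    inter_subset_inter_right _ (Ioo_subset_Ioo (by linarith [min_le_right ε a])
      (by linarith [min_le_right ε a]))
  refine strictMonoOn_of_deriv_pos (hJ.inter ordConnected_Ioo).convex (hf.continuousOn.mono hsub)
    fun r hr ↦ ?_
  have hr1 := interior_subset hr
  have hr2 : r ∈ Metric.ball s ε := by
    rw [Real.ball_eq_Ioo]
    exact ⟨by linarith [hr1.2.1, min_le_left ε a], by linarith [hr1.2.2, min_le_left ε a]⟩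
  have h1 : 0 < derivWithin f (J ∩ Ioo (s - a) (s + a)) r := hball ⟨hr2, hsub hr1⟩
  rwa [derivWithin_of_mem_nhds (mem_of_superset (mem_interior_iff_mem_nhds.1 hr) hsub)] at h1

end Interval

/-! ### Embedded curves -/

section Curve

variable {n : ℕ} {M : Type*} [TopologicalSpace M] [ChartedSpace (EuclideanSpace ℝ (Fin n)) M]

variable (n) in
/-- The common features of properly embedded arcs and of simple closed curves (the latter with `J`
the whole line, so that the curve has no end points): a closed curve that, locally in the manifold,
consists of a single short piece. -/
structure IsEmbeddedCurve (γ : ℝ → M) (J : Set ℝ) : Prop where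
  ordConnected : J.OrdConnected
  nontrivial : J.Nontrivial
  contMDiffOn : ContMDiffOn 𝓘(ℝ, ℝ) (𝓡 n) ∞ γ J
  isClosed : IsClosed (γ '' J)
  local_piece : ∀ s ∈ J, ∀ ε > 0, ∃ N ∈ 𝓝 (γ s), N ∩ γ '' J ⊆ γ '' (J ∩ Ioo (s - ε) (s + ε))

/-- The velocity, as a vector of the model space. -/
def vel (γ : ℝ → M) (J : Set ℝ) (s : ℝ) : Vec n := velocity γ J s

variable {γ : ℝ → M} {J : Set ℝ}

namespace IsEmbeddedCurve

lemma uniqueDiffOn (h : IsEmbeddedCurve n γ J) : UniqueDiffOn ℝ J :=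
  uniqueDiffOn_of_ordConnected h.ordConnected h.nontrivial

lemma exists_subset_source (h : IsEmbeddedCurve n γ J) {s : ℝ} (hs : s ∈ J) {W : Set M}
    (hW : W ∈ 𝓝 (γ s)) : ∃ ε > 0, ∀ r ∈ J ∩ Ioo (s - ε) (s + ε), γ r ∈ W := by
  obtain ⟨ε, hε, hb⟩ := Metric.mem_nhdsWithin_iff.1 ((h.contMDiffOn.continuousOn s hs) hW)
  refine ⟨ε, hε, fun r hr ↦ hb ⟨?_, hr.1⟩⟩
  rw [Real.ball_eq_Ioo]
  exact hr.2

variable [IsManifold (𝓡 n) ∞ M]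

lemma contDiffOn_coordCurve (h : IsEmbeddedCurve n γ J) (c : M) :
    ContDiffOn ℝ ∞ (coordCurve (n := n) γ c) (J ∩ γ ⁻¹' (extChartAt (𝓡 n) c).source) := by
  rw [← contMDiffOn_iff_contDiffOn]
  exact ContMDiffOn.comp (contMDiffOn_extChartAt (I := 𝓡 n) (x := c) (n := ∞))
    (h.contMDiffOn.mono inter_subset_left) fun r hr ↦ by
      have := hr.2
      rwa [mem_preimage, extChartAt_source] at this

lemma hasDerivWithinAt_coordCurve (h : IsEmbeddedCurve n γ J) {c : M} {s : ℝ} (hs : s ∈ J)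
    (hc : γ s ∈ (extChartAt (𝓡 n) c).source) :
    HasDerivWithinAt (coordCurve (n := n) γ c) (chartD c (γ s) (vel γ J s)) J s := by
  have h1 : HasMFDerivWithinAt 𝓘(ℝ, ℝ) (𝓡 n) γ J s (mfderivWithin 𝓘(ℝ, ℝ) (𝓡 n) γ J s) :=
    ((h.contMDiffOn s hs).mdifferentiableWithinAt (by simp)).hasMFDerivWithinAt
  have h2 : HasMFDerivAt (𝓡 n) 𝓘(ℝ, EuclideanSpace ℝ (Fin n)) (extChartAt (𝓡 n) c) (γ s)
      (mfderiv (𝓡 n) 𝓘(ℝ, EuclideanSpace ℝ (Fin n)) (extChartAt (𝓡 n) c) (γ s)) := by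
    refine (mdifferentiableAt_extChartAt ?_).hasMFDerivAt
    rwa [extChartAt_source] at hc
  have h3 := h2.comp_hasMFDerivWithinAt s h1
  have h4 : HasFDerivWithinAt (coordCurve (n := n) γ c) ((chartD c (γ s)).comp
      (show ℝ →L[ℝ] Vec n from mfderivWithin 𝓘(ℝ, ℝ) (𝓡 n) γ J s)) J s := h3.hasFDerivWithinAt
  exact h4.hasDerivWithinAt

lemma derivWithin_coordCurve (h : IsEmbeddedCurve n γ J) {c : M} {s : ℝ} (hs : s ∈ J)
    (hc : γ s ∈ (extChartAt (𝓡 n) c).source) :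
    derivWithin (coordCurve (n := n) γ c) J s = chartD c (γ s) (vel γ J s) :=
  (h.hasDerivWithinAt_coordCurve hs hc).derivWithin (h.uniqueDiffOn s hs)

end IsEmbeddedCurve

end Curve

open Asymptotics

/-! ### Propagation of bounds along a causal curve -/

section Slab

variable {n : ℕ} {M : Type*} [TopologicalSpace M] [ChartedSpace (EuclideanSpace ℝ (Fin n)) M]
  [IsManifold (𝓡 n) ∞ M] [T2Space M] [SecondCountableTopology M]

/-- A bound that holds off `Γ` and on the part of `Γ` on the lower face of arbitrarily thin slabs
`τ₁ ≤ ℓ ≤ t₁` around `p₀` holds at `p₀`, if `Γ` leaves these slabs only through the faces. -/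
lemma mem_boundedSet_of_slab (g : LorentzMetric n M) {c p₀ : M}
    (hp₀ : p₀ ∈ (extChartAt (𝓡 n) c).source) {t : Vec n} (ht : 0 < formAt g.val p₀ t t)
    {L : ℕ → CovariantField n M → ℝ} {b : ℕ → ℝ} (hL : ∀ k, IsStressFunctional g (L k)) {Γ : Set M}
    (hΓ : Γᶜ ⊆ boundedSet L b) {V : Set M} (hV : V ∈ 𝓝 p₀)
    (H : ∀ U ∈ 𝓝 p₀, ∀ δ > 0, ∃ τ₁, -δ < τ₁ ∧ τ₁ < 0 ∧ ∃ t₁, 0 < t₁ ∧ t₁ < δ ∧ ∀ q ∈ V ∩ Γ,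
      (τ₁ ≤ lowered g c p₀ t (extChartAt (𝓡 n) c q - extChartAt (𝓡 n) c p₀) →
        lowered g c p₀ t (extChartAt (𝓡 n) c q - extChartAt (𝓡 n) c p₀) ≤ t₁ → q ∈ U) ∧
      (lowered g c p₀ t (extChartAt (𝓡 n) c q - extChartAt (𝓡 n) c p₀) = τ₁ → q ∈ boundedSet L b)) :
    p₀ ∈ boundedSet L b := by
  obtain ⟨V₁, hV₁, δ, hδ, hmain⟩ := mem_boundedSet_of_cutoff g hp₀ ht
  set ℓ := lowered g c p₀ t with hℓ
  set φ := extChartAt (𝓡 n) c with hφ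
  have hφc : ContinuousAt φ p₀ := continuousAt_extChartAt' hp₀
  have hyt : φ p₀ ∈ φ.target := φ.map_source hp₀
  have hsymm : ContinuousAt φ.symm (φ p₀) := continuousAt_extChartAt_symm' hp₀
  have hmem : φ.target ∩ φ.symm ⁻¹' (V ∩ V₁) ∈ 𝓝 (φ p₀) := by
    refine Filter.inter_mem ((isOpen_extChartAt_target c).mem_nhds hyt) (hsymm ?_)
    rw [φ.left_inv hp₀]
    exact Filter.inter_mem hV hV₁
  obtain ⟨r, hr, hball⟩ := Metric.mem_nhds_iff.1 hmem
  have hcb : Metric.closedBall (φ p₀) (r / 2) ⊆ φ.target ∩ φ.symm ⁻¹' (V ∩ V₁) :=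
    (Metric.closedBall_subset_ball (by linarith)).trans hball
  obtain ⟨τ₁, hτδ, hτ0, t₁, ht0, ht₁δ, hq⟩ := H (φ ⁻¹' Metric.ball (φ p₀) (r / 4))
    (hφc (Metric.ball_mem_nhds _ (by positivity))) δ hδ
  have hℓc : Continuous fun y : Vec n ↦ ℓ (y - φ p₀) := by fun_prop
  -- the compact set of points at which the bound is not known, at positive distance from `ℓ = τ₁`
  have hKc : IsCompact (Metric.closedBall (φ p₀) (r / 2) ∩ φ.symm ⁻¹' (boundedSet L b)ᶜ) := by
    have h1 : IsClosed (Metric.closedBall (φ p₀) (r / 2) ∩ φ.symm ⁻¹' (boundedSet L b)ᶜ) :=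
      ((continuousOn_extChartAt_symm c).mono fun y hy ↦ (hcb hy).1).preimage_isClosed_of_isClosed
        Metric.isClosed_closedBall (isOpen_boundedSet L b).isClosed_compl
    exact (isCompact_closedBall _ _).of_isClosed_subset h1 inter_subset_left
  have hK : ∀ y ∈ Metric.closedBall (φ p₀) (r / 2), φ.symm y ∉ boundedSet L b →
      φ.symm y ∈ V ∩ Γ ∧ φ (φ.symm y) = y := fun y hy hyb ↦
    ⟨⟨(hcb hy).2.1, by_contra fun h ↦ hyb (hΓ h)⟩, φ.right_inv (hcb hy).1⟩
  obtain ⟨η, hη, hKη⟩ : ∃ η > 0, ∀ y ∈ Metric.closedBall (φ p₀) (r / 2),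
      φ.symm y ∉ boundedSet L b → η ≤ |ℓ (y - φ p₀) - τ₁| := by
    rcases (Metric.closedBall (φ p₀) (r / 2) ∩ φ.symm ⁻¹' (boundedSet L b)ᶜ).eq_empty_or_nonempty
      with h0 | h0
    · exact ⟨1, one_pos, fun y hy hyb ↦ absurd (h0.subset ⟨hy, hyb⟩) (notMem_empty _)⟩
    · obtain ⟨y, hy, hmin⟩ := hKc.exists_isMinOn h0
        ((hℓc.sub continuous_const).abs.continuousOn (f := fun y ↦ |ℓ (y - φ p₀) - τ₁|))
      refine ⟨|ℓ (y - φ p₀) - τ₁|, abs_pos.2 fun h ↦ ?_, fun z hz hzb ↦ hmin ⟨hz, hzb⟩⟩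
      obtain ⟨h1, h2⟩ := hK y hy.1 hy.2
      refine hy.2 ((hq _ h1).2 ?_)
      rw [h2]
      linarith
  set η' := min (η / 2) (-τ₁ / 2) with hη'
  have hη'0 : 0 < η' := lt_min (by linarith) (by linarith)
  have hη'1 : η' < η := (min_le_left _ _).trans_lt (by linarith)
  have hη'2 : τ₁ + η' < 0 := by
    have : η' ≤ -τ₁ / 2 := min_le_right _ _
    linarith
  let B : ContDiffBump (φ p₀) := ⟨r / 4, r / 2, by positivity, by linarith⟩
  set σ : Vec n → ℝ := fun y ↦ Real.smoothTransition ((ℓ (y - φ p₀) - τ₁) / η') with hσ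
  -- the cutoff is a bump function times `σ`, which is zero below the slab and one just above its lower
  -- face
  have hσd : ContDiff ℝ ∞ σ := by
    refine Real.smoothTransition.contDiff.comp ?_
    fun_prop
  have hσ1 : ∀ y, τ₁ + η' < ℓ (y - φ p₀) → ∀ᶠ z in 𝓝 y, σ z = 1 := by
    intro y hy
    filter_upwards [hℓc.continuousAt.eventually_const_lt hy] with z hz
    refine Real.smoothTransition.one_of_one_le ?_
    rw [le_div_iff₀ hη'0]
    linarith
  have hB1 : ∀ y ∈ Metric.ball (φ p₀) (r / 4), ∀ᶠ z in 𝓝 y, B z = 1 := fun y hy ↦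
    B.eventuallyEq_one_of_mem_ball hy
  have hts : tsupport (fun y ↦ B y * σ y) ⊆
      Metric.closedBall (φ p₀) (r / 2) ∩ {y | τ₁ ≤ ℓ (y - φ p₀)} := by
    refine closure_minimal (fun y hy ↦ ?_)
      (Metric.isClosed_closedBall.inter (isClosed_le continuous_const hℓc))
    refine ⟨?_, ?_⟩
    · have : y ∈ tsupport B := subset_tsupport _ (left_ne_zero_of_mul hy)
      rwa [B.tsupport_eq] at this
    · by_contra h
      rw [mem_ofPred_eq, not_le] at h
      refine right_ne_zero_of_mul hy (Real.smoothTransition.zero_of_nonpos ?_)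
      exact div_nonpos_of_nonpos_of_nonneg (by linarith) hη'0.le
  refine hmain L b hL t₁ ht0 ht₁δ (fun y ↦ B y * σ y) (B.contDiff.mul hσd) ?_ ?_ ?_ ?_
  · exact (isCompact_closedBall (φ p₀) (r / 2)).of_isClosed_subset (isClosed_tsupport _)
      (hts.trans inter_subset_left)
  · exact fun y hy ↦ ⟨(hcb (hts hy).1).1, (hcb (hts hy).1).2.2⟩
  · filter_upwards [hB1 _ (Metric.mem_ball_self (by positivity)),
      hσ1 (φ p₀) (by rw [sub_self, map_zero]; exact hη'2)] with y h1 h2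
    rw [h1, h2, one_mul]
  · intro y hy hyt₁
    by_cases hyb : φ.symm y ∈ boundedSet L b
    · exact .inr hyb
    · left
      obtain ⟨h1, h2⟩ := hK y (hts hy).1 hyb
      have h3 := hKη y (hts hy).1 hyb
      have hτy : τ₁ ≤ ℓ (y - φ p₀) := (hts hy).2
      rw [abs_of_nonneg (by linarith)] at h3
      have h4 := (hq _ h1).1
      rw [mem_preimage, h2] at h4
      filter_upwards [hB1 y (h4 hτy hyt₁), hσ1 y (by linarith)] with z h5 h6
      rw [h5, h6, one_mul]

/-- Bounds propagate along a curve on which a coordinate `ℓ` increases: if the bound holds at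
parameters just before `s₀`, or if there are no such parameters, then it holds at `s₀`. -/
lemma mem_boundedSet_of_strictMonoOn (g : LorentzMetric n M) {c : M} {γ : ℝ → M} {J : Set ℝ} {s₀ : ℝ}
    (hs₀ : s₀ ∈ J) (hJ : J.OrdConnected) (hγ : ContinuousOn γ J)
    (hloc : ∀ ε > 0, ∃ N ∈ 𝓝 (γ s₀), N ∩ γ '' J ⊆ γ '' (J ∩ Ioo (s₀ - ε) (s₀ + ε)))
    (hc : γ s₀ ∈ (extChartAt (𝓡 n) c).source) {t : Vec n} (ht : 0 < formAt g.val (γ s₀) t t)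
    {L : ℕ → CovariantField n M → ℝ} {b : ℕ → ℝ} (hL : ∀ k, IsStressFunctional g (L k))
    (hΓ : (γ '' J)ᶜ ⊆ boundedSet L b) {ε : ℝ} (hε : 0 < ε)
    (hmono : StrictMonoOn (fun s ↦ lowered g c (γ s₀) t
      (coordCurve (n := n) γ c s - coordCurve (n := n) γ c s₀)) (J ∩ Ioo (s₀ - ε) (s₀ + ε)))
    (H : (∀ s ∈ J, s₀ ≤ s) ∨ ∀ δ > 0, ∃ s ∈ J, s₀ - δ < s ∧ s < s₀ ∧ γ s ∈ boundedSet L b) :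
    γ s₀ ∈ boundedSet L b := by
  obtain ⟨V, hV, hVγ⟩ := hloc ε hε
  set τ : ℝ → ℝ := fun s ↦ lowered g c (γ s₀) t
      (coordCurve (n := n) γ c s - coordCurve (n := n) γ c s₀) with hτ
  have hτ0 : τ s₀ = 0 := by simp [hτ]
  have hs₀' : s₀ ∈ J ∩ Ioo (s₀ - ε) (s₀ + ε) := ⟨hs₀, by constructor <;> linarith⟩
  have hτc : ContinuousWithinAt τ J s₀ := by
    refine (lowered g c (γ s₀) t).continuous.continuousAt.comp_continuousWithinAt ?_
    refine ContinuousWithinAt.sub ?_ continuousWithinAt_const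
    exact (continuousAt_extChartAt' hc).comp_continuousWithinAt (hγ s₀ hs₀)
  refine mem_boundedSet_of_slab g hc ht hL hΓ hV fun U hU δ hδ ↦ ?_
  have hev : ∀ᶠ s in 𝓝[J] s₀, γ s ∈ U ∧ -δ < τ s := by
    refine Filter.Eventually.and (hγ s₀ hs₀ hU) (hτc.eventually_const_lt ?_)
    rw [hτ0]
    exact neg_lt_zero.2 hδ
  obtain ⟨ε₀, hε₀, hb₀⟩ := Metric.mem_nhdsWithin_iff.1 hev
  rw [Real.ball_eq_Ioo] at hb₀
  obtain ⟨ε₁, hε₁, hε₁ε, hb⟩ : ∃ ε₁ > 0, ε₁ ≤ ε ∧ ∀ s ∈ J, s₀ - ε₁ < s → s < s₀ + ε₁ →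
      γ s ∈ U ∧ -δ < τ s := by
    refine ⟨min ε₀ ε, lt_min hε₀ hε, min_le_right _ _, fun s hs h1 h2 ↦ hb₀ ⟨⟨?_, ?_⟩, hs⟩⟩
    · linarith [min_le_left ε₀ ε]
    · linarith [min_le_left ε₀ ε]
  -- the lower face of the slab
  obtain ⟨τ₁, hτ₁δ, hτ₁, hlow⟩ : ∃ τ₁, -δ < τ₁ ∧ τ₁ < 0 ∧ ∀ s ∈ J ∩ Ioo (s₀ - ε) (s₀ + ε),
      (τ₁ ≤ τ s → s₀ - ε₁ < s) ∧ (τ s = τ₁ → γ s ∈ boundedSet L b) := by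
    rcases H with H | H
    · refine ⟨-δ / 2, by linarith, by linarith, fun s hs ↦ ⟨fun _ ↦ ?_, fun h ↦ ?_⟩⟩
      · linarith [H s hs.1]
      · have := hmono.monotoneOn hs₀' hs (H s hs.1)
        rw [h, hτ0] at this
        linarith
    · obtain ⟨s₁, hs₁J, hs₁, hs₁', hs₁b⟩ := H ε₁ hε₁
      have hs₁m : s₁ ∈ J ∩ Ioo (s₀ - ε) (s₀ + ε) := ⟨hs₁J, by constructor <;> linarith⟩
      have h1 := hmono hs₁m hs₀' hs₁'
      rw [hτ0] at h1
      refine ⟨τ s₁, (hb s₁ hs₁J hs₁ (by linarith)).2, h1, fun s hs ↦ ⟨fun h ↦ ?_, fun h ↦ ?_⟩⟩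
      · exact hs₁.trans_le ((hmono.le_iff_le hs₁m hs).1 h)
      · rwa [hmono.injOn hs hs₁m h]
  -- the upper face of the slab
  obtain ⟨t₁, ht₁, ht₁δ, hup⟩ : ∃ t₁, 0 < t₁ ∧ t₁ < δ ∧ ∀ s ∈ J ∩ Ioo (s₀ - ε) (s₀ + ε),
      τ s ≤ t₁ → s < s₀ + ε₁ := by
    by_cases h : ∃ s₂ ∈ J, s₀ < s₂ ∧ s₂ < s₀ + ε₁
    · obtain ⟨s₂, hs₂J, hs₂, hs₂'⟩ := h
      have hs₂m : s₂ ∈ J ∩ Ioo (s₀ - ε) (s₀ + ε) := ⟨hs₂J, by constructor <;> linarith⟩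
      have h1 := hmono hs₀' hs₂m hs₂
      rw [hτ0] at h1
      refine ⟨min (τ s₂) (δ / 2), lt_min h1 (by linarith), min_lt_of_right_lt (by linarith),
        fun s hs h ↦ ?_⟩
      exact ((hmono.le_iff_le hs hs₂m).1 (h.trans (min_le_left _ _))).trans_lt hs₂'
    · refine ⟨δ / 2, by linarith, by linarith, fun s hs _ ↦ ?_⟩
      by_contra! h2
      refine h ⟨s₀ + ε₁ / 2, hJ.out hs₀ hs.1 ⟨by linarith, by linarith⟩, by linarith, by linarith⟩
  refine ⟨τ₁, hτ₁δ, hτ₁, t₁, ht₁, ht₁δ, fun q hq ↦ ?_⟩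
  obtain ⟨s, hs, rfl⟩ := hVγ hq
  exact ⟨fun h1 h2 ↦ (hb s hs.1 ((hlow s hs).1 h1) (hup s hs h2)).1, (hlow s hs).2⟩

end Slab

section Propagation

variable {n : ℕ} {M : Type*} [TopologicalSpace M] [ChartedSpace (EuclideanSpace ℝ (Fin n)) M]
  [IsManifold (𝓡 n) ∞ M] {γ : ℝ → M} {J : Set ℝ}

/-- The velocity is causal and non-zero. -/
def IsCausalCurve (g : LorentzMetric n M) (γ : ℝ → M) (J : Set ℝ) : Prop :=
  ∀ s ∈ J, (vel γ J s : Vec n) ≠ 0 ∧ 0 ≤ formAt g.val (γ s) (vel γ J s) (vel γ J s)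

/-- No causal vector is orthogonal to a timelike vector, so that a sign can be chosen. -/
lemma exists_timelike_pos (g : LorentzMetric n M) (p : M) {u : Vec n} (hu : u ≠ 0)
    (huu : 0 ≤ formAt g.val p u u) : ∃ t : Vec n, 0 < formAt g.val p t t ∧ 0 < formAt g.val p t u := by
  obtain ⟨t, ht, hneg⟩ : ∃ t : Vec n, 0 < formAt g.val p t t ∧ ∀ w : Vec n, w ≠ 0 →
    formAt g.val p t w = 0 → formAt g.val p w w < 0 := g.signature p
  rcases lt_trichotomy (formAt g.val p t u) 0 with h | h | h
  · refine ⟨-t, ?_, ?_⟩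
    · rw [map_neg, map_neg, _root_.neg_apply, neg_neg]
      exact ht
    · rw [map_neg, _root_.neg_apply]
      linarith
  · exact absurd huu (not_le.2 (hneg u hu h))
  · exact ⟨t, ht, h⟩

lemma lowered_chartD (g : LorentzMetric n M) {c p : M} (hp : p ∈ (extChartAt (𝓡 n) c).source)
    (t u : Vec n) : lowered g c p t (chartD c p u) = formAt g.val p t u := by
  rw [lowered, ContinuousLinearMap.comp_apply, chartDSymm_chartD hp]

lemma IsEmbeddedCurve.exists_strictMonoOn_lowered (h : IsEmbeddedCurve n γ J) (g : LorentzMetric n M)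
    {s : ℝ} (hs : s ∈ J) {t : Vec n} (ht : 0 < formAt g.val (γ s) t (vel γ J s)) :
    ∃ ε > 0, StrictMonoOn (fun r ↦ lowered g (γ s) (γ s) t
      (coordCurve (n := n) γ (γ s) r - coordCurve (n := n) γ (γ s) s))
      (J ∩ Ioo (s - ε) (s + ε)) := by
  have hsrc := mem_extChartAt_source (I := 𝓡 n) (γ s)
  obtain ⟨a, ha, hsub⟩ := h.exists_subset_source hs
    ((isOpen_extChartAt_source (I := 𝓡 n) (γ s)).mem_nhds hsrc)
  have hcd : ContDiffOn ℝ ∞ (coordCurve (n := n) γ (γ s)) (J ∩ Ioo (s - a) (s + a)) :=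
    (h.contDiffOn_coordCurve (γ s)).mono fun r hr ↦ ⟨hr.1, hsub r hr⟩
  have hd : HasDerivWithinAt (fun r ↦ lowered g (γ s) (γ s) t
      (coordCurve (n := n) γ (γ s) r - coordCurve (n := n) γ (γ s) s))
      (lowered g (γ s) (γ s) t (chartD (γ s) (γ s) (vel γ J s))) J s :=
    (lowered g (γ s) (γ s) t).hasFDerivAt.comp_hasDerivWithinAt s
      ((h.hasDerivWithinAt_coordCurve hs hsrc).sub_const _)
  obtain ⟨ε, hε, -, hmono⟩ := exists_strictMonoOn_of_derivWithin_pos h.ordConnected h.nontrivial hs ha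
    (f := fun r ↦ lowered g (γ s) (γ s) t
      (coordCurve (n := n) γ (γ s) r - coordCurve (n := n) γ (γ s) s))
    (((lowered g (γ s) (γ s) t).contDiff.comp_contDiffOn (hcd.sub contDiffOn_const)).of_le (by simp))
    (by rw [hd.derivWithin (h.uniqueDiffOn s hs), lowered_chartD g hsrc]; exact ht)
  exact ⟨ε, hε, hmono⟩

variable [T2Space M] [SecondCountableTopology M]

/-- Bounds propagate along a causal curve in the direction of its parametrization. -/
lemma IsEmbeddedCurve.mem_boundedSet_forward (h : IsEmbeddedCurve n γ J) {g : LorentzMetric n M}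
    (hcausal : IsCausalCurve g γ J) {L : ℕ → CovariantField n M → ℝ} {b : ℕ → ℝ}
    (hL : ∀ k, IsStressFunctional g (L k)) (hΓ : (γ '' J)ᶜ ⊆ boundedSet L b) {s₀ : ℝ} (hs₀ : s₀ ∈ J)
    (H : (∀ s ∈ J, s₀ ≤ s) ∨ ∀ δ > 0, ∃ s ∈ J, s₀ - δ < s ∧ s < s₀ ∧ γ s ∈ boundedSet L b) :
    γ s₀ ∈ boundedSet L b := by
  obtain ⟨t, ht, htu⟩ := exists_timelike_pos g (γ s₀) (hcausal s₀ hs₀).1 (hcausal s₀ hs₀).2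
  obtain ⟨ε, hε, hmono⟩ := h.exists_strictMonoOn_lowered g hs₀ htu
  exact mem_boundedSet_of_strictMonoOn g hs₀ h.ordConnected h.contMDiffOn.continuousOn
    (h.local_piece s₀ hs₀) (mem_extChartAt_source (I := 𝓡 n) (γ s₀)) ht hL hΓ hε hmono H

/-- Bounds propagate along a causal curve against the direction of its parametrization: reverse the
curve, and replace the timelike vector `t` by `-t`. -/
lemma IsEmbeddedCurve.mem_boundedSet_backward (h : IsEmbeddedCurve n γ J) {g : LorentzMetric n M}
    (hcausal : IsCausalCurve g γ J) {L : ℕ → CovariantField n M → ℝ} {b : ℕ → ℝ}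
    (hL : ∀ k, IsStressFunctional g (L k)) (hΓ : (γ '' J)ᶜ ⊆ boundedSet L b) {s₀ : ℝ} (hs₀ : s₀ ∈ J)
    (H : (∀ s ∈ J, s ≤ s₀) ∨ ∀ δ > 0, ∃ s ∈ J, s₀ < s ∧ s < s₀ + δ ∧ γ s ∈ boundedSet L b) :
    γ s₀ ∈ boundedSet L b := by
  obtain ⟨t, ht, htu⟩ := exists_timelike_pos g (γ s₀) (hcausal s₀ hs₀).1 (hcausal s₀ hs₀).2
  obtain ⟨ε, hε, hmono⟩ := h.exists_strictMonoOn_lowered g hs₀ htu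
  have himg : ∀ S : Set ℝ, (fun s ↦ γ (-s)) '' (Neg.neg ⁻¹' S) = γ '' S := by
    intro S
    ext p
    constructor
    · rintro ⟨s, hs, rfl⟩
      exact ⟨-s, hs, rfl⟩
    · rintro ⟨s, hs, rfl⟩
      exact ⟨-s, by simpa using hs, by simp⟩
  have hIoo : ∀ ε : ℝ, Neg.neg ⁻¹' J ∩ Ioo (-s₀ - ε) (-s₀ + ε) =
      Neg.neg ⁻¹' (J ∩ Ioo (s₀ - ε) (s₀ + ε)) := by
    intro ε
    ext s
    simp only [mem_inter_iff, mem_preimage, mem_Ioo]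
    refine and_congr_right fun _ ↦ ⟨fun h ↦ ⟨by linarith, by linarith⟩, fun h ↦ ⟨by linarith, by linarith⟩⟩
  have hlow : ∀ w : Vec n, lowered g (γ s₀) (γ s₀) (-t) w = -lowered g (γ s₀) (γ s₀) t w := by
    intro w
    simp only [lowered, ContinuousLinearMap.comp_apply, map_neg, _root_.neg_apply]
  have key := mem_boundedSet_of_strictMonoOn g (c := γ s₀) (γ := fun s ↦ γ (-s)) (J := Neg.neg ⁻¹' J)
    (s₀ := -s₀) (t := -t) (L := L) (b := b) (ε := ε)
  simp only [neg_neg, himg, hIoo] at key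
  refine key (by simpa using hs₀) ⟨fun a ha b hb x hx ↦ h.ordConnected.out hb ha
    ⟨by linarith [hx.2], by linarith [hx.1]⟩⟩ ?_ (h.local_piece s₀ hs₀)
    (mem_extChartAt_source (I := 𝓡 n) (γ s₀)) ?_ hL hΓ hε ?_ ?_
  · exact h.contMDiffOn.continuousOn.comp continuous_neg.continuousOn fun s hs ↦ hs
  · rw [map_neg, map_neg, _root_.neg_apply, neg_neg]
    exact ht
  · intro r hr s hs hrs
    have := hmono hs hr (by linarith : -s < -r)
    simp only [hlow]
    simp only [coordCurve, neg_neg] at this ⊢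
    linarith
  · rcases H with H | H
    · exact .inl fun s hs ↦ by linarith [H _ hs]
    · refine .inr fun δ hδ ↦ ?_
      obtain ⟨s, hs, h1, h2, h3⟩ := H δ hδ
      exact ⟨-s, by simpa using hs, by linarith, by linarith, by simpa using h3⟩

/-- A bound that holds off a causal curve and near one of its points holds everywhere: the parameters
of the points at which it holds form an open and closed set. -/
theorem IsEmbeddedCurve.boundedSet_eq_univ (h : IsEmbeddedCurve n γ J) {g : LorentzMetric n M}
    (hcausal : IsCausalCurve g γ J) {L : ℕ → CovariantField n M → ℝ} {b : ℕ → ℝ}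
    (hL : ∀ k, IsStressFunctional g (L k)) (hΓ : (γ '' J)ᶜ ⊆ boundedSet L b) {s₁ : ℝ} (hs₁ : s₁ ∈ J)
    (hb : γ s₁ ∈ boundedSet L b) : boundedSet L b = univ := by
  have hpc : PreconnectedSpace J := isPreconnected_iff_preconnectedSpace.1
    h.ordConnected.isPreconnected
  have hcont : Continuous fun s : J ↦ γ s := h.contMDiffOn.continuousOn.domRestrict
  have hclopen : IsClopen {s : J | γ s ∈ boundedSet L b} := by
    refine ⟨isClosed_of_closure_subset fun s hs ↦ ?_, (isOpen_boundedSet L b).preimage hcont⟩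
    by_contra hsb
    have hsb' : γ s ∉ boundedSet L b := hsb
    have hf : ¬ ∀ δ > 0, ∃ r ∈ J, (s : ℝ) - δ < r ∧ r < s ∧ γ r ∈ boundedSet L b := fun H ↦
      hsb' (h.mem_boundedSet_forward hcausal hL hΓ s.2 (.inr H))
    have hb : ¬ ∀ δ > 0, ∃ r ∈ J, (s : ℝ) < r ∧ r < s + δ ∧ γ r ∈ boundedSet L b := fun H ↦
      hsb' (h.mem_boundedSet_backward hcausal hL hΓ s.2 (.inr H))
    push Not at hf hb
    obtain ⟨δ₁, hδ₁, h1⟩ := hf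
    obtain ⟨δ₂, hδ₂, h2⟩ := hb
    obtain ⟨r, hr, hdist⟩ := Metric.mem_closure_iff.1 hs (min δ₁ δ₂) (lt_min hδ₁ hδ₂)
    rw [Subtype.dist_eq, Real.dist_eq, abs_lt] at hdist
    rcases lt_trichotomy (r : ℝ) s with h3 | h3 | h3
    · exact h1 r r.2 (by linarith [min_le_left δ₁ δ₂, hdist.2]) h3 hr
    · exact hsb' (by rw [← h3]; exact hr)
    · exact h2 r r.2 h3 (by linarith [min_le_right δ₁ δ₂, hdist.1]) hr
  have huniv := hclopen.eq_univ ⟨⟨s₁, hs₁⟩, hb⟩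
  refine eq_univ_of_forall fun p ↦ ?_
  by_cases hp : p ∈ γ '' J
  · obtain ⟨s, hs, rfl⟩ := hp
    exact huniv.superset (mem_univ (⟨s, hs⟩ : J))
  · exact hΓ hp

/-- Concentrating functionals are bounded: `e` dominates the fields near one point of the curve, and
this bound propagates. -/
theorem IsConcentrating.isBigO_one {g : LorentzMetric n M} {L : ℕ → CovariantField n M → ℝ}
    {e : CovariantField n M} (hL : IsConcentrating g L (γ '' J) e) (h : IsEmbeddedCurve n γ J)
    (hcausal : IsCausalCurve g γ J) {s₁ : ℝ} (hs₁ : s₁ ∈ J) (hen : IsEnergyNonneg g e)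
    (hdom : ∃ N ∈ 𝓝 (γ s₁), ∀ x, IsTestField x → fieldSupport x ⊆ N → IsDominatedBy g x e) :
    ∀ x, IsTestField x → (fun k ↦ L k x) =O[atTop] fun _ ↦ (1 : ℝ) := by
  have hoff : (γ '' J)ᶜ ⊆ boundedSet L fun _ ↦ 1 := fun p hp ↦
    ⟨_, h.isClosed.isOpen_compl.mem_nhds hp, fun x hx hxs ↦
      (hL.isBigO x hx (subset_compl_iff_disjoint_right.1 hxs)).trans (.of_bound 1 (.of_forall fun k ↦ by
        rw [Real.norm_of_nonneg (by positivity), norm_one, mul_one]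
        exact inv_le_one_of_one_le₀ (by linarith [k.cast_nonneg (α := ℝ)])))⟩
  obtain ⟨N, hN, hdom⟩ := hdom
  have h1 := h.boundedSet_eq_univ hcausal hL.stress hoff hs₁
    (mem_boundedSet_of_dominated hL.stress hL.isTestField hen
      (by simp only [hL.eq_one]; exact isBigO_refl _ _) hN hdom)
  exact fun x hx ↦ isBigO_of_subset_boundedSet hL.stress hx (by rw [h1]; exact subset_univ _)

/-- The curve has no end points: from an end point a bound by `1 / (k + 1)` would propagate, in
contradiction to the normalization. -/
theorem IsConcentrating.isOpen {g : LorentzMetric n M} {L : ℕ → CovariantField n M → ℝ}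
    {e : CovariantField n M} (hL : IsConcentrating g L (γ '' J) e) (h : IsEmbeddedCurve n γ J)
    (hcausal : IsCausalCurve g γ J) : IsOpen J := by
  have hoff : (γ '' J)ᶜ ⊆ boundedSet L fun k : ℕ ↦ ((k : ℝ) + 1)⁻¹ := fun p hp ↦
    ⟨_, h.isClosed.isOpen_compl.mem_nhds hp, fun x hx hxs ↦
      hL.isBigO x hx (subset_compl_iff_disjoint_right.1 hxs)⟩
  have hnot : ∀ s ∈ J, γ s ∉ boundedSet L fun k : ℕ ↦ ((k : ℝ) + 1)⁻¹ := by
    intro s hs hb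
    have h1 := h.boundedSet_eq_univ hcausal hL.stress hoff hs hb
    have h2 := isBigO_of_subset_boundedSet (b := fun k : ℕ ↦ ((k : ℝ) + 1)⁻¹) hL.stress
      hL.isTestField (by rw [h1]; exact subset_univ _)
    simp only [hL.eq_one] at h2
    have h3 := h2.trans_tendsto
      (by simpa [one_div] using tendsto_one_div_add_atTop_nhds_zero_nat (𝕜 := ℝ))
    exact one_ne_zero (tendsto_nhds_unique tendsto_const_nhds h3)
  rw [isOpen_iff_mem_nhds]
  intro s hs
  have h1 : ¬ ∀ r ∈ J, s ≤ r := fun H ↦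
    hnot s hs (h.mem_boundedSet_forward hcausal hL.stress hoff hs (.inl H))
  have h2 : ¬ ∀ r ∈ J, r ≤ s := fun H ↦
    hnot s hs (h.mem_boundedSet_backward hcausal hL.stress hoff hs (.inl H))
  push Not at h1 h2
  obtain ⟨a, ha, has⟩ := h1
  obtain ⟨b, hb, hbs⟩ := h2
  exact mem_of_superset (Icc_mem_nhds has hbs) (h.ordConnected.out ha hb)

end Propagation

/-! ### Test functions -/

section TestFunctions

variable {E F F' : Type*} [NormedAddCommGroup E] [NormedSpace ℝ E] [NormedAddCommGroup F]
  [NormedSpace ℝ F] [NormedAddCommGroup F'] [NormedSpace ℝ F']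

/-- Smooth functions with compact support in `W`. -/
structure IsTestOn (W : Set E) (f : E → F) : Prop where
  contDiff : ContDiff ℝ ∞ f
  hasCompactSupport : HasCompactSupport f
  tsupport_subset : tsupport f ⊆ W

namespace IsTestOn

variable {W : Set E} {f g : E → F}

lemma eq_zero (hf : IsTestOn W f) {z : E} (hz : z ∉ W) : f z = 0 :=
  image_eq_zero_of_notMem_tsupport fun h ↦ hz (hf.tsupport_subset h)

lemma of_closed {K : Set E} (hW : IsOpen W) (hK : IsCompact K) (hKc : IsClosed K) (hKW : K ⊆ W)
    (hf : ContDiffOn ℝ ∞ f W) (h0 : ∀ z ∉ K, f z = 0) : IsTestOn W f := by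
  have hs : tsupport f ⊆ K := closure_minimal (fun z hz ↦ by_contra fun h ↦ hz (h0 z h)) hKc
  exact ⟨contDiff_of_tsupport_subset hW hf (hs.trans hKW),
    hK.of_isClosed_subset (isClosed_tsupport _) hs, hs.trans hKW⟩

/-- A function that is smooth on `W` and vanishes where a test function does is a test function. -/
lemma of_eq_zero (hW : IsOpen W) (hf : IsTestOn W f) {Φ : E → F'} (hΦ : ContDiffOn ℝ ∞ Φ W)
    (h0 : ∀ z, f z = 0 → Φ z = 0) : IsTestOn W Φ :=
  of_closed hW hf.hasCompactSupport (isClosed_tsupport f) hf.tsupport_subset hΦ fun z hz ↦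
    h0 z (image_eq_zero_of_notMem_tsupport hz)

lemma add (hf : IsTestOn W f) (hg : IsTestOn W g) : IsTestOn W (f + g) :=
  ⟨hf.contDiff.add hg.contDiff, hf.hasCompactSupport.add hg.hasCompactSupport,
    (tsupport_add f g).trans (union_subset hf.tsupport_subset hg.tsupport_subset)⟩

lemma const_smul (hW : IsOpen W) (hf : IsTestOn W f) (a : ℝ) : IsTestOn W (a • f) :=
  hf.of_eq_zero hW (contDiff_const.smul hf.contDiff).contDiffOn fun z hz ↦ by simp [hz]

lemma sub (hW : IsOpen W) (hf : IsTestOn W f) (hg : IsTestOn W g) : IsTestOn W (f - g) := by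
  have := hf.add (hg.const_smul hW (-1))
  rwa [neg_one_smul, ← sub_eq_add_neg] at this

end IsTestOn

lemma IsTestOn.deriv {I : Set ℝ} {h : ℝ → ℝ} (hh : IsTestOn I h) : IsTestOn I (deriv h) :=
  ⟨(contDiff_infty_iff_deriv.1 hh.contDiff).2, hh.hasCompactSupport.deriv,
    tsupport_deriv_subset.trans hh.tsupport_subset⟩

end TestFunctions

/-! ### Distributions on an interval -/

section Calculus

/-- The inverse function theorem for a smooth function on an interval. -/
lemma exists_smooth_leftInverse {f : ℝ → ℝ} {s a : ℝ} (ha : 0 < a)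
    (hf : ContDiffOn ℝ ∞ f (Ioo (s - a) (s + a))) (hs : deriv f s ≠ 0) :
    ∃ ε > 0, ε ≤ a ∧ (∀ r ∈ Ioo (s - ε) (s + ε), deriv f r ≠ 0) ∧
      ∃ (σ : ℝ → ℝ) (O : Set ℝ), IsOpen O ∧ ContDiffOn ℝ ∞ σ O ∧
        (∀ z ∈ O, σ z ∈ Ioo (s - ε) (s + ε)) ∧
        ∀ r ∈ Ioo (s - ε) (s + ε), f r ∈ O ∧ σ (f r) = r := by
  have hsa : s ∈ Ioo (s - a) (s + a) := by constructor <;> linarith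
  have hfa : ∀ r ∈ Ioo (s - a) (s + a), ContDiffAt ℝ ∞ f r := fun r hr ↦
    hf.contDiffAt (isOpen_Ioo.mem_nhds hr)
  have hd : ∀ r ∈ Ioo (s - a) (s + a), HasDerivAt f (deriv f r) r := fun r hr ↦
    ((hfa r hr).differentiableAt (by simp)).hasDerivAt
  have hstrict : HasStrictFDerivAt f
      ((ContinuousLinearEquiv.unitsEquivAut ℝ (Units.mk0 _ hs) : ℝ ≃L[ℝ] ℝ) : ℝ →L[ℝ] ℝ) s :=
    ((hfa s hsa).hasStrictDerivAt (by simp)).hasStrictFDerivAt_equiv hs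
  set e := hstrict.toOpenPartialHomeomorph f with he
  have hes : s ∈ e.source := hstrict.mem_toOpenPartialHomeomorph_source
  have hef : ∀ r, e r = f r := fun r ↦ rfl
  have hdc : ContinuousAt (deriv f) s :=
    ((contDiffOn_infty_iff_deriv_of_isOpen isOpen_Ioo).1 hf).2.continuousOn.continuousAt
      (isOpen_Ioo.mem_nhds hsa)
  obtain ⟨ε₀, hε₀, hb⟩ := Metric.mem_nhds_iff.1
    (Filter.inter_mem (e.open_source.mem_nhds hes) (hdc.eventually_ne hs))
  rw [Real.ball_eq_Ioo] at hb
  set ε := min ε₀ a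
  have hsub : Ioo (s - ε) (s + ε) ⊆ e.source ∩ {r | deriv f r ≠ 0} :=
    (Ioo_subset_Ioo (by linarith [min_le_left ε₀ a]) (by linarith [min_le_left ε₀ a])).trans hb
  have hsub' : Ioo (s - ε) (s + ε) ⊆ Ioo (s - a) (s + a) :=
    Ioo_subset_Ioo (by linarith [min_le_right ε₀ a]) (by linarith [min_le_right ε₀ a])
  refine ⟨ε, lt_min hε₀ ha, min_le_right _ _, fun r hr ↦ (hsub hr).2, e.symm,
    e.target ∩ e.symm ⁻¹' Ioo (s - ε) (s + ε), e.isOpen_inter_preimage_symm isOpen_Ioo, ?_,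
    fun z hz ↦ hz.2, fun r hr ↦ ?_⟩
  · intro z hz
    exact (e.contDiffAt_symm_deriv (hsub hz.2).2 hz.1 (hd _ (hsub' hz.2))
      (hfa _ (hsub' hz.2))).contDiffWithinAt
  · have h1 := (hsub hr).1
    have h2 : e.symm (f r) = r := e.left_inv h1
    exact ⟨⟨e.map_source h1, by rw [mem_preimage, h2]; exact hr⟩, h2⟩

/-- A linear functional on the test functions on an interval that annihilates the derivatives is a
multiple of the integral. -/
lemma exists_eq_mul_integral {a b : ℝ} (hab : a < b) {μ : (ℝ → ℝ) → ℝ}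
    (hadd : ∀ f h, IsTestOn (Ioo a b) f → IsTestOn (Ioo a b) h → μ (f + h) = μ f + μ h)
    (hsmul : ∀ (t : ℝ) f, IsTestOn (Ioo a b) f → μ (t • f) = t * μ f)
    (hderiv : ∀ f, IsTestOn (Ioo a b) f → μ (deriv f) = 0) :
    ∃ C : ℝ, ∀ f, IsTestOn (Ioo a b) f → μ f = C * ∫ s, f s := by
  let B : ContDiffBump ((a + b) / 2) := ⟨(b - a) / 8, (b - a) / 4, by linarith, by linarith⟩
  have hB : IsTestOn (Ioo a b) (B.normed volume) := by
    refine ⟨B.contDiff_normed, B.hasCompactSupport_normed, ?_⟩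
    rw [B.tsupport_normed_eq, Real.closedBall_eq_Icc]
    exact Icc_subset_Ioo (by change a < (a + b) / 2 - (b - a) / 4; linarith)
      (by change (a + b) / 2 + (b - a) / 4 < b; linarith)
  refine ⟨μ (B.normed volume), fun f hf ↦ ?_⟩
  set t := ∫ s, f s
  set h : ℝ → ℝ := f - t • B.normed volume with hh
  have hht : IsTestOn (Ioo a b) h := hf.sub isOpen_Ioo (hB.const_smul isOpen_Ioo t)
  have hint : ∫ s, h s = 0 := by
    have h1 : ∫ s, h s = (∫ s, f s) - ∫ s, t * B.normed volume s :=
      integral_sub (hf.contDiff.continuous.integrable_of_hasCompactSupport hf.hasCompactSupport)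
        ((hB.contDiff.continuous.integrable_of_hasCompactSupport hB.hasCompactSupport).const_mul t)
    rw [h1, integral_const_mul, B.integral_normed, mul_one, sub_self]
  have hhI : Integrable h :=
    hht.contDiff.continuous.integrable_of_hasCompactSupport hht.hasCompactSupport
  -- the primitive of `h` is a test function
  set m : ℝ → ℝ := fun x ↦ ∫ s in a..x, h s with hm
  have hmd : ∀ x, HasDerivAt m (h x) x := fun x ↦
    intervalIntegral.integral_hasDerivAt_right (hht.contDiff.continuous.intervalIntegrable _ _)
      (hht.contDiff.continuous.stronglyMeasurableAtFilter _ _) hht.contDiff.continuous.continuousAt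
  have hmderiv : deriv m = h := funext fun x ↦ (hmd x).deriv
  have hms : ContDiff ℝ ∞ m := contDiff_infty_iff_deriv.2
    ⟨fun x ↦ (hmd x).differentiableAt, by rw [hmderiv]; exact hht.contDiff⟩
  obtain ⟨a', b', ha', hb', hab', hsupp⟩ : ∃ a' b', a < a' ∧ b' < b ∧ a' ≤ b' ∧
      tsupport h ⊆ Icc a' b' := by
    rcases (tsupport h).eq_empty_or_nonempty with h0 | h0
    · exact ⟨(a + b) / 2, (a + b) / 2, by linarith, by linarith, le_rfl, by rw [h0]; exact empty_subset _⟩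
    · have hc : IsCompact (tsupport h) := hht.hasCompactSupport
      have h1 := hht.tsupport_subset (hc.sInf_mem h0)
      have h2 := hht.tsupport_subset (hc.sSup_mem h0)
      exact ⟨_, _, h1.1, h2.2, csInf_le_csSup h0 hc.bddBelow hc.bddAbove,
        subset_Icc_csInf_csSup hc.bddBelow hc.bddAbove⟩
  have hz : ∀ x ∉ Icc a' b', h x = 0 := fun x hx ↦
    image_eq_zero_of_notMem_tsupport fun h' ↦ hx (hsupp h')
  have hmt : IsTestOn (Ioo a b) m := by
    refine .of_closed isOpen_Ioo isCompact_Icc isClosed_Icc (Icc_subset_Ioo ha' hb') hms.contDiffOn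
      fun x hx ↦ ?_
    rw [mem_Icc, not_and_or, not_le, not_le] at hx
    rcases hx with hx | hx
    · refine (intervalIntegral.integral_congr fun s hs ↦ ?_).trans intervalIntegral.integral_zero
      refine hz s fun hs' ↦ ?_
      rw [mem_uIcc] at hs
      rcases hs with hs | hs <;> linarith [hs'.1, hs.1, hs.2]
    · have h1 : ∫ s in a..x, h s = ∫ s, h s := by
        refine intervalIntegral.integral_eq_integral_of_support_subset fun s hs ↦ ?_
        by_contra h'
        refine hs (hz s fun hs' ↦ h' ⟨?_, ?_⟩)
        · linarith [hs'.1]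
        · linarith [hs'.2]
      exact h1.trans hint
  have h2 := hderiv m hmt
  rw [hmderiv] at h2
  have h3 : f = h + t • B.normed volume := by rw [hh, sub_add_cancel]
  have h4 := hadd h _ hht (hB.const_smul isOpen_Ioo t)
  rw [← h3, h2, hsmul t _ hB, zero_add] at h4
  rw [h4, mul_comm]

/-- Positive solutions of `q' = κ q`. -/
lemma exists_integratingFactor {a b : ℝ} {κ : ℝ → ℝ} (hκ : ContDiffOn ℝ ∞ κ (Ioo a b)) :
    ∃ q : ℝ → ℝ, ContDiffOn ℝ ∞ q (Ioo a b) ∧ (∀ s, 0 < q s) ∧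
      ∀ s ∈ Ioo a b, HasDerivAt q (κ s * q s) s := by
  rcases le_or_gt b a with hab | hab
  · exact ⟨fun _ ↦ 1, contDiffOn_const, fun _ ↦ one_pos, fun s hs ↦ absurd (hs.1.trans hs.2) (not_lt.2 hab)⟩
  set F : ℝ → ℝ := fun x ↦ ∫ s in ((a + b) / 2)..x, κ s with hF
  have hmid : (a + b) / 2 ∈ Ioo a b := by constructor <;> linarith
  have hFd : ∀ x ∈ Ioo a b, HasDerivAt F (κ x) x := by
    intro x hx
    have hsub : uIcc ((a + b) / 2) x ⊆ Ioo a b := ordConnected_Ioo.uIcc_subset hmid hx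
    exact intervalIntegral.integral_hasDerivAt_right
      ((hκ.continuousOn.mono hsub).intervalIntegrable)
      (hκ.continuousOn.stronglyMeasurableAtFilter isOpen_Ioo x hx)
      (hκ.continuousOn.continuousAt (isOpen_Ioo.mem_nhds hx))
  have hFs : ContDiffOn ℝ ∞ F (Ioo a b) := by
    rw [contDiffOn_infty_iff_deriv_of_isOpen isOpen_Ioo]
    exact ⟨fun x hx ↦ (hFd x hx).differentiableAt.differentiableWithinAt,
      hκ.congr fun x hx ↦ (hFd x hx).deriv⟩
  refine ⟨fun x ↦ Real.exp (F x), Real.contDiff_exp.comp_contDiffOn hFs, fun s ↦ Real.exp_pos _,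
    fun s hs ↦ ?_⟩
  have := (hFd s hs).exp
  rwa [mul_comm] at this

/-- A continuous function that is orthogonal to all test functions vanishes. -/
lemma eq_zero_of_integral_test {a b : ℝ} {f : ℝ → ℝ} (hf : ContinuousOn f (Ioo a b))
    (h : ∀ η, IsTestOn (Ioo a b) η → ∫ s, η s * f s = 0) {s : ℝ} (hs : s ∈ Ioo a b) : f s = 0 := by
  have h1 := isOpen_Ioo.ae_eq_zero_of_integral_contDiff_smul_eq_zero (μ := volume)
    (hf.locallyIntegrableOn measurableSet_Ioo) fun η h1 h2 h3 ↦ h η ⟨h1, h2, h3⟩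
  have h2 : f =ᵐ[volume.restrict (Ioo a b)] fun _ ↦ 0 :=
    (ae_restrict_iff' measurableSet_Ioo).2 h1
  exact Measure.eqOn_open_of_ae_eq h2 isOpen_Ioo hf continuousOn_const hs

/-- A linear functional `ν` on the test functions on an interval that satisfies the differential
equations `(A_k ν)' + B_k ν = 0`, where one of the `A_k` has no zeros, has a smooth density. -/
theorem exists_density {ι : Type*} {a b : ℝ} (hab : a < b) {ν : (ℝ → ℝ) → ℝ}
    (hadd : ∀ f h, IsTestOn (Ioo a b) f → IsTestOn (Ioo a b) h → ν (f + h) = ν f + ν h)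
    (hsmul : ∀ (t : ℝ) f, IsTestOn (Ioo a b) f → ν (t • f) = t * ν f)
    {A B : ι → ℝ → ℝ} (hA : ∀ k, ContDiffOn ℝ ∞ (A k) (Ioo a b))
    (hB : ∀ k, ContDiffOn ℝ ∞ (B k) (Ioo a b)) {k₀ : ι} (hk₀ : ∀ s ∈ Ioo a b, A k₀ s ≠ 0)
    (hode : ∀ k f, IsTestOn (Ioo a b) f → ν (fun s ↦ deriv f s * A k s - f s * B k s) = 0) :
    ∃ ρ : ℝ → ℝ, ContDiffOn ℝ ∞ ρ (Ioo a b) ∧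
      ((∀ s ∈ Ioo a b, ρ s = 0) ∨ ∀ s ∈ Ioo a b, ρ s ≠ 0) ∧
      (∀ f, IsTestOn (Ioo a b) f → ν f = ∫ s in Ioo a b, ρ s * f s) ∧
      ∀ k, ∀ s ∈ Ioo a b, deriv ρ s * A k s + ρ s * (deriv (A k) s + B k s) = 0 := by
  have hoi : IsOpen (Ioo a b) := isOpen_Ioo
  -- the integrating factor turns the equation for `k₀` into `(q A_{k₀} ν)' = 0`
  obtain ⟨q, hq, hq0, hqd⟩ := exists_integratingFactor ((hB k₀).div (hA k₀) hk₀)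
  have hqA : ContDiffOn ℝ ∞ (fun s ↦ q s * A k₀ s) (Ioo a b) := hq.mul (hA k₀)
  have hqA0 : ∀ s ∈ Ioo a b, q s * A k₀ s ≠ 0 := fun s hs ↦ mul_ne_zero (hq0 s).ne' (hk₀ s hs)
  have hmul : ∀ {c f : ℝ → ℝ}, ContDiffOn ℝ ∞ c (Ioo a b) → IsTestOn (Ioo a b) f →
      IsTestOn (Ioo a b) fun s ↦ c s * f s := fun hc hf ↦
    hf.of_eq_zero hoi (hc.mul hf.contDiff.contDiffOn) fun z hz ↦ by rw [hz, mul_zero]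
  obtain ⟨C, hC⟩ := exists_eq_mul_integral hab (μ := fun f ↦ ν fun s ↦ q s * A k₀ s * f s)
    (fun f h hf hh ↦ by
      rw [← hadd _ _ (hmul hqA hf) (hmul hqA hh)]
      congr 1
      ext s
      simp only [Pi.add_apply]
      ring)
    (fun t f hf ↦ by
      rw [← hsmul _ _ (hmul hqA hf)]
      congr 1
      ext s
      simp only [Pi.smul_apply, smul_eq_mul]
      ring)
    (fun f hf ↦ by
      have h1 := hode k₀ _ (hmul hq hf)
      convert h1 using 2
      ext s
      by_cases hs : s ∈ Ioo a b
      · have h2 := ((hqd s hs).mul (hf.contDiff.differentiable (by simp) s).hasDerivAt).deriv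
        have h3 : deriv (fun s ↦ q s * f s) s = B k₀ s / A k₀ s * q s * f s + q s * deriv f s := h2
        rw [h3]
        field_simp [hk₀ s hs]
        ring
      · rw [hf.deriv.eq_zero hs, (hmul hq hf).deriv.eq_zero hs, hf.eq_zero hs]
        ring)
  set ρ : ℝ → ℝ := fun s ↦ C / (q s * A k₀ s) with hρ
  have hρs : ContDiffOn ℝ ∞ ρ (Ioo a b) := contDiffOn_const.div hqA hqA0
  have hint : ∀ f, IsTestOn (Ioo a b) f → ν f = ∫ s in Ioo a b, ρ s * f s := by
    intro f hf
    have h1 := hC _ (hmul (hqA.inv hqA0) hf)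
    have h2 : (fun s ↦ q s * A k₀ s * ((q s * A k₀ s)⁻¹ * f s)) = f := by
      ext s
      by_cases hs : s ∈ Ioo a b
      · rw [← mul_assoc, mul_inv_cancel₀ (hqA0 s hs), one_mul]
      · rw [hf.eq_zero hs]
        ring
    simp only [Pi.inv_apply] at h1
    rw [h2] at h1
    rw [h1, ← integral_const_mul, setIntegral_eq_integral_of_forall_compl_eq_zero fun s hs ↦ by
      rw [hf.eq_zero hs, mul_zero]]
    refine integral_congr_ae (.of_forall fun s ↦ ?_)
    simp only [hρ, div_eq_mul_inv]
    ring
  refine ⟨ρ, hρs, ?_, hint, fun k s hs ↦ ?_⟩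
  · rcases eq_or_ne C 0 with h | h
    · exact .inl fun s _ ↦ by rw [hρ, h]; exact zero_div _
    · exact .inr fun s hs ↦ div_ne_zero h (hqA0 s hs)
  · have hρd : ∀ s ∈ Ioo a b, HasDerivAt ρ (deriv ρ s) s := fun s hs ↦
      ((hρs.contDiffAt (hoi.mem_nhds hs)).differentiableAt (by simp)).hasDerivAt
    have hAd : ∀ s ∈ Ioo a b, HasDerivAt (A k) (deriv (A k) s) s := fun s hs ↦
      (((hA k).contDiffAt (hoi.mem_nhds hs)).differentiableAt (by simp)).hasDerivAt
    refine eq_zero_of_integral_test (f := fun s ↦ deriv ρ s * A k s + ρ s * (deriv (A k) s + B k s))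
      ?_ (fun η hη ↦ ?_) hs
    · have h1 := ((contDiffOn_infty_iff_deriv_of_isOpen hoi).1 hρs).2.continuousOn
      have h2 := ((contDiffOn_infty_iff_deriv_of_isOpen hoi).1 (hA k)).2.continuousOn
      exact (h1.mul (hA k).continuousOn).add (hρs.continuousOn.mul (h2.add (hB k).continuousOn))
    · -- integrate by parts
      have ht := hmul (hρs.mul (hA k)) hη
      have h4 : Integrable (deriv fun s ↦ ρ s * A k s * η s) :=
        ht.deriv.contDiff.continuous.integrable_of_hasCompactSupport ht.deriv.hasCompactSupport
      have h1 : ∫ s, deriv (fun s ↦ ρ s * A k s * η s) s = 0 :=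
        integral_eq_zero_of_hasDerivAt_of_integrable
          (fun s ↦ (ht.contDiff.differentiable (by simp) s).hasDerivAt) h4
          (ht.contDiff.continuous.integrable_of_hasCompactSupport ht.hasCompactSupport)
      have hf1 : IsTestOn (Ioo a b) fun s ↦ deriv η s * A k s - η s * B k s := by
        have := (hmul (hA k) hη.deriv).sub hoi (hmul (hB k) hη)
        convert this using 1
        ext s
        simp only [Pi.sub_apply]
        ring
      have h2 := hint _ hf1
      rw [hode k η hη, setIntegral_eq_integral_of_forall_compl_eq_zero fun s hs ↦ by
        rw [hf1.eq_zero hs, mul_zero]] at h2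
      have h3 : Integrable fun s ↦ ρ s * (deriv η s * A k s - η s * B k s) :=
        (hmul hρs hf1).contDiff.continuous.integrable_of_hasCompactSupport
          (hmul hρs hf1).hasCompactSupport
      have h5 := integral_sub h4 h3
      rw [h1, ← h2, sub_zero] at h5
      rw [← h5]
      refine integral_congr_ae (.of_forall fun r ↦ ?_)
      beta_reduce
      by_cases hr : r ∈ Ioo a b
      · have h6 : deriv (fun s ↦ ρ s * A k s * η s) r =
            (deriv ρ r * A k r + ρ r * deriv (A k) r) * η r + ρ r * A k r * deriv η r :=
          (((hρd r hr).mul (hAd r hr)).mul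
            (hη.contDiff.differentiable (by simp) r).hasDerivAt).deriv
        rw [h6]
        ring
      · rw [ht.deriv.eq_zero hr, hη.eq_zero hr, hη.deriv.eq_zero hr]
        ring

end Calculus

/-! ### Functionals supported on a curve -/

section CurveFunctional

variable {n : ℕ} {M : Type*} [TopologicalSpace M] [ChartedSpace (EuclideanSpace ℝ (Fin n)) M]
  [IsManifold (𝓡 n) ∞ M]

/-- Functionals with the properties of a limit of concentrating sequences: they are, in addition,
supported in `Γ`. -/
structure IsCurveFunctional (g : LorentzMetric n M) (Λ : CovariantField n M → ℝ) (Γ : Set M) : Prop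
    extends IsStressFunctional g Λ where
  zero_off : ∀ x, IsTestField x → Disjoint (fieldSupport x) Γ → Λ x = 0

omit [IsManifold (𝓡 n) ∞ M] in
lemma chartField_sub (c : M) (X Y : Vec n → Form n) :
    chartField c (X - Y) = chartField c X - chartField c Y := by
  refine field_ext fun p ↦ ?_
  change _ = formAt (chartField c X) p - formAt (chartField c Y) p
  by_cases hp : p ∈ (extChartAt (𝓡 n) c).source
  · rw [chartField_apply hp, chartField_apply hp, chartField_apply hp]
    rfl
  · rw [chartField_apply_of_notMem hp, chartField_apply_of_notMem hp, chartField_apply_of_notMem hp,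
      sub_zero]

omit [IsManifold (𝓡 n) ∞ M] in
lemma chartField_add (c : M) (X Y : Vec n → Form n) :
    chartField c (X + Y) = chartField c X + chartField c Y := by
  refine field_ext fun p ↦ ?_
  rw [formAt_add]
  by_cases hp : p ∈ (extChartAt (𝓡 n) c).source
  · rw [chartField_apply hp, chartField_apply hp, chartField_apply hp]
    rfl
  · rw [chartField_apply_of_notMem hp, chartField_apply_of_notMem hp, chartField_apply_of_notMem hp,
      add_zero]

omit [IsManifold (𝓡 n) ∞ M] in
lemma chartField_smul (c : M) (a : ℝ) (X : Vec n → Form n) :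
    chartField c (a • X) = a • chartField c X := by
  refine field_ext fun p ↦ ?_
  rw [formAt_smul]
  by_cases hp : p ∈ (extChartAt (𝓡 n) c).source
  · rw [chartField_apply hp, chartField_apply hp]
    rfl
  · rw [chartField_apply_of_notMem hp, chartField_apply_of_notMem hp, smul_zero]

omit [IsManifold (𝓡 n) ∞ M] in
lemma notMem_fieldSupport {x : CovariantField n M} {p : M} (h : ∀ᶠ q in 𝓝 p, formAt x q = 0) :
    p ∉ fieldSupport x := fun hp ↦
  (mem_closure_iff_frequently.1 hp) (h.mono fun _ hq hq' ↦ hq' hq)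

variable [T2Space M] [SecondCountableTopology M]

/-- A positive functional that is supported in `Γ` vanishes on the fields that are zero on `Γ`:
near `Γ` these are small compared with an energy density. -/
lemma IsCurveFunctional.exists_nhds_eq_zero {g : LorentzMetric n M} {Λ : CovariantField n M → ℝ}
    {Γ : Set M} (hΛ : IsCurveFunctional g Λ Γ) (hΓ : IsClosed Γ) {c p₀ : M}
    (hp₀ : p₀ ∈ (extChartAt (𝓡 n) c).source) :
    ∃ N ∈ 𝓝 p₀, ∀ (W : Set (Vec n)) (X : Vec n → Form n),
      W ⊆ (extChartAt (𝓡 n) c).target ∩ (extChartAt (𝓡 n) c).symm ⁻¹' N → IsTestOn W X →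
      (∀ z ∈ W, (extChartAt (𝓡 n) c).symm z ∈ Γ → X z = 0) → Λ (chartField c X) = 0 := by
  obtain ⟨e, he, -, hen, -, -, ⟨N₀, hN₀, -, K, hK, hdom₀⟩, -⟩ :=
    exists_energyBump g hp₀ isOpen_univ (mem_univ _)
  obtain ⟨N, hNs, hNo, hpN⟩ : ∃ N ⊆ N₀ ∩ (extChartAt (𝓡 n) c).source, IsOpen N ∧ p₀ ∈ N :=
    mem_nhds_iff.1 (Filter.inter_mem hN₀ ((isOpen_extChartAt_source c).mem_nhds hp₀))
  refine ⟨N, hNo.mem_nhds hpN, fun W X hW hX hX0 ↦ ?_⟩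
  set x := chartField c X with hx
  have hXt : tsupport X ⊆ (extChartAt (𝓡 n) c).target := fun z hz ↦ (hW (hX.tsupport_subset hz)).1
  have hxt : IsTestField x := isTestField_chartField c hX.contDiff hX.hasCompactSupport hXt
  have hsupp : ∀ p ∈ fieldSupport x, p ∈ N ∧ extChartAt (𝓡 n) c p ∈ W ∧
      (extChartAt (𝓡 n) c).symm (extChartAt (𝓡 n) c p) = p := by
    intro p hp
    obtain ⟨z, hz, rfl⟩ := fieldSupport_chartField_subset c hX.hasCompactSupport hXt hp
    have hzW := hW (hX.tsupport_subset hz)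
    rw [(extChartAt (𝓡 n) c).right_inv hzW.1]
    exact ⟨hzW.2, hX.tsupport_subset hz, rfl⟩
  have key : ∀ δ > 0, |Λ x| ≤ δ * (K * Λ e) := by
    intro δ hδ
    have hOo : IsOpen (N ∩ (fun p ↦ ‖X (extChartAt (𝓡 n) c p)‖) ⁻¹' Iio δ) := by
      refine ContinuousOn.isOpen_inter_preimage ?_ hNo isOpen_Iio
      exact (hX.contDiff.continuous.comp_continuousOn
        ((continuousOn_extChartAt c).mono fun p hp ↦ (hNs hp).2)).norm
    have hsub : Γ ∩ fieldSupport x ⊆ N ∩ (fun p ↦ ‖X (extChartAt (𝓡 n) c p)‖) ⁻¹' Iio δ := by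
      rintro p ⟨hpΓ, hp⟩
      obtain ⟨h1, h2, h3⟩ := hsupp p hp
      refine ⟨h1, ?_⟩
      rw [mem_preimage, hX0 _ h2 (by rw [h3]; exact hpΓ), norm_zero]
      exact hδ
    -- cut off to a neighborhood of `Γ` on which `‖X‖ < δ`; this does not change the value
    obtain ⟨β, hβ, hβ01, hβ1, hβs⟩ :=
      exists_smooth_cutoff n (hΓ.inter (isClosed_fieldSupport x)) hOo hsub
    have hβx := hxt.smulField hβ
    have h1 : Λ x = Λ (smulField β x) := by
      rw [← sub_eq_zero, ← hΛ.map_sub hxt hβx]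
      refine hΛ.zero_off _ (hxt.sub hβx) (disjoint_right.2 fun p hp ↦ notMem_fieldSupport ?_)
      have hd : ∀ q, formAt (x - smulField β x) q = formAt x q - β q • formAt x q := fun q ↦ rfl
      by_cases hpx : p ∈ fieldSupport x
      · filter_upwards [hβ1 p ⟨hp, hpx⟩] with q hq
        rw [hd, hq, one_smul, sub_self]
      · filter_upwards [(isClosed_fieldSupport x).isOpen_compl.mem_nhds hpx] with q hq
        rw [hd, formAt_eq_zero hq, smul_zero, sub_zero]
    rw [h1, ← mul_assoc]
    refine hΛ.abs_le_of_dominated hβx he fun p T hT ↦ ?_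
    rw [formAt_smulField, contract_smul]
    have hTe := hen p T hT
    by_cases hp : p ∈ tsupport β
    · obtain ⟨hpN, hpδ⟩ := hβs hp
      have h2 := hdom₀ p (hNs hpN).1 T hT (X (extChartAt (𝓡 n) c p))
      rw [← chartField_apply (hNs hpN).2] at h2
      have hpδ' : ‖X (extChartAt (𝓡 n) c p)‖ ≤ δ := le_of_lt hpδ
      rw [abs_mul, abs_of_nonneg (hβ01 p).1]
      calc _ ≤ 1 * (K * ‖X (extChartAt (𝓡 n) c p)‖ * contract T (formAt e p)) :=
            mul_le_mul (hβ01 p).2 h2 (abs_nonneg _) zero_le_one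
        _ ≤ 1 * (K * δ * contract T (formAt e p)) := by gcongr
        _ = _ := by ring
    · rw [image_eq_zero_of_notMem_tsupport hp, zero_mul, abs_zero]
      positivity
  have h0 : Tendsto (fun δ : ℝ ↦ δ * (K * Λ e)) (𝓝[>] 0) (𝓝 0) := by
    have : Tendsto (fun δ : ℝ ↦ δ * (K * Λ e)) (𝓝 0) (𝓝 (0 * (K * Λ e))) :=
      tendsto_id.mul_const _
    rw [zero_mul] at this
    exact this.mono_left nhdsWithin_le_nhds
  refine abs_eq_zero.1 (le_antisymm (ge_of_tendsto h0 ?_) (abs_nonneg _))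
  filter_upwards [self_mem_nhdsWithin] with δ hδ using key δ hδ

end CurveFunctional

/-! ### Straightening the curve -/

section Straightening

variable {n : ℕ} {M : Type*} [TopologicalSpace M] [ChartedSpace (EuclideanSpace ℝ (Fin n)) M]
  [IsManifold (𝓡 n) ∞ M] {γ : ℝ → M} {J : Set ℝ}

/-- A function `S` on an open set `W` of coordinates that extends the parameter of the piece of the
curve in `W`. -/
structure IsStraightened (γ : ℝ → M) (J : Set ℝ) (c : M) (I : Set ℝ) (W : Set (Vec n))
    (S : Vec n → ℝ) : Prop where
  isOpen_I : IsOpen I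
  I_subset : I ⊆ J
  mem_source : ∀ s ∈ I, γ s ∈ (extChartAt (𝓡 n) c).source
  isOpen_W : IsOpen W
  W_subset : W ⊆ (extChartAt (𝓡 n) c).target
  contDiffOn : ContDiffOn ℝ ∞ S W
  mem_I : ∀ z ∈ W, S z ∈ I
  left_inv : ∀ s ∈ I, coordCurve γ c s ∈ W → S (coordCurve γ c s) = s
  coordCurve_apply : ∀ z ∈ W, (extChartAt (𝓡 n) c).symm z ∈ γ '' J → coordCurve γ c (S z) = z

/-- A coordinate with non-zero derivative along the curve determines the parameter. -/
lemma IsEmbeddedCurve.exists_isStraightened (h : IsEmbeddedCurve n γ J) (hJ : IsOpen J) {s₀ : ℝ}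
    (hs₀ : s₀ ∈ J) (hvel : (vel γ J s₀ : Vec n) ≠ 0) {c : M}
    (hc : γ s₀ ∈ (extChartAt (𝓡 n) c).source) {N : Set M} (hN : N ∈ 𝓝 (γ s₀)) :
    ∃ ε > 0, ∃ (W : Set (Vec n)) (S : Vec n → ℝ) (k₀ : Fin n),
      IsStraightened γ J c (Ioo (s₀ - ε) (s₀ + ε)) W S ∧ coordCurve γ c s₀ ∈ W ∧
      W ⊆ (extChartAt (𝓡 n) c).symm ⁻¹' N ∧
      ∀ s ∈ Ioo (s₀ - ε) (s₀ + ε), deriv (coordCurve (n := n) γ c) s k₀ ≠ 0 := by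
  set y := coordCurve (n := n) γ c with hy
  obtain ⟨a₁, ha₁, hsrc₁⟩ := h.exists_subset_source hs₀ ((isOpen_extChartAt_source c).mem_nhds hc)
  obtain ⟨a₂, ha₂, hJ₂⟩ := Metric.isOpen_iff.1 hJ s₀ hs₀
  rw [Real.ball_eq_Ioo] at hJ₂
  obtain ⟨a, ha, hJa, hsrc⟩ : ∃ a > 0, Ioo (s₀ - a) (s₀ + a) ⊆ J ∧
      ∀ s ∈ Ioo (s₀ - a) (s₀ + a), γ s ∈ (extChartAt (𝓡 n) c).source := by
    have h1 : Ioo (s₀ - min a₁ a₂) (s₀ + min a₁ a₂) ⊆ Ioo (s₀ - a₁) (s₀ + a₁) :=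
      Ioo_subset_Ioo (by linarith [min_le_left a₁ a₂]) (by linarith [min_le_left a₁ a₂])
    have h2 : Ioo (s₀ - min a₁ a₂) (s₀ + min a₁ a₂) ⊆ Ioo (s₀ - a₂) (s₀ + a₂) :=
      Ioo_subset_Ioo (by linarith [min_le_right a₁ a₂]) (by linarith [min_le_right a₁ a₂])
    exact ⟨min a₁ a₂, lt_min ha₁ ha₂, h2.trans hJ₂, fun s hs ↦ hsrc₁ s ⟨hJ₂ (h2 hs), h1 hs⟩⟩
  have hyd : ContDiffOn ℝ ∞ y (Ioo (s₀ - a) (s₀ + a)) :=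
    (h.contDiffOn_coordCurve c).mono fun s hs ↦ ⟨hJa hs, hsrc s hs⟩
  have hyD : ∀ s ∈ Ioo (s₀ - a) (s₀ + a), HasDerivAt y (deriv y s) s := fun s hs ↦
    ((hyd.contDiffAt (isOpen_Ioo.mem_nhds hs)).differentiableAt (by simp)).hasDerivAt
  have hs₀a : s₀ ∈ Ioo (s₀ - a) (s₀ + a) := by constructor <;> linarith
  have hw : deriv y s₀ = chartD c (γ s₀) (vel γ J s₀) := by
    have := (h.hasDerivWithinAt_coordCurve hs₀ hc).hasDerivAt (hJ.mem_nhds hs₀)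
    exact this.deriv
  have hw0 : deriv y s₀ ≠ 0 := by
    intro h0
    rw [hw] at h0
    refine hvel ?_
    rw [← chartDSymm_chartD hc (vel γ J s₀), h0, map_zero]
  obtain ⟨k₀, hk₀⟩ : ∃ k, deriv y s₀ k ≠ 0 := by
    by_contra! h0
    exact hw0 (PiLp.ext h0)
  have hproj : ∀ s ∈ Ioo (s₀ - a) (s₀ + a), HasDerivAt (fun s ↦ y s k₀) (deriv y s k₀) s :=
    fun s hs ↦ (EuclideanSpace.proj k₀ : Vec n →L[ℝ] ℝ).hasFDerivAt.comp_hasDerivAt s (hyD s hs)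
  have hfd : ContDiffOn ℝ ∞ (fun s ↦ y s k₀) (Ioo (s₀ - a) (s₀ + a)) :=
    (EuclideanSpace.proj k₀ : Vec n →L[ℝ] ℝ).contDiff.comp_contDiffOn hyd
  obtain ⟨ε, hε, hεa, hne, σ, O, hO, hσ, hσI, hσl⟩ := exists_smooth_leftInverse ha hfd
    (by rw [(hproj s₀ hs₀a).deriv]; exact hk₀)
  have hsub : Ioo (s₀ - ε) (s₀ + ε) ⊆ Ioo (s₀ - a) (s₀ + a) :=
    Ioo_subset_Ioo (by linarith) (by linarith)
  obtain ⟨N₁, hN₁, hN₁γ⟩ := h.local_piece s₀ hs₀ ε hε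
  obtain ⟨N₂, hN₂s, hN₂o, hpN₂⟩ := mem_nhds_iff.1 (Filter.inter_mem hN hN₁)
  have hs₀ε : s₀ ∈ Ioo (s₀ - ε) (s₀ + ε) := by constructor <;> linarith
  have hleft : (extChartAt (𝓡 n) c).symm (y s₀) = γ s₀ := (extChartAt (𝓡 n) c).left_inv hc
  refine ⟨ε, hε, ((extChartAt (𝓡 n) c).target ∩ (extChartAt (𝓡 n) c).symm ⁻¹' N₂) ∩
    {z : Vec n | z k₀ ∈ O}, fun z ↦ σ (z k₀), k₀, ⟨isOpen_Ioo, hsub.trans hJa,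
      fun s hs ↦ hsrc s (hsub hs), ?_, ?_, ?_, ?_, ?_, ?_⟩, ?_, ?_, ?_⟩
  · refine IsOpen.inter ?_ (hO.preimage (EuclideanSpace.proj k₀ : Vec n →L[ℝ] ℝ).continuous)
    exact (continuousOn_extChartAt_symm c).isOpen_inter_preimage (isOpen_extChartAt_target c) hN₂o
  · exact fun z hz ↦ hz.1.1
  · exact hσ.comp (EuclideanSpace.proj k₀ : Vec n →L[ℝ] ℝ).contDiff.contDiffOn fun z hz ↦ hz.2
  · exact fun z hz ↦ hσI _ hz.2
  · exact fun s hs _ ↦ (hσl s hs).2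
  · rintro z ⟨⟨hzt, hzN⟩, -⟩ hzγ
    obtain ⟨s, hs, hsz⟩ := hN₁γ ⟨(hN₂s hzN).2, hzγ⟩
    have h1 : y s = z := by
      rw [hy, coordCurve, hsz, (extChartAt (𝓡 n) c).right_inv hzt]
    rw [← h1, (hσl s hs.2).2]
  · refine ⟨⟨(extChartAt (𝓡 n) c).map_source hc, ?_⟩, (hσl s₀ hs₀ε).1⟩
    rw [mem_preimage, hleft]
    exact hpN₂
  · exact fun z hz ↦ (hN₂s hz.1.2).1
  · intro s hs
    rw [← (hproj s (hsub hs)).deriv]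
    exact hne s hs

end Straightening

/-! ### Reduction to the component along the velocity -/

section Reduction

variable {n : ℕ} {M : Type*} [TopologicalSpace M] [ChartedSpace (EuclideanSpace ℝ (Fin n)) M]
  [IsManifold (𝓡 n) ∞ M] {γ : ℝ → M} {J : Set ℝ} {c : M} {I : Set ℝ} {W : Set (Vec n)}
  {S : Vec n → ℝ}

lemma isTestOn_covDeriv (g : LorentzMetric n M) (hW : W ⊆ (extChartAt (𝓡 n) c).target)
    {v : Vec n → Covec n} (hv : IsTestOn W v) : IsTestOn W (covDeriv g c v) :=
  ⟨contDiff_covDeriv g c hv.contDiff (hv.tsupport_subset.trans hW),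
    hasCompactSupport_covDeriv g c hv.hasCompactSupport,
    (tsupport_covDeriv_subset g c v).trans hv.tsupport_subset⟩

namespace IsStraightened

variable (hS : IsStraightened γ J c I W S)
include hS

lemma contDiffOn_coordCurve (h : IsEmbeddedCurve n γ J) :
    ContDiffOn ℝ ∞ (coordCurve (n := n) γ c) I :=
  (h.contDiffOn_coordCurve c).mono fun s hs ↦ ⟨hS.I_subset hs, hS.mem_source s hs⟩

lemma contDiffOn_deriv (h : IsEmbeddedCurve n γ J) :
    ContDiffOn ℝ ∞ (deriv (coordCurve (n := n) γ c)) I :=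
  ((contDiffOn_infty_iff_deriv_of_isOpen hS.isOpen_I).1 (hS.contDiffOn_coordCurve h)).2

lemma hasDerivAt_coordCurve (h : IsEmbeddedCurve n γ J) {s : ℝ} (hs : s ∈ I) :
    HasDerivAt (coordCurve (n := n) γ c) (deriv (coordCurve (n := n) γ c) s) s :=
  (((hS.contDiffOn_coordCurve h).contDiffAt (hS.isOpen_I.mem_nhds hs)).differentiableAt
    (by simp)).hasDerivAt

lemma deriv_coordCurve (h : IsEmbeddedCurve n γ J) {s : ℝ} (hs : s ∈ I) :
    deriv (coordCurve (n := n) γ c) s = chartD c (γ s) (vel γ J s) :=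
  ((h.hasDerivWithinAt_coordCurve (hS.I_subset hs) (hS.mem_source s hs)).hasDerivAt
    (mem_of_superset (hS.isOpen_I.mem_nhds hs) hS.I_subset)).deriv

omit [IsManifold (𝓡 n) ∞ M] in
lemma hasFDerivAt {z : Vec n} (hz : z ∈ W) : HasFDerivAt S (fderiv ℝ S z) z :=
  ((hS.contDiffOn.contDiffAt (hS.isOpen_W.mem_nhds hz)).differentiableAt (by simp)).hasFDerivAt

omit [IsManifold (𝓡 n) ∞ M] in
lemma contDiffOn_fderiv : ContDiffOn ℝ ∞ (fderiv ℝ S) W :=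
  ((contDiffOn_infty_iff_fderiv_of_isOpen hS.isOpen_W).1 hS.contDiffOn).2

lemma fderiv_deriv (h : IsEmbeddedCurve n γ J) {z : Vec n} (hz : z ∈ W)
    (hzγ : (extChartAt (𝓡 n) c).symm z ∈ γ '' J) :
    fderiv ℝ S z (deriv (coordCurve (n := n) γ c) (S z)) = 1 := by
  have hy := hS.coordCurve_apply z hz hzγ
  have hd := hS.hasDerivAt_coordCurve h (hS.mem_I z hz)
  have hF : HasFDerivAt S (fderiv ℝ S z) (coordCurve γ c (S z)) := by
    rw [hy]
    exact hS.hasFDerivAt hz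
  have h1 := hF.comp_hasDerivAt _ hd
  have hW : ∀ᶠ s in 𝓝 (S z), coordCurve γ c s ∈ W := by
    refine hd.continuousAt (hS.isOpen_W.mem_nhds ?_)
    rwa [hy]
  have h2 : (S ∘ coordCurve (n := n) γ c) =ᶠ[𝓝 (S z)] id := by
    filter_upwards [hW, hS.isOpen_I.mem_nhds (hS.mem_I z hz)] with s h1 h2
    exact hS.left_inv s h2 h1
  exact h1.unique ((hasDerivAt_id _).congr_of_eventuallyEq h2)

/-- Two chart fields that agree on the curve have the same value. -/
lemma eq_of_eqOn [T2Space M] {g : LorentzMetric n M} {Λ : CovariantField n M → ℝ} (hΛ : IsStressFunctional g Λ)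
    (hvan : ∀ X, IsTestOn W X → (∀ z ∈ W, (extChartAt (𝓡 n) c).symm z ∈ γ '' J → X z = 0) →
      Λ (chartField c X) = 0) {X Y : Vec n → Form n} (hX : IsTestOn W X) (hY : IsTestOn W Y)
    (hXY : ∀ z ∈ W, (extChartAt (𝓡 n) c).symm z ∈ γ '' J → X z = Y z) :
    Λ (chartField c X) = Λ (chartField c Y) := by
  have h1 : ∀ {X : Vec n → Form n}, IsTestOn W X → IsTestField (chartField c X) := fun hX ↦
    isTestField_chartField c hX.contDiff hX.hasCompactSupport (hX.tsupport_subset.trans hS.W_subset)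
  have h2 := hvan (X - Y) (hX.sub hS.isOpen_W hY) fun z hz hzγ ↦ sub_eq_zero.2 (hXY z hz hzγ)
  rwa [chartField_sub, hΛ.map_sub (h1 hX) (h1 hY), sub_eq_zero] at h2

/-- The field `v = X(z - y(S(z)), ·)` vanishes on the curve, and its derivative is `X`, up to a
term that only involves the value of `X` on the velocity. -/
lemma eq_first_slot [T2Space M] (h : IsEmbeddedCurve n γ J) {g : LorentzMetric n M} {Λ : CovariantField n M → ℝ}
    (hΛ : IsStressFunctional g Λ)
    (hvan : ∀ X, IsTestOn W X → (∀ z ∈ W, (extChartAt (𝓡 n) c).symm z ∈ γ '' J → X z = 0) →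
      Λ (chartField c X) = 0) {X : Vec n → Form n} (hX : IsTestOn W X) :
    IsTestOn W (fun z ↦ (fderiv ℝ S z).smulRight (X z (deriv (coordCurve γ c) (S z)))) ∧
    Λ (chartField c X) =
      Λ (chartField c fun z ↦ (fderiv ℝ S z).smulRight (X z (deriv (coordCurve γ c) (S z)))) := by
  have hyS : ContDiffOn ℝ ∞ (fun z ↦ coordCurve (n := n) γ c (S z)) W :=
    (hS.contDiffOn_coordCurve h).comp hS.contDiffOn hS.mem_I
  have hwS : ContDiffOn ℝ ∞ (fun z ↦ deriv (coordCurve (n := n) γ c) (S z)) W :=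
    (hS.contDiffOn_deriv h).comp hS.contDiffOn hS.mem_I
  have hv : IsTestOn W fun z ↦ X z (z - coordCurve γ c (S z)) :=
    hX.of_eq_zero hS.isOpen_W (hX.contDiff.contDiffOn.clm_apply (contDiffOn_id.sub hyS))
      fun z hz ↦ by rw [hz]; rfl
  have hY : IsTestOn W fun z ↦ (fderiv ℝ S z).smulRight (X z (deriv (coordCurve γ c) (S z))) := by
    refine hX.of_eq_zero hS.isOpen_W ?_ fun z hz ↦ ?_
    · exact hS.contDiffOn_fderiv.smulRight (hX.contDiff.contDiffOn.clm_apply hwS)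
    · rw [hz]
      ext a b
      simp
  refine ⟨hY, ?_⟩
  have h1 := hΛ.map_covDeriv c _ hv.contDiff hv.hasCompactSupport
    (hv.tsupport_subset.trans hS.W_subset)
  have h2 := hS.eq_of_eqOn hΛ hvan (isTestOn_covDeriv g hS.W_subset hv) (hX.sub hS.isOpen_W hY)
    fun z hz hzγ ↦ ?_
  · have h3 : ∀ {X : Vec n → Form n}, IsTestOn W X → IsTestField (chartField c X) := fun hX ↦
      isTestField_chartField c hX.contDiff hX.hasCompactSupport
        (hX.tsupport_subset.trans hS.W_subset)
    rw [h1, chartField_sub, hΛ.map_sub (h3 hX) (h3 hY)] at h2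
    linarith
  · have hy := hS.coordCurve_apply z hz hzγ
    have hd : HasFDerivAt (fun z ↦ z - coordCurve (n := n) γ c (S z))
        (ContinuousLinearMap.id ℝ (Vec n) -
          (fderiv ℝ S z).smulRight (deriv (coordCurve γ c) (S z))) z := by
      refine (hasFDerivAt_id z).sub ?_
      have h5 := (hS.hasDerivAt_coordCurve h (hS.mem_I z hz)).hasFDerivAt.comp z (hS.hasFDerivAt hz)
      refine h5.congr_fderiv ?_
      ext a : 1
      simp
    have hXd : HasFDerivAt X (fderiv ℝ X z) z :=
      (hX.contDiff.differentiable (by simp) z).hasFDerivAt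
    have h4 := (hXd.clm_apply hd).fderiv
    have h0 : z - coordCurve γ c (S z) = 0 := by rw [hy, sub_self]
    rw [covDeriv, h4, h0, map_zero, map_zero, gammaForm_zero, sub_zero, add_zero]
    ext a b
    simp

/-- The value of the functional on a field only depends on the component along the velocity: reduce
one slot of the form, exchange the slots by symmetry, and reduce the other one. -/
lemma eq_tangential [T2Space M] (h : IsEmbeddedCurve n γ J) {g : LorentzMetric n M} {Λ : CovariantField n M → ℝ}
    (hΛ : IsStressFunctional g Λ)
    (hvan : ∀ X, IsTestOn W X → (∀ z ∈ W, (extChartAt (𝓡 n) c).symm z ∈ γ '' J → X z = 0) →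
      Λ (chartField c X) = 0) {X Y : Vec n → Form n} (hX : IsTestOn W X) (hY : IsTestOn W Y)
    (hXY : ∀ s ∈ I, coordCurve γ c s ∈ W →
      X (coordCurve γ c s) (deriv (coordCurve γ c) s) (deriv (coordCurve γ c) s) =
      Y (coordCurve γ c s) (deriv (coordCurve γ c) s) (deriv (coordCurve γ c) s)) :
    Λ (chartField c X) = Λ (chartField c Y) := by
  have hflip : ∀ {X : Vec n → Form n}, IsTestOn W X → IsTestOn W fun z ↦ (X z).flip := fun hX ↦
    hX.of_eq_zero hS.isOpen_W
      ((ContinuousLinearMap.flipₗᵢ ℝ (Vec n) (Vec n) ℝ).toContinuousLinearEquiv.contDiff.comp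
        hX.contDiff).contDiffOn fun z hz ↦ by rw [hz]; rfl
  have hred : ∀ {X : Vec n → Form n}, IsTestOn W X →
      IsTestOn W (fun z ↦ (fderiv ℝ S z).smulRight (((fderiv ℝ S z).smulRight
        (X z (deriv (coordCurve γ c) (S z)))).flip (deriv (coordCurve γ c) (S z)))) ∧
      Λ (chartField c X) = Λ (chartField c fun z ↦ (fderiv ℝ S z).smulRight
        (((fderiv ℝ S z).smulRight (X z (deriv (coordCurve γ c) (S z)))).flip
          (deriv (coordCurve γ c) (S z)))) := by
    intro X hX
    obtain ⟨h1, h2⟩ := hS.eq_first_slot h hΛ hvan hX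
    obtain ⟨h3, h4⟩ := hS.eq_first_slot h hΛ hvan (hflip h1)
    refine ⟨h3, ?_⟩
    rw [h2, ← h4, hΛ.map_flip c _ h1.contDiff h1.hasCompactSupport
      (h1.tsupport_subset.trans hS.W_subset)]
  obtain ⟨hX1, hX2⟩ := hred hX
  obtain ⟨hY1, hY2⟩ := hred hY
  rw [hX2, hY2]
  refine hS.eq_of_eqOn hΛ hvan hX1 hY1 fun z hz hzγ ↦ ?_
  have hy := hS.coordCurve_apply z hz hzγ
  have h1 := hXY (S z) (hS.mem_I z hz) (by rwa [hy])
  rw [hy] at h1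
  ext a b
  simp [h1]

end IsStraightened

end Reduction

/-! ### The density near a point of the curve -/

section LocalDensity

variable {n : ℕ} {M : Type*} [TopologicalSpace M] [ChartedSpace (EuclideanSpace ℝ (Fin n)) M]
  [IsManifold (𝓡 n) ∞ M] {γ : ℝ → M} {J : Set ℝ}

lemma gammaForm_proj (g : LorentzMetric n M) (c : M) (y : Vec n) (k : Fin n) (a : Vec n) :
    gammaForm g c y (EuclideanSpace.proj k) a a = ∑ i, ∑ j, christoffel g c k i j y * a i * a j := by
  rw [gammaForm_apply]
  refine Finset.sum_congr rfl fun i _ ↦ Finset.sum_congr rfl fun j _ ↦ ?_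
  simp [mul_assoc]

namespace IsStraightened

variable {c : M} {I I₁ : Set ℝ} {W : Set (Vec n)} {S : Vec n → ℝ}

/-- The field that corresponds to a function `h` of the parameter: its component along the velocity
is `h`, where `χ` is `1`. -/
def extend (S χ : Vec n → ℝ) (h : ℝ → ℝ) (z : Vec n) : Form n :=
  (h (S z) * χ z) • outer (fderiv ℝ S z) (fderiv ℝ S z)

variable (hS : IsStraightened γ J c I W S) {χ : Vec n → ℝ} (hχ : IsTestOn W χ)
include hS hχ

omit [IsManifold (𝓡 n) ∞ M] in
lemma isTestOn_extend {h : ℝ → ℝ} (hh : ContDiff ℝ ∞ h) : IsTestOn W (extend S χ h) := by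
  refine hχ.of_eq_zero hS.isOpen_W ?_ fun z hz ↦ by rw [extend, hz, mul_zero, zero_smul]
  refine ((hh.comp_contDiffOn hS.contDiffOn).mul hχ.contDiff.contDiffOn).smul ?_
  exact hS.contDiffOn_fderiv.smulRight hS.contDiffOn_fderiv

omit hχ in
lemma extend_apply (h : IsEmbeddedCurve n γ J)
    (hχ1 : ∀ s ∈ I₁, ∀ᶠ z in 𝓝 (coordCurve γ c s), χ z = 1) {f : ℝ → ℝ} (hf : IsTestOn I₁ f) {s : ℝ}
    (hs : s ∈ I) (hsW : coordCurve γ c s ∈ W) :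
    extend S χ f (coordCurve γ c s) (deriv (coordCurve γ c) s) (deriv (coordCurve γ c) s) = f s := by
  have h1 := hS.fderiv_deriv h hsW (by
    rw [coordCurve, (extChartAt (𝓡 n) c).left_inv (hS.mem_source s hs)]
    exact mem_image_of_mem γ (hS.I_subset hs))
  rw [hS.left_inv s hs hsW] at h1
  rw [extend, _root_.smul_apply, _root_.smul_apply, outer_apply, h1, hS.left_inv s hs hsW]
  by_cases hs₁ : s ∈ I₁
  · rw [(hχ1 s hs₁).self_of_nhds]
    simp
  · rw [hf.eq_zero hs₁]
    simp

/-- The divergence identity for the covector field `f(S) ξ`, in terms of its restriction to the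
curve. -/
lemma map_extend_deriv [T2Space M] (h : IsEmbeddedCurve n γ J) {g : LorentzMetric n M}
    {Λ : CovariantField n M → ℝ} (hΛ : IsStressFunctional g Λ)
    (hvan : ∀ X, IsTestOn W X → (∀ z ∈ W, (extChartAt (𝓡 n) c).symm z ∈ γ '' J → X z = 0) →
      Λ (chartField c X) = 0)
    (hχ1 : ∀ s ∈ I₁, ∀ᶠ z in 𝓝 (coordCurve γ c s), χ z = 1) {f : ℝ → ℝ} (hf : IsTestOn I₁ f)
    (ξ : Covec n) (hξ : IsTestOn I₁ fun s ↦ deriv f s * ξ (deriv (coordCurve γ c) s) -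
      f s * gammaForm g c (coordCurve γ c s) ξ (deriv (coordCurve γ c) s)
        (deriv (coordCurve γ c) s)) :
    Λ (chartField c (extend S χ fun s ↦ deriv f s * ξ (deriv (coordCurve γ c) s) -
      f s * gammaForm g c (coordCurve γ c s) ξ (deriv (coordCurve γ c) s)
        (deriv (coordCurve γ c) s))) = 0 := by
  have hv : IsTestOn W fun z ↦ (f (S z) * χ z) • ξ :=
    hχ.of_eq_zero hS.isOpen_W (((hf.contDiff.comp_contDiffOn hS.contDiffOn).mul
      hχ.contDiff.contDiffOn).smul contDiffOn_const) fun z hz ↦ by rw [hz, mul_zero, zero_smul]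
  rw [← hΛ.map_covDeriv c _ hv.contDiff hv.hasCompactSupport
    (hv.tsupport_subset.trans hS.W_subset)]
  refine hS.eq_tangential h hΛ hvan (hS.isTestOn_extend hχ hξ.contDiff)
    (isTestOn_covDeriv g hS.W_subset hv) fun s hs hsW ↦ ?_
  rw [hS.extend_apply h hχ1 hξ hs hsW]
  have hSs := hS.left_inv s hs hsW
  have h1 := hS.fderiv_deriv h hsW (by
    rw [coordCurve, (extChartAt (𝓡 n) c).left_inv (hS.mem_source s hs)]
    exact mem_image_of_mem γ (hS.I_subset hs))
  rw [hSs] at h1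
  have hfχ : f s * χ (coordCurve γ c s) = f s := by
    by_cases hs₁ : s ∈ I₁
    · rw [(hχ1 s hs₁).self_of_nhds, mul_one]
    · rw [hf.eq_zero hs₁, zero_mul]
  have hfS : HasFDerivAt (fun z ↦ f (S z)) (deriv f s • fderiv ℝ S (coordCurve γ c s))
      (coordCurve γ c s) := by
    have h2 : HasDerivAt f (deriv f s) (S (coordCurve γ c s)) := by
      rw [hSs]
      exact (hf.contDiff.differentiable (by simp) s).hasDerivAt
    exact h2.comp_hasFDerivAt _ (hS.hasFDerivAt hsW)
  have hd : HasFDerivAt (fun z ↦ f (S z) * χ z) (deriv f s • fderiv ℝ S (coordCurve γ c s))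
      (coordCurve γ c s) := by
    by_cases hs₁ : s ∈ tsupport f
    · refine hfS.congr_of_eventuallyEq ?_
      filter_upwards [hχ1 s (hf.tsupport_subset hs₁)] with z hz
      rw [hz, mul_one]
    · have h3 : ∀ᶠ r in 𝓝 s, f r = 0 := by
        filter_upwards [(isClosed_tsupport f).isOpen_compl.mem_nhds hs₁] with r hr
        exact image_eq_zero_of_notMem_tsupport hr
      have h4 : ∀ᶠ z in 𝓝 (coordCurve γ c s), f (S z) = 0 := by
        have h5 := (hS.hasFDerivAt hsW).continuousAt
        rw [ContinuousAt, hSs] at h5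
        exact h5.eventually h3
      refine hfS.congr_of_eventuallyEq ?_
      filter_upwards [h4] with z hz
      rw [hz, zero_mul]
  have h6 := (hd.smul_const ξ).fderiv
  rw [covDeriv, h6, hSs, hfχ, gammaForm_smul]
  simp [h1]

end IsStraightened

variable [T2Space M] [SecondCountableTopology M]

/-- The structure of a conserved positive functional supported on a curve, near a point of the
curve: it has a smooth density `ρ` times the square of the velocity, and `ρ` satisfies the equations
`(ρ u^k)' + ρ Γ^k_{ij} u^i u^j = 0`. -/
theorem IsCurveFunctional.exists_local_density {g : LorentzMetric n M}
    {Λ : CovariantField n M → ℝ} (hΛ : IsCurveFunctional g Λ (γ '' J)) (h : IsEmbeddedCurve n γ J)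
    (hJ : IsOpen J) {s₀ : ℝ} (hs₀ : s₀ ∈ J) (hvel : (vel γ J s₀ : Vec n) ≠ 0) {c : M}
    (hc : γ s₀ ∈ (extChartAt (𝓡 n) c).source) :
    ∃ ε > 0, ∃ ρ : ℝ → ℝ, Ioo (s₀ - ε) (s₀ + ε) ⊆ J ∧ InjOn γ (Ioo (s₀ - ε) (s₀ + ε)) ∧
      ContDiffOn ℝ ∞ ρ (Ioo (s₀ - ε) (s₀ + ε)) ∧
      ((∀ s ∈ Ioo (s₀ - ε) (s₀ + ε), ρ s = 0) ∨ ∀ s ∈ Ioo (s₀ - ε) (s₀ + ε), ρ s ≠ 0) ∧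
      (∃ N ∈ 𝓝 (γ s₀), ∀ x, IsTestField x → fieldSupport x ⊆ N →
        Λ x = ∫ s in Ioo (s₀ - ε) (s₀ + ε), ρ s * formAt x (γ s) (vel γ J s) (vel γ J s)) ∧
      ∀ k, ∀ s ∈ Ioo (s₀ - ε) (s₀ + ε),
        deriv ρ s * deriv (coordCurve (n := n) γ c) s k +
          ρ s * (deriv (fun s ↦ deriv (coordCurve (n := n) γ c) s k) s +
            ∑ i, ∑ j, christoffel g c k i j (coordCurve γ c s) *
              deriv (coordCurve (n := n) γ c) s i * deriv (coordCurve (n := n) γ c) s j) = 0 := by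
  obtain ⟨N₀, hN₀, hvan₀⟩ := hΛ.exists_nhds_eq_zero h.isClosed hc
  obtain ⟨ε₀, hε₀, W, S, k₀, hS, hyW, hWN, hk₀⟩ := h.exists_isStraightened hJ hs₀ hvel hc hN₀
  have hvan := fun X ↦ hvan₀ W X (subset_inter hS.W_subset hWN)
  set y := coordCurve (n := n) γ c with hy
  have hs₀I : s₀ ∈ Ioo (s₀ - ε₀) (s₀ + ε₀) := by constructor <;> linarith
  have hyc : ContinuousAt y s₀ := (hS.hasDerivAt_coordCurve h hs₀I).continuousAt
  -- the cutoff in the coordinates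
  obtain ⟨r, hr, hrW⟩ := Metric.isOpen_iff.1 hS.isOpen_W _ hyW
  let χ : ContDiffBump (y s₀) := ⟨r / 4, r / 2, by positivity, by linarith⟩
  have hχ : IsTestOn W χ := by
    refine ⟨χ.contDiff, χ.hasCompactSupport, ?_⟩
    rw [χ.tsupport_eq]
    exact (Metric.closedBall_subset_ball (by change r / 2 < r; linarith)).trans hrW
  obtain ⟨ε, hε, hεε₀, hball⟩ : ∃ ε > 0, ε ≤ ε₀ ∧
      ∀ s ∈ Ioo (s₀ - ε) (s₀ + ε), y s ∈ Metric.ball (y s₀) (r / 4) := by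
    obtain ⟨ε, hε, hb⟩ := Metric.mem_nhds_iff.1
      (hyc (Metric.ball_mem_nhds (y s₀) (by positivity : 0 < r / 4)))
    rw [Real.ball_eq_Ioo] at hb
    refine ⟨min ε ε₀, lt_min hε hε₀, min_le_right _ _, fun s hs ↦ hb ⟨?_, ?_⟩⟩
    · linarith [hs.1, min_le_left ε ε₀]
    · linarith [hs.2, min_le_left ε ε₀]
  have hχ1 : ∀ s ∈ Ioo (s₀ - ε) (s₀ + ε), ∀ᶠ z in 𝓝 (y s), χ z = 1 := fun s hs ↦
    χ.eventuallyEq_one_of_mem_ball (hball s hs)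
  have hsub : Ioo (s₀ - ε) (s₀ + ε) ⊆ Ioo (s₀ - ε₀) (s₀ + ε₀) :=
    Ioo_subset_Ioo (by linarith) (by linarith)
  have hIW : ∀ s ∈ Ioo (s₀ - ε) (s₀ + ε), y s ∈ W := fun s hs ↦
    hrW (Metric.ball_subset_ball (by linarith) (hball s hs))
  have hoi : IsOpen (Ioo (s₀ - ε) (s₀ + ε)) := isOpen_Ioo
  have hft : ∀ {X : Vec n → Form n}, IsTestOn W X → IsTestField (chartField c X) := fun hX ↦
    isTestField_chartField c hX.contDiff hX.hasCompactSupport (hX.tsupport_subset.trans hS.W_subset)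
  have hFt : ∀ {f : ℝ → ℝ}, IsTestOn (Ioo (s₀ - ε) (s₀ + ε)) f →
      IsTestOn W (IsStraightened.extend S χ f) := fun hf ↦ hS.isTestOn_extend hχ hf.contDiff
  have hyd := (hS.contDiffOn_coordCurve h).mono hsub
  have hwd := (hS.contDiffOn_deriv h).mono hsub
  have hA : ∀ k : Fin n, ContDiffOn ℝ ∞ (fun s ↦ deriv y s k) (Ioo (s₀ - ε) (s₀ + ε)) := fun k ↦
    (EuclideanSpace.proj k : Vec n →L[ℝ] ℝ).contDiff.comp_contDiffOn hwd
  have hB : ∀ k : Fin n, ContDiffOn ℝ ∞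
      (fun s ↦ gammaForm g c (y s) (EuclideanSpace.proj k) (deriv y s) (deriv y s))
      (Ioo (s₀ - ε) (s₀ + ε)) := fun k ↦
    (((contDiffOn_gammaForm g c subset_rfl contDiffOn_const).comp hyd fun s hs ↦
      hS.W_subset (hIW s hs)).clm_apply hwd).clm_apply hwd
  obtain ⟨ρ, hρ, hρ0, hρint, hρode⟩ := exists_density (ν := fun f ↦
      Λ (chartField c (IsStraightened.extend S χ f))) (a := s₀ - ε) (b := s₀ + ε) (by linarith)
    (fun f f' hf hf' ↦ by
      rw [← hΛ.map_add _ _ (hft (hFt hf)) (hft (hFt hf')), ← chartField_add]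
      congr 2
      ext z : 1
      simp only [IsStraightened.extend, Pi.add_apply, add_mul, add_smul])
    (fun t f hf ↦ by
      rw [← hΛ.map_smul _ _ (hft (hFt hf)), ← chartField_smul]
      congr 2
      ext z : 1
      simp only [IsStraightened.extend, Pi.smul_apply, smul_eq_mul, mul_assoc, mul_smul])
    hA hB (k₀ := k₀) (fun s hs ↦ hk₀ s (hsub hs))
    (fun k f hf ↦ by
      refine hS.map_extend_deriv hχ h hΛ.toIsStressFunctional hvan hχ1 hf
        (EuclideanSpace.proj k) ?_
      refine .sub hoi (f := fun s ↦ deriv f s * deriv y s k) (g := fun s ↦ f s *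
        gammaForm g c (y s) (EuclideanSpace.proj k) (deriv y s) (deriv y s)) ?_ ?_
      · exact hf.deriv.of_eq_zero hoi (hf.deriv.contDiff.contDiffOn.mul (hA k)) fun z hz ↦ by
          rw [hz, zero_mul]
      · exact hf.of_eq_zero hoi (hf.contDiff.contDiffOn.mul (hB k)) fun z hz ↦ by
          rw [hz, zero_mul])
  refine ⟨ε, hε, ρ, (hsub.trans hS.I_subset), ?_, hρ, hρ0, ?_, fun k s hs ↦ ?_⟩
  · intro s hs r hr hsr
    rw [← hS.left_inv s (hsub hs) (hIW s hs), ← hS.left_inv r (hsub hr) (hIW r hr), coordCurve,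
      coordCurve, hsr]
  · -- localize the test fields so that they meet the curve in a compact part of the interval
    have hW' : IsOpen (W ∩ S ⁻¹' Ioo (s₀ - ε / 2) (s₀ + ε / 2)) :=
      hS.contDiffOn.continuousOn.isOpen_inter_preimage hS.isOpen_W isOpen_Ioo
    have hyW' : y s₀ ∈ W ∩ S ⁻¹' Ioo (s₀ - ε / 2) (s₀ + ε / 2) := by
      refine ⟨hyW, ?_⟩
      rw [mem_preimage, hS.left_inv s₀ hs₀I hyW]
      constructor <;> linarith
    obtain ⟨r', hr', hrW'⟩ := Metric.isOpen_iff.1 hW' _ hyW'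
    let ψ : ContDiffBump (y s₀) := ⟨r' / 4, r' / 2, by positivity, by linarith⟩
    have hψs : tsupport ψ ⊆ W ∩ S ⁻¹' Ioo (s₀ - ε / 2) (s₀ + ε / 2) := by
      rw [ψ.tsupport_eq]
      exact (Metric.closedBall_subset_ball (by change r' / 2 < r'; linarith)).trans hrW'
    have hψ : IsTestOn W ψ := ⟨ψ.contDiff, ψ.hasCompactSupport, hψs.trans inter_subset_left⟩
    have hψ0 : ∀ s ∈ Ioo (s₀ - ε₀) (s₀ + ε₀), y s ∈ W → s ∉ Icc (s₀ - ε / 2) (s₀ + ε / 2) →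
        ψ (y s) = 0 := by
      intro s hs hsW hsi
      refine image_eq_zero_of_notMem_tsupport fun h' ↦ hsi ?_
      have := (hψs h').2
      rw [mem_preimage, hS.left_inv s hs hsW] at this
      exact Ioo_subset_Icc_self this
    refine ⟨(extChartAt (𝓡 n) c).source ∩ extChartAt (𝓡 n) c ⁻¹' Metric.ball (y s₀) (r' / 4),
      Filter.inter_mem ((isOpen_extChartAt_source c).mem_nhds hc)
        ((continuousAt_extChartAt' hc) (Metric.ball_mem_nhds _ (by positivity))), fun x hx hxN ↦ ?_⟩
    set X : Vec n → Form n := fun z ↦ ψ z • coordForm c x z with hX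
    have hXt : IsTestOn W X := hψ.of_eq_zero hS.isOpen_W
      (hψ.contDiff.contDiffOn.smul ((hx.1.contDiffOn c).mono hS.W_subset)) fun z hz ↦ by
        simp only [hX, hz, zero_smul]
    have hxX : chartField c X = x := by
      refine field_ext fun p ↦ ?_
      by_cases hp : p ∈ (extChartAt (𝓡 n) c).source
      · have h1 : formAt (chartField c X) p = ψ (extChartAt (𝓡 n) c p) • formAt x p := by
          rw [← chartField_coordForm hp x, chartField_apply hp, chartField_apply hp]
          rfl
        rw [h1]
        by_cases hpx : p ∈ fieldSupport x
        · rw [(ψ.eventuallyEq_one_of_mem_ball (hxN hpx).2).self_of_nhds]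
          exact one_smul ℝ _
        · rw [formAt_eq_zero hpx, smul_zero]
      · rw [chartField_apply_of_notMem hp, formAt_eq_zero fun h' ↦ hp (hxN h').1]
    set H : ℝ → ℝ := (Ioo (s₀ - ε) (s₀ + ε)).indicator fun s ↦ X (y s) (deriv y s) (deriv y s) with hH
    have hHI : ∀ s ∈ Ioo (s₀ - ε) (s₀ + ε), H s = X (y s) (deriv y s) (deriv y s) := fun s hs ↦
      indicator_of_mem hs _
    have hHt : IsTestOn (Ioo (s₀ - ε) (s₀ + ε)) H := by
      refine .of_closed hoi isCompact_Icc isClosed_Icc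
        (Icc_subset_Ioo (by linarith : s₀ - ε < s₀ - ε / 2) (by linarith : s₀ + ε / 2 < s₀ + ε)) ?_ ?_
      · exact (((hXt.contDiff.comp_contDiffOn hyd).clm_apply hwd).clm_apply hwd).congr hHI
      · intro s hs
        by_cases hsI : s ∈ Ioo (s₀ - ε) (s₀ + ε)
        · rw [hHI s hsI, hX]
          simp [hψ0 s (hsub hsI) (hIW s hsI) hs]
        · exact indicator_of_notMem hsI _
    have h1 : Λ x = Λ (chartField c (IsStraightened.extend S χ H)) := by
      rw [← hxX]
      refine hS.eq_tangential h hΛ.toIsStressFunctional hvan hXt (hFt hHt) fun s hs hsW ↦ ?_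
      rw [hS.extend_apply h hχ1 hHt hs hsW]
      by_cases hsI : s ∈ Ioo (s₀ - ε) (s₀ + ε)
      · rw [hHI s hsI]
      · rw [hHt.eq_zero hsI]
        have h2 : s ∉ Icc (s₀ - ε / 2) (s₀ + ε / 2) := fun h' ↦
          hsI ⟨by linarith [h'.1], by linarith [h'.2]⟩
        simp [hX, ← hy, hψ0 s hs hsW h2]
    rw [h1, hρint H hHt]
    refine setIntegral_congr_fun measurableSet_Ioo fun s hs ↦ ?_
    beta_reduce
    rw [hHI s hs, ← hxX, chartField_apply (hS.mem_source s (hsub hs)), Form.pull_apply,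
      hS.deriv_coordCurve h (hsub hs)]
    rfl
  · have := hρode k s hs
    rw [gammaForm_proj] at this
    exact this

end LocalDensity

/-! ### The density on the whole curve -/

section GlobalDensity

variable {n : ℕ} {M : Type*} [TopologicalSpace M] [ChartedSpace (EuclideanSpace ℝ (Fin n)) M]
  {γ : ℝ → M} {J : Set ℝ}

/-- The component of a field along the velocity. -/
def alongCurve (γ : ℝ → M) (J : Set ℝ) (x : CovariantField n M) (s : ℝ) : ℝ :=
  formAt x (γ s) (vel γ J s) (vel γ J s)

variable [IsManifold (𝓡 n) ∞ M]

lemma IsEmbeddedCurve.vel_eq (h : IsEmbeddedCurve n γ J) {c : M} {s : ℝ} (hs : s ∈ J)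
    (hc : γ s ∈ (extChartAt (𝓡 n) c).source) :
    (vel γ J s : Vec n) = chartDSymm c (coordCurve γ c s) (derivWithin (coordCurve γ c) J s) := by
  rw [h.derivWithin_coordCurve hs hc, coordCurve, chartDSymm_chartD hc]

lemma IsEmbeddedCurve.alongCurve_eq (h : IsEmbeddedCurve n γ J) (x : CovariantField n M) {c : M}
    {s : ℝ} (hs : s ∈ J) (hc : γ s ∈ (extChartAt (𝓡 n) c).source) :
    alongCurve γ J x s = coordForm c x (coordCurve γ c s) (derivWithin (coordCurve γ c) J s)
      (derivWithin (coordCurve γ c) J s) := by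
  rw [coordForm, Form.pull_apply, ← h.vel_eq hs hc, coordCurve, (extChartAt (𝓡 n) c).left_inv hc]
  rfl

lemma IsEmbeddedCurve.continuousOn_alongCurve (h : IsEmbeddedCurve n γ J) (hJ : IsOpen J)
    {x : CovariantField n M} (hx : IsTestField x) : ContinuousOn (alongCurve γ J x) J := by
  intro s hs
  have hsrc := mem_extChartAt_source (I := 𝓡 n) (γ s)
  have hev : ∀ᶠ r in 𝓝 s, r ∈ J ∩ γ ⁻¹' (extChartAt (𝓡 n) (γ s)).source :=
    (h.contMDiffOn.continuousOn.isOpen_inter_preimage hJ (isOpen_extChartAt_source (γ s))).mem_nhds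
      ⟨hs, hsrc⟩
  have hopen := h.contMDiffOn.continuousOn.isOpen_inter_preimage hJ
    (isOpen_extChartAt_source (I := 𝓡 n) (γ s))
  have hy := h.contDiffOn_coordCurve (γ s)
  have hyc := (hy.continuousOn.continuousAt (hopen.mem_nhds ⟨hs, hsrc⟩))
  have hdc := (((contDiffOn_infty_iff_deriv_of_isOpen hopen).1 hy).2.continuousOn.continuousAt
    (hopen.mem_nhds ⟨hs, hsrc⟩))
  have hXc : ContinuousAt (coordForm (γ s) x) (coordCurve (γ) (γ s) s) :=
    (hx.1.contDiffOn (γ s)).continuousOn.continuousAt ((isOpen_extChartAt_target (γ s)).mem_nhds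
      ((extChartAt (𝓡 n) (γ s)).map_source hsrc))
  have hc : ContinuousAt (fun r ↦ coordForm (γ s) x (coordCurve γ (γ s) r)
      (deriv (coordCurve γ (γ s)) r) (deriv (coordCurve γ (γ s)) r)) s :=
    ((ContinuousAt.comp (f := coordCurve (n := n) γ (γ s)) hXc hyc).clm_apply hdc).clm_apply hdc
  refine (hc.congr ?_).continuousWithinAt
  filter_upwards [hev] with r hr
  rw [h.alongCurve_eq x hr.1 hr.2, derivWithin_of_isOpen hJ hr.1]

omit [IsManifold (𝓡 n) ∞ M] in
lemma alongCurve_eq_zero {x : CovariantField n M} {N : Set M} {I K : Set ℝ} (hIJ : I ⊆ J)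
    (hI : InjOn γ I) (hK : K ⊆ I) (hN : N ∩ γ '' J ⊆ γ '' K) (hx : fieldSupport x ⊆ N) :
    ∀ s ∈ I \ K, alongCurve γ J x s = 0 := by
  intro s hs
  rw [alongCurve, formAt_eq_zero]
  · rfl
  · intro h
    obtain ⟨r, hr, hrs⟩ := hN ⟨hx h, mem_image_of_mem γ (hIJ hs.1)⟩
    exact hs.2 (hI (hK hr) hs.1 hrs ▸ hr)

/-- The vector field `ρ dγ/ds` satisfies the equations `(ρ u^k)' + ρ Γ^k_{ij} u^i u^j = 0` with
`u = dγ/ds`, in each chart: it is parallel along the curve. -/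
def HasParallelMomentum (g : LorentzMetric n M) (γ : ℝ → M) (J : Set ℝ) (ρ : ℝ → ℝ) : Prop :=
  ∀ c, ∀ s ∈ J, γ s ∈ (extChartAt (𝓡 n) c).source → ∀ k,
    deriv ρ s * deriv (coordCurve (n := n) γ c) s k +
      ρ s * (deriv (fun s ↦ deriv (coordCurve (n := n) γ c) s k) s +
        ∑ i, ∑ j, christoffel g c k i j (coordCurve γ c s) *
          deriv (coordCurve (n := n) γ c) s i * deriv (coordCurve (n := n) γ c) s j) = 0

/-- The functional is represented by the density `ρ` on the piece `I` of the curve, for fields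
supported in `N`. -/
structure IsDensityOn (Λ : CovariantField n M → ℝ) (γ : ℝ → M) (J I : Set ℝ) (N : Set M)
    (ρ : ℝ → ℝ) : Prop where
  isOpen : IsOpen I
  subset : I ⊆ J
  injOn : InjOn γ I
  continuousOn : ContinuousOn ρ I
  eq_integral : ∀ x, IsTestField x → fieldSupport x ⊆ N →
    Λ x = ∫ s in I, ρ s * alongCurve γ J x s

/-- The interval of a density can be shrunk, together with the neighborhood `N`. -/
lemma IsDensityOn.shrink (h : IsEmbeddedCurve n γ J) {Λ : CovariantField n M → ℝ} {I K : Set ℝ}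
    {N : Set M} {ρ : ℝ → ℝ} (hρ : IsDensityOn Λ γ J I N ρ) {s : ℝ} (hK : IsOpen K) (hKI : K ⊆ I)
    (hs : s ∈ K) (hN : N ∈ 𝓝 (γ s)) : ∃ N' ∈ 𝓝 (γ s), N' ∩ γ '' J ⊆ γ '' K ∧ N' ⊆ N ∧
      IsDensityOn Λ γ J K N' ρ := by
  obtain ⟨ε, hε, hb⟩ := Metric.isOpen_iff.1 hK s hs
  rw [Real.ball_eq_Ioo] at hb
  obtain ⟨N₁, hN₁, hN₁γ⟩ := h.local_piece s (hρ.subset (hKI hs)) ε hε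
  have hsub : (N ∩ N₁) ∩ γ '' J ⊆ γ '' K := fun p hp ↦
    image_mono (inter_subset_right.trans hb) (hN₁γ ⟨hp.1.2, hp.2⟩)
  refine ⟨N ∩ N₁, Filter.inter_mem hN hN₁, hsub, inter_subset_left, hK, hKI.trans hρ.subset,
    hρ.injOn.mono hKI, hρ.continuousOn.mono hKI, fun x hx hxN ↦ ?_⟩
  rw [hρ.eq_integral x hx (hxN.trans inter_subset_left)]
  refine setIntegral_eq_of_subset_of_forall_sdiff_eq_zero hρ.isOpen.measurableSet hKI fun r hr ↦ ?_
  rw [alongCurve_eq_zero hρ.subset hρ.injOn hKI hsub hxN r hr, mul_zero]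

variable [T2Space M]

/-- Energy densities that are localized near a point of the curve detect the sign of a function
there. -/
lemma IsEmbeddedCurve.exists_integral_pos (h : IsEmbeddedCurve n γ J) (hJ : IsOpen J)
    {g : LorentzMetric n M} (hcausal : IsCausalCurve g γ J) {I : Set ℝ} (hI : IsOpen I) (hIJ : I ⊆ J)
    (hinj : InjOn γ I) {s : ℝ} (hs : s ∈ I) {N : Set M} (hN : N ∈ 𝓝 (γ s)) {κ : ℝ → ℝ}
    (hκ : ContinuousOn κ I) (hκs : 0 < κ s) :
    ∃ e : CovariantField n M, IsTestField e ∧ fieldSupport e ⊆ N ∧ IsEnergyNonneg g e ∧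
      (∀ ρ, ContinuousOn ρ I → IntegrableOn (fun r ↦ ρ r * alongCurve γ J e r) I) ∧
      0 < ∫ r in I, κ r * alongCurve γ J e r := by
  obtain ⟨δ₀, hδ₀, hb⟩ := Metric.mem_nhds_iff.1 (Filter.inter_mem (hI.mem_nhds hs)
    ((hκ.continuousAt (hI.mem_nhds hs)).eventually_const_lt hκs))
  rw [Real.ball_eq_Ioo] at hb
  set δ := δ₀ / 2
  have hδ : 0 < δ := half_pos hδ₀
  have hδδ : δ < δ₀ := half_lt_self hδ₀
  have hIcc : Icc (s - δ) (s + δ) ⊆ I ∩ {r | 0 < κ r} := fun r hr ↦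
    hb ⟨by linarith [hr.1], by linarith [hr.2]⟩
  have hIoo : Ioo (s - δ) (s + δ) ⊆ I := fun r hr ↦ (hIcc (Ioo_subset_Icc_self hr)).1
  have hsm : s ∈ Ioo (s - δ) (s + δ) := by constructor <;> linarith
  obtain ⟨N₁, hN₁, hN₁γ⟩ := h.local_piece s (hIJ hs) δ hδ
  obtain ⟨e, he, hes, hen, -, -, -, hnn, hpos⟩ := exists_energyBump g
    (mem_extChartAt_source (I := 𝓡 n) (γ s)) (isOpen_interior (s := N ∩ N₁))
    (mem_interior_iff_mem_nhds.2 (Filter.inter_mem hN hN₁))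
  have hes' : fieldSupport e ⊆ N ∩ N₁ := hes.trans interior_subset
  have hzero : ∀ r ∈ I \ Ioo (s - δ) (s + δ), alongCurve γ J e r = 0 :=
    alongCurve_eq_zero hIJ hinj hIoo (fun p hp ↦ image_mono inter_subset_right (hN₁γ hp))
      (hes'.trans inter_subset_right)
  have hec : ContinuousOn (alongCurve γ J e) I := (h.continuousOn_alongCurve hJ he).mono hIJ
  have hint : ∀ ρ, ContinuousOn ρ I → IntegrableOn (fun r ↦ ρ r * alongCurve γ J e r)
      (Ioo (s - δ) (s + δ)) := fun ρ hρ ↦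
    (((hρ.mul hec).mono fun r hr ↦ (hIcc hr).1).integrableOn_Icc).mono_set Ioo_subset_Icc_self
  refine ⟨e, he, hes'.trans inter_subset_left, hen, fun ρ hρ ↦ ?_, ?_⟩
  · exact (hint ρ hρ).of_forall_sdiff_eq_zero hI.measurableSet fun r hr ↦ by
      rw [hzero r hr, mul_zero]
  · rw [setIntegral_eq_of_subset_of_forall_sdiff_eq_zero hI.measurableSet hIoo fun r hr ↦ by
      rw [hzero r hr, mul_zero]]
    have hnn' : ∀ r ∈ Ioo (s - δ) (s + δ), 0 ≤ κ r * alongCurve γ J e r := fun r hr ↦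
      mul_nonneg (le_of_lt (hIcc (Ioo_subset_Icc_self hr)).2) (hnn _ _)
    refine lt_of_le_of_ne (setIntegral_nonneg measurableSet_Ioo hnn') fun h0 ↦ ?_
    have h1 := (setIntegral_eq_zero_iff_of_nonneg_ae
      ((ae_restrict_iff' measurableSet_Ioo).2 (.of_forall hnn')) (hint κ hκ)).1 h0.symm
    have h2 := Measure.eqOn_open_of_ae_eq h1 isOpen_Ioo ((hκ.mul hec).mono hIoo) continuousOn_const hsm
    have h3 : 0 < alongCurve γ J e s := hpos _ (hcausal s (hIJ hs)).1 (hcausal s (hIJ hs)).2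
    exact (mul_pos hκs h3).ne' h2

/-- A density is non-negative, as the functional is non-negative on localized energy densities. -/
lemma IsDensityOn.nonneg (h : IsEmbeddedCurve n γ J) (hJ : IsOpen J) {g : LorentzMetric n M}
    (hcausal : IsCausalCurve g γ J) {Λ : CovariantField n M → ℝ} (hΛ : IsStressFunctional g Λ)
    {I : Set ℝ} {N : Set M} {ρ : ℝ → ℝ} (hρ : IsDensityOn Λ γ J I N ρ) {s : ℝ} (hs : s ∈ I)
    (hN : N ∈ 𝓝 (γ s)) : 0 ≤ ρ s := by
  by_contra! hneg
  obtain ⟨e, he, hes, hen, -, hpos⟩ := h.exists_integral_pos hJ hcausal hρ.isOpen hρ.subset hρ.injOn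
    hs hN hρ.continuousOn.neg (by rw [Pi.neg_apply]; linarith)
  have h1 := hΛ.nonneg e he hen
  rw [hρ.eq_integral e he hes] at h1
  simp only [Pi.neg_apply, neg_mul, integral_neg] at hpos
  linarith

/-- Densities are unique. -/
lemma IsDensityOn.eq (h : IsEmbeddedCurve n γ J) (hJ : IsOpen J) {g : LorentzMetric n M}
    (hcausal : IsCausalCurve g γ J) {Λ : CovariantField n M → ℝ} {I₁ I₂ : Set ℝ} {N₁ N₂ : Set M}
    {ρ₁ ρ₂ : ℝ → ℝ} (hρ₁ : IsDensityOn Λ γ J I₁ N₁ ρ₁) (hρ₂ : IsDensityOn Λ γ J I₂ N₂ ρ₂) {s : ℝ}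
    (hs₁ : s ∈ I₁) (hs₂ : s ∈ I₂) (hN₁ : N₁ ∈ 𝓝 (γ s)) (hN₂ : N₂ ∈ 𝓝 (γ s)) : ρ₁ s = ρ₂ s := by
  have hK : IsOpen (I₁ ∩ I₂) := hρ₁.isOpen.inter hρ₂.isOpen
  obtain ⟨N₁', hN₁', -, -, h₁⟩ := hρ₁.shrink h hK inter_subset_left ⟨hs₁, hs₂⟩ hN₁
  obtain ⟨N₂', hN₂', -, -, h₂⟩ := hρ₂.shrink h hK inter_subset_right ⟨hs₁, hs₂⟩ hN₂
  have key : ∀ {ρ₁ ρ₂ : ℝ → ℝ} {N₁ N₂ : Set M}, IsDensityOn Λ γ J (I₁ ∩ I₂) N₁ ρ₁ →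
      IsDensityOn Λ γ J (I₁ ∩ I₂) N₂ ρ₂ → N₁ ∈ 𝓝 (γ s) → N₂ ∈ 𝓝 (γ s) → ρ₁ s ≤ ρ₂ s := by
    intro ρ₁ ρ₂ N₁ N₂ h₁ h₂ hN₁ hN₂
    by_contra! hlt
    obtain ⟨e, he, hes, -, hint, hpos⟩ := h.exists_integral_pos hJ hcausal hK h₁.subset h₁.injOn
      ⟨hs₁, hs₂⟩ (Filter.inter_mem hN₁ hN₂) (h₁.continuousOn.sub h₂.continuousOn) (sub_pos.2 hlt)
    simp only [Pi.sub_apply, sub_mul] at hpos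
    rw [integral_sub (hint _ h₁.continuousOn) (hint _ h₂.continuousOn),
      ← h₁.eq_integral e he (hes.trans inter_subset_left),
      ← h₂.eq_integral e he (hes.trans inter_subset_right), sub_self] at hpos
    exact lt_irrefl _ hpos
  exact le_antisymm (key h₁ h₂ hN₁' hN₂') (key h₂ h₁ hN₂' hN₁')

variable [SecondCountableTopology M]

/-- A conserved positive functional supported on a causal curve is given by a positive smooth density
on the curve, with parallel momentum. -/
theorem IsCurveFunctional.exists_global_density {g : LorentzMetric n M}
    {Λ : CovariantField n M → ℝ} (hΛ : IsCurveFunctional g Λ (γ '' J)) (h : IsEmbeddedCurve n γ J)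
    (hJ : IsOpen J) (hcausal : IsCausalCurve g γ J) {e : CovariantField n M} (he : IsTestField e)
    (hΛe : Λ e ≠ 0) :
    ∃ ρ : ℝ → ℝ, ContDiffOn ℝ ∞ ρ J ∧ (∀ s ∈ J, 0 < ρ s) ∧
      (∀ s₀ ∈ J, ∃ ε > 0, ∃ N ∈ 𝓝 (γ s₀), IsDensityOn Λ γ J (Ioo (s₀ - ε) (s₀ + ε)) N ρ) ∧
      HasParallelMomentum g γ J ρ := by
  -- local densities
  have hloc : ∀ s₀ ∈ J, ∀ c : M, γ s₀ ∈ (extChartAt (𝓡 n) c).source → ∃ ρ : ℝ → ℝ, ∃ ε > 0,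
      ∃ N ∈ 𝓝 (γ s₀), IsDensityOn Λ γ J (Ioo (s₀ - ε) (s₀ + ε)) N ρ ∧
      ContDiffOn ℝ ∞ ρ (Ioo (s₀ - ε) (s₀ + ε)) ∧
      ((∀ s ∈ Ioo (s₀ - ε) (s₀ + ε), ρ s = 0) ∨ ∀ s ∈ Ioo (s₀ - ε) (s₀ + ε), ρ s ≠ 0) ∧
      ∀ k, deriv ρ s₀ * deriv (coordCurve (n := n) γ c) s₀ k +
          ρ s₀ * (deriv (fun s ↦ deriv (coordCurve (n := n) γ c) s k) s₀ +
            ∑ i, ∑ j, christoffel g c k i j (coordCurve γ c s₀) *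
              deriv (coordCurve (n := n) γ c) s₀ i * deriv (coordCurve (n := n) γ c) s₀ j) = 0 := by
    intro s₀ hs₀ c hc
    obtain ⟨ε, hε, ρ, hIJ, hinj, hρ, hρ0, ⟨N, hN, hint⟩, hode⟩ :=
      hΛ.exists_local_density h hJ hs₀ (hcausal s₀ hs₀).1 hc
    exact ⟨ρ, ε, hε, N, hN, ⟨isOpen_Ioo, hIJ, hinj, hρ.continuousOn, hint⟩, hρ, hρ0,
      fun k ↦ hode k s₀ (by constructor <;> linarith)⟩
  have hsrc : ∀ s, γ s ∈ (extChartAt (𝓡 n) (γ s)).source := fun s ↦ mem_extChartAt_source (γ s)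
  choose! d ε hε N hN hd using fun s (hs : s ∈ J) ↦ hloc s hs (γ s) (hsrc s)
  set ρ : ℝ → ℝ := fun s ↦ d s s with hρdef
  -- they are pieces of one function
  have hagree : ∀ s₀ ∈ J, ∀ (ρ₁ : ℝ → ℝ), ∀ ε₁ > 0, ∀ N₁ ∈ 𝓝 (γ s₀),
      IsDensityOn Λ γ J (Ioo (s₀ - ε₁) (s₀ + ε₁)) N₁ ρ₁ → ρ =ᶠ[𝓝 s₀] ρ₁ := by
    intro s₀ hs₀ ρ₁ ε₁ hε₁ N₁ hN₁ hρ₁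
    have hc : ContinuousAt γ s₀ := h.contMDiffOn.continuousOn.continuousAt (hJ.mem_nhds hs₀)
    filter_upwards [hJ.mem_nhds hs₀, Ioo_mem_nhds (by linarith : s₀ - ε₁ < s₀)
      (by linarith : s₀ < s₀ + ε₁), hc.eventually (eventually_mem_nhds_iff.2 hN₁)] with s hs hsI hsN
    have hsI' : s ∈ Ioo (s - ε s) (s + ε s) := by
      have := hε s hs
      constructor <;> linarith
    exact (hd s hs).1.eq h hJ hcausal hρ₁ hsI' hsI (hN s hs) hsN
  have hρd : ∀ s₀ ∈ J, ρ =ᶠ[𝓝 s₀] d s₀ := fun s₀ hs₀ ↦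
    hagree s₀ hs₀ _ _ (hε s₀ hs₀) _ (hN s₀ hs₀) (hd s₀ hs₀).1
  have hρs : ContDiffOn ℝ ∞ ρ J := fun s hs ↦
    ((((hd s hs).2.1.contDiffAt (Ioo_mem_nhds (by linarith [hε s hs])
      (by linarith [hε s hs])))).congr_of_eventuallyEq (hρd s hs)).contDiffWithinAt
  have hdens : ∀ s₀ ∈ J, ∃ ε > 0, ∃ N ∈ 𝓝 (γ s₀), IsDensityOn Λ γ J (Ioo (s₀ - ε) (s₀ + ε)) N ρ := by
    intro s₀ hs₀
    obtain ⟨ε₁, hε₁, hb⟩ := Metric.mem_nhds_iff.1 (hρd s₀ hs₀)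
    rw [Real.ball_eq_Ioo] at hb
    have hε₂ : 0 < min ε₁ (ε s₀) := lt_min hε₁ (hε s₀ hs₀)
    have hsub1 : Ioo (s₀ - min ε₁ (ε s₀)) (s₀ + min ε₁ (ε s₀)) ⊆ Ioo (s₀ - ε₁) (s₀ + ε₁) :=
      Ioo_subset_Ioo (by linarith [min_le_left ε₁ (ε s₀)]) (by linarith [min_le_left ε₁ (ε s₀)])
    have hsub2 : Ioo (s₀ - min ε₁ (ε s₀)) (s₀ + min ε₁ (ε s₀)) ⊆ Ioo (s₀ - ε s₀) (s₀ + ε s₀) :=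
      Ioo_subset_Ioo (by linarith [min_le_right ε₁ (ε s₀)]) (by linarith [min_le_right ε₁ (ε s₀)])
    obtain ⟨N', hN', -, -, h'⟩ := (hd s₀ hs₀).1.shrink h isOpen_Ioo hsub2
      (by constructor <;> linarith : s₀ ∈ _) (hN s₀ hs₀)
    refine ⟨min ε₁ (ε s₀), hε₂, N', hN', h'.isOpen, h'.subset, h'.injOn,
      hρs.continuousOn.mono h'.subset, fun x hx hxN ↦ ?_⟩
    rw [h'.eq_integral x hx hxN]
    refine setIntegral_congr_fun measurableSet_Ioo fun s hs ↦ ?_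
    have h1 : ρ s = d s₀ s := hb (hsub1 hs)
    simp only [h1]
  have hnn : ∀ s ∈ J, 0 ≤ ρ s := fun s hs ↦ by
    obtain ⟨ε, hε, N, hN, h'⟩ := hdens s hs
    exact h'.nonneg h hJ hcausal hΛ.toIsStressFunctional (by constructor <;> linarith) hN
  -- the zero set of the density is open and closed
  have hzero : ∀ s ∈ J, (∀ᶠ r in 𝓝 s, ρ r = 0) ∨ ∀ᶠ r in 𝓝 s, ρ r ≠ 0 := by
    intro s hs
    have hI := Ioo_mem_nhds (by linarith [hε s hs] : s - ε s < s) (by linarith [hε s hs] : s < s + ε s)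
    rcases (hd s hs).2.2.1 with h0 | h0
    · left
      filter_upwards [hρd s hs, hI] with r h1 h2
      rw [h1, h0 r h2]
    · right
      filter_upwards [hρd s hs, hI] with r h1 h2
      rw [h1]
      exact h0 r h2
  have hpc : PreconnectedSpace J := isPreconnected_iff_preconnectedSpace.1
    h.ordConnected.isPreconnected
  have hclopen : IsClopen {s : J | ρ s = 0} := by
    constructor
    · rw [← isOpen_compl_iff, isOpen_iff_mem_nhds]
      intro s hs
      rcases hzero s s.2 with h0 | h0
      · exact absurd h0.self_of_nhds hs
      · exact continuousAt_subtype_val.eventually h0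
    · rw [isOpen_iff_mem_nhds]
      intro s hs
      rcases hzero s s.2 with h0 | h0
      · exact continuousAt_subtype_val.eventually h0
      · exact absurd hs h0.self_of_nhds
  have hne : ∀ s ∈ J, ρ s ≠ 0 := by
    intro s hs hs0
    have huniv := hclopen.eq_univ ⟨⟨s, hs⟩, hs0⟩
    refine hΛe (he.local_induction (P := fun x ↦ Λ x = 0) hΛ.map_zero
      (fun x y hx hy h1 h2 ↦ by rw [hΛ.map_add x y hx hy, h1, h2, add_zero]) fun p _ ↦ ?_)
    by_cases hp : p ∈ γ '' J
    · obtain ⟨r, hr, rfl⟩ := hp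
      obtain ⟨ε, -, N, hN, h'⟩ := hdens r hr
      refine ⟨N, hN, fun x hx hxN ↦ ?_⟩
      rw [h'.eq_integral x hx hxN, setIntegral_eq_zero_of_forall_eq_zero fun t ht ↦ ?_]
      have h1 : ρ t = 0 := huniv.superset (mem_univ (⟨t, h'.subset ht⟩ : J))
      rw [h1, zero_mul]
    · exact ⟨_, h.isClosed.isOpen_compl.mem_nhds hp, fun x hx hxN ↦
        hΛ.zero_off x hx (subset_compl_iff_disjoint_right.1 hxN)⟩
  refine ⟨ρ, hρs, fun s hs ↦ lt_of_le_of_ne (hnn s hs) (hne s hs).symm, hdens, ?_⟩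
  intro c s hs hc k
  obtain ⟨ρ₁, ε₁, hε₁, N₁, hN₁, h1, -, -, h2⟩ := hloc s hs c hc
  have h3 := hagree s hs ρ₁ ε₁ hε₁ N₁ hN₁ h1
  rw [h3.deriv_eq, h3.self_of_nhds]
  exact h2 k

end GlobalDensity

/-! ### Arcs and loops -/

section ArcsAndLoops

variable {n : ℕ} {M : Type*} [TopologicalSpace M] [ChartedSpace (EuclideanSpace ℝ (Fin n)) M]
  {γ : ℝ → M} {J : Set ℝ}

lemma IsProperArc.isEmbeddedCurve (h : IsProperArc (n := n) γ J) : IsEmbeddedCurve n γ J := by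
  obtain ⟨h1, h2, h3, h4⟩ := h
  refine ⟨h1, h2, h3, ?_, fun s hs ε hε ↦ ?_⟩
  · have := h4.isClosed_range
    rwa [range_comp' γ, Subtype.range_coe] at this
  · have hV : IsOpen {r : J | (r : ℝ) ∈ Ioo (s - ε) (s + ε)} := isOpen_Ioo.preimage continuous_subtype_val
    obtain ⟨U, hU, hUV⟩ := h4.isInducing.isOpen_iff.1 hV
    refine ⟨U, hU.mem_nhds ?_, ?_⟩
    · have : (⟨s, hs⟩ : J) ∈ (fun s : J ↦ γ s) ⁻¹' U := by
        rw [hUV]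
        exact ⟨by linarith, by linarith⟩
      exact this
    · rintro _ ⟨hpU, r, hr, rfl⟩
      have : (⟨r, hr⟩ : J) ∈ {r : J | (r : ℝ) ∈ Ioo (s - ε) (s + ε)} := by
        rw [← hUV]
        exact hpU
      exact mem_image_of_mem γ ⟨hr, this⟩

omit [TopologicalSpace M] [ChartedSpace (EuclideanSpace ℝ (Fin n)) M] in
/-- A periodic map that is injective on one period is injective on each period. -/
lemma injOn_Ico_of_periodic {L : ℝ} (hL : 0 < L) (hp : Function.Periodic γ L)
    (hinj : InjOn γ (Ico 0 L)) (a : ℝ) : InjOn γ (Ico a (a + L)) := by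
  intro r hr s hs hrs
  have hmem : ∀ t, toIcoMod hL 0 t ∈ Ico 0 L := fun t ↦ by
    have := toIcoMod_mem_Ico hL 0 t
    rwa [zero_add] at this
  have hval : ∀ t, γ (toIcoMod hL 0 t) = γ t := fun t ↦ by
    rw [← self_sub_toIcoDiv_zsmul]
    exact hp.sub_zsmul_eq _
  have h1 := hinj (hmem r) (hmem s) (by rw [hval, hval, hrs])
  have h2 := (toIcoMod_eq_toIcoMod hL).1 h1
  obtain ⟨m, hm⟩ := h2
  rw [zsmul_eq_mul] at hm
  have h3 : (m : ℝ) * L < 1 * L := by rw [← hm]; linarith [hr.1, hs.2]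
  have h4 : (-1 : ℝ) * L < m * L := by rw [← hm]; linarith [hr.2, hs.1]
  have h5 : (m : ℝ) < 1 := lt_of_mul_lt_mul_right h3 hL.le
  have h6 : (-1 : ℝ) < m := lt_of_mul_lt_mul_right h4 hL.le
  have h7 : m = 0 := by
    have : m < 1 := by exact_mod_cast h5
    have : -1 < m := by exact_mod_cast h6
    omega
  rw [h7] at hm
  simp only [Int.cast_zero, zero_mul] at hm
  linarith

variable [T2Space M]

lemma isEmbeddedCurve_univ_of_loop {L : ℝ} (hL : 0 < L) (hs : ContMDiff 𝓘(ℝ, ℝ) (𝓡 n) ∞ γ)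
    (hp : Function.Periodic γ L) (hinj : InjOn γ (Ico 0 L)) : IsEmbeddedCurve n γ univ := by
  refine ⟨ordConnected_univ, nontrivial_univ, hs.contMDiffOn, ?_, fun s _ ε hε ↦ ?_⟩
  · rw [image_univ, ← hp.image_Icc hL 0]
    exact (isCompact_Icc.image hs.continuous).isClosed
  · -- a neighborhood of `γ s` avoids the image of the rest of a period
    set η := min ε (L / 2) with hη
    have hη0 : 0 < η := lt_min hε (by linarith)
    have hηL : η ≤ L / 2 := min_le_right _ _
    have hηε : η ≤ ε := min_le_left _ _
    have hinj' := injOn_Ico_of_periodic hL hp hinj (s - η)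
    have hK : IsClosed (γ '' Icc (s + η) (s - η + L)) := (isCompact_Icc.image hs.continuous).isClosed
    refine ⟨_, hK.isOpen_compl.mem_nhds ?_, ?_⟩
    · rintro ⟨r, hr, hrs⟩
      rcases hr.2.lt_or_eq with h | h
      · have := hinj' ⟨by linarith [hr.1], h⟩ ⟨by linarith, by linarith⟩ hrs
        linarith [hr.1]
      · rw [h, hp] at hrs
        have := hinj' ⟨le_rfl, by linarith⟩ ⟨by linarith, by linarith⟩ hrs
        linarith
    · rintro _ ⟨hpK, r, -, rfl⟩
      obtain ⟨r', hr', hrr'⟩ := hp.exists_mem_Ico hL r (s - η)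
      rw [hrr'] at hpK ⊢
      refine mem_image_of_mem γ ⟨mem_univ _, ?_, ?_⟩
      · rcases hr'.1.lt_or_eq with h | h
        · linarith
        · refine absurd ⟨s - η + L, ⟨by linarith, le_rfl⟩, ?_⟩ hpK
          rw [hp, h]
      · by_contra! h
        exact hpK ⟨r', ⟨by linarith, hr'.2.le⟩, rfl⟩

end ArcsAndLoops

/-! ### Integral formulas on the whole curve -/

section Formula

variable {n : ℕ} {M : Type*} [TopologicalSpace M] [ChartedSpace (EuclideanSpace ℝ (Fin n)) M]
  [IsManifold (𝓡 n) ∞ M] [T2Space M] [SecondCountableTopology M] {γ : ℝ → M} {J J₀ : Set ℝ}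
  {g : LorentzMetric n M} {Λ : CovariantField n M → ℝ} {ρ : ℝ → ℝ}

/-- A local integral formula implies the global one. -/
lemma IsCurveFunctional.eq_setIntegral_of_local (hΛ : IsCurveFunctional g Λ (γ '' J))
    (h : IsEmbeddedCurve n γ J) (hJ₀ : J₀ ⊆ J) (hJ₀m : MeasurableSet J₀)
    (hloc : ∀ s ∈ J, ∃ N ∈ 𝓝 (γ s), ∀ x, IsTestField x → fieldSupport x ⊆ N →
      IntegrableOn (fun r ↦ ρ r * alongCurve γ J x r) J₀ ∧
        Λ x = ∫ r in J₀, ρ r * alongCurve γ J x r)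
    {x : CovariantField n M} (hx : IsTestField x) : Λ x = ∫ r in J₀, ρ r * alongCurve γ J x r := by
  refine And.right (hx.local_induction (P := fun x ↦ IntegrableOn (fun r ↦ ρ r * alongCurve γ J x r) J₀ ∧
        Λ x = ∫ r in J₀, ρ r * alongCurve γ J x r) ?_ (fun x y hx hy h1 h2 ↦ ?_) fun p _ ↦ ?_)
  · have h0 : (fun r ↦ ρ r * alongCurve γ J (0 : CovariantField n M) r) = fun _ ↦ 0 := by
      ext r
      simp [alongCurve]
    rw [h0, hΛ.map_zero, integral_zero]
    exact ⟨integrableOn_zero, rfl⟩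
  · have hadd : (fun r ↦ ρ r * alongCurve γ J (x + y) r) =
        fun r ↦ ρ r * alongCurve γ J x r + ρ r * alongCurve γ J y r := by
      ext r
      simp [alongCurve, mul_add]
    rw [hadd, hΛ.map_add x y hx hy, h1.2, h2.2, integral_add h1.1 h2.1]
    exact ⟨h1.1.add h2.1, rfl⟩
  · by_cases hp : p ∈ γ '' J
    · obtain ⟨s, hs, rfl⟩ := hp
      exact hloc s hs
    · refine ⟨_, h.isClosed.isOpen_compl.mem_nhds hp, fun x hx hxN ↦ ?_⟩
      have hz : ∀ r ∈ J₀, ρ r * alongCurve γ J x r = 0 := fun r hr ↦ by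
        rw [alongCurve, formAt_eq_zero fun h' ↦ hxN h' (mem_image_of_mem γ (hJ₀ hr))]
        simp
      rw [hΛ.zero_off x hx (subset_compl_iff_disjoint_right.1 hxN),
        setIntegral_eq_zero_of_forall_eq_zero hz]
      exact ⟨integrableOn_zero.congr_fun (fun r hr ↦ (hz r hr).symm) hJ₀m, rfl⟩

/-- Arcs: densities integrate to the functional. -/
lemma IsCurveFunctional.eq_integral_of_injOn (hΛ : IsCurveFunctional g Λ (γ '' J))
    (h : IsEmbeddedCurve n γ J) (hJ : IsOpen J) (hinj : InjOn γ J) (hρ : ContinuousOn ρ J)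
    (hd : ∀ s ∈ J, ∃ ε > 0, ∃ N ∈ 𝓝 (γ s), IsDensityOn Λ γ J (Ioo (s - ε) (s + ε)) N ρ)
    {x : CovariantField n M} (hx : IsTestField x) : Λ x = ∫ r in J, ρ r * alongCurve γ J x r := by
  refine hΛ.eq_setIntegral_of_local h subset_rfl hJ.measurableSet (fun s hs ↦ ?_) hx
  obtain ⟨ε, hε, N, hN, hd⟩ := hd s hs
  have hIcc : Icc (s - ε / 2) (s + ε / 2) ⊆ J := fun r hr ↦
    hd.subset ⟨by linarith [hr.1], by linarith [hr.2]⟩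
  obtain ⟨N', hN', hN'γ, -, hd'⟩ := hd.shrink h (K := Ioo (s - ε / 2) (s + ε / 2)) isOpen_Ioo
    (Ioo_subset_Ioo (by linarith) (by linarith)) (by constructor <;> linarith) hN
  refine ⟨N', hN', fun x hx hxN ↦ ?_⟩
  have hz := alongCurve_eq_zero subset_rfl hinj hd'.subset hN'γ hxN
  have hz' : ∀ r ∈ J \ Ioo (s - ε / 2) (s + ε / 2), ρ r * alongCurve γ J x r = 0 := fun r hr ↦ by
    rw [hz r hr, mul_zero]
  constructor
  · refine IntegrableOn.of_forall_sdiff_eq_zero (IntegrableOn.mono_set ?_ Ioo_subset_Icc_self)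
      hJ.measurableSet hz'
    exact ((hρ.mul (h.continuousOn_alongCurve hJ hx)).mono hIcc).integrableOn_Icc
  · rw [hd'.eq_integral x hx hxN, setIntegral_eq_of_subset_of_forall_sdiff_eq_zero hJ.measurableSet
      hd'.subset hz']

omit [T2Space M] [SecondCountableTopology M] in
lemma IsEmbeddedCurve.vel_add_period (h : IsEmbeddedCurve n γ univ) {L : ℝ}
    (hp : Function.Periodic γ L) (s : ℝ) : (vel γ univ (s + L) : Vec n) = vel γ univ s := by
  have hsrc := mem_extChartAt_source (I := 𝓡 n) (γ s)
  have hpy : Function.Periodic (coordCurve (n := n) γ (γ s)) L := fun r ↦ by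
    rw [coordCurve, hp, coordCurve]
  have hd : deriv (coordCurve (n := n) γ (γ s)) (s + L) = deriv (coordCurve (n := n) γ (γ s)) s := by
    rw [← deriv_comp_add_const]
    congr 1
    exact funext hpy
  rw [h.vel_eq (c := γ s) (mem_univ _) (by rwa [hp]), h.vel_eq (c := γ s) (mem_univ _) hsrc,
    derivWithin_univ, hpy, hd]

omit [T2Space M] [SecondCountableTopology M] in
lemma IsEmbeddedCurve.alongCurve_add_period (h : IsEmbeddedCurve n γ univ) {L : ℝ}
    (hp : Function.Periodic γ L) (x : CovariantField n M) (s : ℝ) :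
    alongCurve γ univ x (s + L) = alongCurve γ univ x s := by
  rw [alongCurve, h.vel_add_period hp, hp, alongCurve]

omit [SecondCountableTopology M] in
/-- Loops: the density of a functional is periodic. -/
lemma IsEmbeddedCurve.density_add_period (h : IsEmbeddedCurve n γ univ)
    (hcausal : IsCausalCurve g γ univ) {L : ℝ} (hp : Function.Periodic γ L)
    (hd : ∀ s, ∃ ε > 0, ∃ N ∈ 𝓝 (γ s), IsDensityOn Λ γ univ (Ioo (s - ε) (s + ε)) N ρ) (s : ℝ) :
    ρ (s + L) = ρ s := by
  obtain ⟨ε, hε, N, hN, hds⟩ := hd s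
  obtain ⟨ε', hε', N', hN', hds'⟩ := hd (s + L)
  have hshift : IsDensityOn Λ γ univ ((fun r ↦ r - L) ⁻¹' Ioo (s - ε) (s + ε)) N fun r ↦ ρ (r - L) := by
    refine ⟨isOpen_Ioo.preimage (by fun_prop), subset_univ _, fun r hr t ht hrt ↦ ?_,
      hds.continuousOn.comp (by fun_prop) fun r hr ↦ hr, fun x hx hxN ↦ ?_⟩
    · have := hds.injOn hr ht (by rw [hp.sub_eq, hp.sub_eq, hrt])
      linarith
    · rw [hds.eq_integral x hx hxN, ← (measurePreserving_sub_right volume L).setIntegral_preimage_emb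
        (measurableEmbedding_subRight L)]
      refine integral_congr_ae (.of_forall fun r ↦ ?_)
      beta_reduce
      rw [← h.alongCurve_add_period hp x (r - L), sub_add_cancel]
  have := hds'.eq h isOpen_univ hcausal hshift (s := s + L) (by constructor <;> linarith)
    (by simp only [mem_preimage, add_sub_cancel_right]; constructor <;> linarith) hN'
    (by rwa [hp])
  rwa [add_sub_cancel_right] at this

/-- Loops: densities integrate to the functional. -/
lemma IsCurveFunctional.eq_integral_of_periodic (hΛ : IsCurveFunctional g Λ (γ '' univ))
    (h : IsEmbeddedCurve n γ univ) (hcausal : IsCausalCurve g γ univ) {L : ℝ} (hL : 0 < L)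
    (hp : Function.Periodic γ L) (hinj : InjOn γ (Ico 0 L)) (hρ : ContinuousOn ρ univ)
    (hd : ∀ s ∈ univ, ∃ ε > 0, ∃ N ∈ 𝓝 (γ s), IsDensityOn Λ γ univ (Ioo (s - ε) (s + ε)) N ρ)
    {x : CovariantField n M} (hx : IsTestField x) :
    Λ x = ∫ r in Ico 0 L, ρ r * alongCurve γ univ x r := by
  refine hΛ.eq_setIntegral_of_local h (subset_univ _) measurableSet_Ico (fun s _ ↦ ?_) hx
  obtain ⟨ε, hε, N, hN, hds⟩ := hd s (mem_univ s)
  set δ := min ε (L / 2) with hδ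
  have hδ0 : 0 < δ := lt_min hε (by linarith)
  have hδL : δ ≤ L / 2 := min_le_right _ _
  obtain ⟨N', hN', hN'γ, -, hd'⟩ := hds.shrink h (K := Ioo (s - δ) (s + δ)) isOpen_Ioo
    (Ioo_subset_Ioo (by linarith [min_le_left ε (L / 2)]) (by linarith [min_le_left ε (L / 2)]))
    (by constructor <;> linarith) hN
  refine ⟨N', hN', fun x hx hxN ↦ ?_⟩
  have hK : Ioo (s - δ) (s + δ) ⊆ Ico (s - L / 2) (s - L / 2 + L) := fun r hr ↦
    ⟨by linarith [hr.1], by linarith [hr.2]⟩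
  have hz := alongCurve_eq_zero (subset_univ _) (injOn_Ico_of_periodic hL hp hinj (s - L / 2)) hK
    hN'γ hxN
  have hFc : Continuous fun r ↦ ρ r * alongCurve γ univ x r :=
    continuousOn_univ.1 (hρ.mul (h.continuousOn_alongCurve isOpen_univ hx))
  have hFp : Function.Periodic (fun r ↦ ρ r * alongCurve γ univ x r) L := fun r ↦ by
    simp only [h.alongCurve_add_period hp x r,
      h.density_add_period hcausal hp (fun s ↦ hd s (mem_univ s)) r]
  refine ⟨(hFc.integrableOn_Icc).mono_set Ico_subset_Icc_self, ?_⟩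
  have h1 := hFp.intervalIntegral_add_eq 0 (s - L / 2)
  rw [zero_add, intervalIntegral.integral_of_le hL.le, intervalIntegral.integral_of_le (by linarith),
    ← integral_Ico_eq_integral_Ioc, ← integral_Ico_eq_integral_Ioc] at h1
  rw [h1, hd'.eq_integral x hx hxN]
  exact (setIntegral_eq_of_subset_of_forall_sdiff_eq_zero measurableSet_Ico hK fun r hr ↦ by
    rw [hz r hr, mul_zero]).symm

end Formula

/-! ### Limits along ultrafilters -/

section Limits

variable {n : ℕ} {M : Type*} [TopologicalSpace M] [ChartedSpace (EuclideanSpace ℝ (Fin n)) M]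
  [IsManifold (𝓡 n) ∞ M] [T2Space M] {g : LorentzMetric n M}

lemma IsStressFunctional.of_tendsto {ι : Type*} {l : Filter ι} [l.NeBot]
    {L : ι → CovariantField n M → ℝ} {Λ : CovariantField n M → ℝ}
    (hL : ∀ k, IsStressFunctional g (L k))
    (h : ∀ x, IsTestField x → Tendsto (fun k ↦ L k x) l (𝓝 (Λ x))) : IsStressFunctional g Λ where
  map_add x y hx hy := tendsto_nhds_unique (h _ (hx.add hy))
    (((h x hx).add (h y hy)).congr fun k ↦ ((hL k).map_add x y hx hy).symm)
  map_smul a x hx := tendsto_nhds_unique (h _ (hx.const_smul a))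
    (((h x hx).const_mul a).congr fun k ↦ ((hL k).map_smul a x hx).symm)
  nonneg x hx hx0 := ge_of_tendsto' (h x hx) fun k ↦ (hL k).nonneg x hx hx0
  map_flip c X hX hc hs := by

    have h1 : IsTestField (chartField c fun y ↦ (X y).flip) := by
      refine isTestField_chartField c ?_ ?_ ?_
      · exact (ContinuousLinearMap.flipₗᵢ ℝ (Vec n) (Vec n) ℝ).contDiff.comp hX
      · exact hc.comp_left (g := fun x : Form n ↦ x.flip) rfl
      · exact (tsupport_comp_subset (g := fun x : Form n ↦ x.flip) rfl X).trans hs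
    exact tendsto_nhds_unique (h _ h1) ((h _ (isTestField_chartField c hX hc hs)).congr fun k ↦
      ((hL k).map_flip c X hX hc hs).symm)
  map_covDeriv c v hv hc hs := tendsto_nhds_unique
    (h _ (isTestField_chartField c (contDiff_covDeriv g c hv hs) (hasCompactSupport_covDeriv g c hc)
      ((tsupport_covDeriv_subset g c v).trans hs)))
    (tendsto_const_nhds.congr fun k ↦ ((hL k).map_covDeriv c v hv hc hs).symm)

/-- Bounded concentrating sequences have limits along ultrafilters. -/
lemma IsConcentrating.exists_limit {L : ℕ → CovariantField n M → ℝ} {Γ : Set M}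
    {e : CovariantField n M} (hL : IsConcentrating g L Γ e)
    (hb : ∀ x, IsTestField x → (fun k ↦ L k x) =O[atTop] fun _ ↦ (1 : ℝ)) (U : Ultrafilter ℕ)
    (hU : (U : Filter ℕ) ≤ atTop) :
    ∃ Λ, IsCurveFunctional g Λ Γ ∧ Λ e = 1 ∧
      ∀ x, IsTestField x → Tendsto (fun k ↦ L k x) U (𝓝 (Λ x)) := by
  have hex : ∀ x, ∃ a, IsTestField x → Tendsto (fun k ↦ L k x) U (𝓝 a) := fun x ↦ by
    by_cases hx : IsTestField x
    · obtain ⟨B, hB⟩ := (hb x hx).bound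
      have hmem : (fun k ↦ L k x) ⁻¹' Icc (-B) B ∈ U := hU (hB.mono fun k hk ↦ by
        rw [norm_one, mul_one, Real.norm_eq_abs, abs_le] at hk
        exact hk)
      obtain ⟨a, -, ha⟩ := isCompact_Icc.ultrafilter_le_nhds (U.map fun k ↦ L k x)
        (le_principal_iff.2 hmem)
      exact ⟨a, fun _ ↦ ha⟩
    · exact ⟨0, fun h ↦ absurd h hx⟩
  choose Λ hΛ using hex
  have h1 : IsStressFunctional g Λ := .of_tendsto hL.stress hΛ
  refine ⟨Λ, ⟨h1, fun x hx hd ↦ ?_⟩, ?_, hΛ⟩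
  · have h0 : Tendsto (fun k : ℕ ↦ ((k : ℝ) + 1)⁻¹) atTop (𝓝 0) := by
      simpa [one_div] using tendsto_one_div_add_atTop_nhds_zero_nat (𝕜 := ℝ)
    exact tendsto_nhds_unique (hΛ x hx) (((hL.isBigO x hx hd).trans_tendsto h0).mono_left hU)
  · exact tendsto_nhds_unique (hΛ e hL.isTestField)
      (tendsto_const_nhds.congr fun k ↦ (hL.eq_one k).symm)

end Limits

/-! ### Parallel momentum -/

section Transport

variable {n : ℕ} {M : Type*} [TopologicalSpace M] [ChartedSpace (EuclideanSpace ℝ (Fin n)) M]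
  [IsManifold (𝓡 n) ∞ M] {γ : ℝ → M} {J : Set ℝ} {g : LorentzMetric n M} {ρ ρ₀ ρ₁ : ℝ → ℝ}

/-- A parallel momentum is determined up to a constant factor. -/
lemma HasParallelMomentum.exists_eq_mul (h₀ : HasParallelMomentum g γ J ρ₀)
    (h₁ : HasParallelMomentum g γ J ρ₁) (h : IsEmbeddedCurve n γ J) (hJ : IsOpen J)
    (hcausal : IsCausalCurve g γ J) (hρ₀ : ContDiffOn ℝ ∞ ρ₀ J) (hρ₁ : ContDiffOn ℝ ∞ ρ₁ J)
    (hpos : ∀ s ∈ J, 0 < ρ₀ s) : ∃ a, ∀ s ∈ J, ρ₁ s = a * ρ₀ s := by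
  have hd : ∀ {ρ : ℝ → ℝ}, ContDiffOn ℝ ∞ ρ J → ∀ s ∈ J, HasDerivAt ρ (deriv ρ s) s := fun hρ s hs ↦
    ((hρ.contDiffAt (hJ.mem_nhds hs)).differentiableAt (by simp)).hasDerivAt
  have hq : ∀ s ∈ J, HasDerivAt (fun r ↦ ρ₁ r / ρ₀ r) 0 s := fun s hs ↦ by
    have hc := mem_extChartAt_source (I := 𝓡 n) (γ s)
    have hy : deriv (coordCurve (n := n) γ (γ s)) s ≠ 0 := fun h0 ↦ by
      refine (hcausal s hs).1 ?_
      rw [h.vel_eq hs hc, derivWithin_of_isOpen hJ hs, h0, map_zero]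
    obtain ⟨k, hk⟩ : ∃ k, deriv (coordCurve (n := n) γ (γ s)) s k ≠ 0 := by
      by_contra! h0
      exact hy (by ext k; simpa using h0 k)
    have e₀ := h₀ (γ s) s hs hc k
    have e₁ := h₁ (γ s) s hs hc k
    have hw : deriv ρ₁ s * ρ₀ s - ρ₁ s * deriv ρ₀ s = 0 := by
      refine (mul_eq_zero.1 ?_).resolve_right hk
      linear_combination ρ₀ s * e₁ - ρ₁ s * e₀
    have := (hd hρ₁ s hs).div (hd hρ₀ s hs) (hpos s hs).ne'
    rw [hw, zero_div] at this
    exact this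
  obtain ⟨s₀, hs₀⟩ := h.nontrivial.nonempty
  refine ⟨ρ₁ s₀ / ρ₀ s₀, fun s hs ↦ ?_⟩
  have := hJ.is_const_of_deriv_eq_zero h.ordConnected.isPreconnected
    (fun r hr ↦ (hq r hr).differentiableAt.differentiableWithinAt) (fun r hr ↦ (hq r hr).deriv) hs₀ hs
  rw [this, div_mul_cancel₀ _ (hpos s hs).ne']

/-- The contraction of the Christoffel symbols with three copies of a vector; `D i l j` is the
derivative `∂_i g_{lj}` of the metric `G`. -/
lemma christoffel_contract {G Ginv : Matrix (Fin n) (Fin n) ℝ} (hG : G * Ginv = 1)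
    (D : Fin n → Fin n → Fin n → ℝ) (w : Fin n → ℝ) :
    ∑ m, ∑ k, w m * G m k * ∑ i, ∑ j, (2⁻¹ * ∑ l, Ginv k l * (D i l j + D j l i - D l i j)) * w i * w j =
      2⁻¹ * ∑ l, ∑ i, ∑ j, D l i j * w l * w i * w j := by
  set v : Fin n → ℝ := fun l ↦ ∑ i, ∑ j, (D i l j + D j l i - D l i j) * w i * w j with hv
  have h1 : ∀ k, ∑ i, ∑ j, (2⁻¹ * ∑ l, Ginv k l * (D i l j + D j l i - D l i j)) * w i * w j =
      2⁻¹ * (Ginv.mulVec v) k := fun k ↦ by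
    have : ∀ i j, (2⁻¹ * ∑ l, Ginv k l * (D i l j + D j l i - D l i j)) * w i * w j =
        ∑ l, 2⁻¹ * (Ginv k l * ((D i l j + D j l i - D l i j) * w i * w j)) := fun i j ↦ by
      rw [Finset.mul_sum, Finset.sum_mul, Finset.sum_mul]
      exact Finset.sum_congr rfl fun l _ ↦ by ring
    simp only [this]
    simp only [Matrix.mulVec, dotProduct, hv, Finset.mul_sum]
    rw [Finset.sum_congr rfl fun i _ ↦ Finset.sum_comm, Finset.sum_comm]
  have h2 : ∑ m, ∑ k, w m * G m k * (2⁻¹ * (Ginv.mulVec v) k) =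
      2⁻¹ * ∑ m, w m * (G.mulVec (Ginv.mulVec v)) m := by
    rw [Finset.mul_sum]
    refine Finset.sum_congr rfl fun m _ ↦ ?_
    rw [Matrix.mulVec, dotProduct, Finset.mul_sum, Finset.mul_sum]
    exact Finset.sum_congr rfl fun k _ ↦ by ring
  simp only [h1]
  rw [h2, Matrix.mulVec_mulVec, hG, Matrix.one_mulVec]
  congr 1
  have e1 : ∑ m, ∑ i, ∑ j, D i m j * w m * w i * w j = ∑ m, ∑ i, ∑ j, D m i j * w m * w i * w j := by
    rw [Finset.sum_comm]
    exact Finset.sum_congr rfl fun m _ ↦ Finset.sum_congr rfl fun i _ ↦ Finset.sum_congr rfl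
      fun j _ ↦ by ring
  have e2 : ∑ m, ∑ i, ∑ j, D j m i * w m * w i * w j = ∑ m, ∑ i, ∑ j, D m i j * w m * w i * w j := by
    rw [Finset.sum_congr rfl fun m _ ↦ Finset.sum_comm, Finset.sum_comm]
    exact Finset.sum_congr rfl fun m _ ↦ Finset.sum_congr rfl fun i _ ↦ Finset.sum_congr rfl
      fun j _ ↦ by ring
  have e3 : ∀ m, w m * v m = ∑ i, ∑ j, D i m j * w m * w i * w j + ∑ i, ∑ j, D j m i * w m * w i * w j -
      ∑ i, ∑ j, D m i j * w m * w i * w j := fun m ↦ by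
    simp only [hv, Finset.mul_sum, ← Finset.sum_add_distrib, ← Finset.sum_sub_distrib]
    exact Finset.sum_congr rfl fun i _ ↦ Finset.sum_congr rfl fun j _ ↦ by ring
  simp only [e3, Finset.sum_sub_distrib, Finset.sum_add_distrib, e1, e2]
  ring

/-- The square of a parallel momentum is constant. -/
lemma HasParallelMomentum.hasDerivAt_sq (hρ : HasParallelMomentum g γ J ρ)
    (h : IsEmbeddedCurve n γ J) (hJ : IsOpen J) (hρs : ContDiffOn ℝ ∞ ρ J) {s : ℝ} (hs : s ∈ J) :
    HasDerivAt (fun r ↦ ρ r ^ 2 * alongCurve γ J g.val r) 0 s := by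
  set c := γ s with hcdef
  have hc : γ s ∈ (extChartAt (𝓡 n) c).source := mem_extChartAt_source (γ s)
  set y := coordCurve (n := n) γ c with hy
  set V := J ∩ γ ⁻¹' (extChartAt (𝓡 n) c).source with hV
  have hVo : IsOpen V :=
    h.contMDiffOn.continuousOn.isOpen_inter_preimage hJ (isOpen_extChartAt_source c)
  have hsV : s ∈ V := ⟨hs, hc⟩
  have hyV : ContDiffOn ℝ ∞ y V := h.contDiffOn_coordCurve c
  have hy1 : HasDerivAt y (deriv y s) s :=
    ((hyV.contDiffAt (hVo.mem_nhds hsV)).differentiableAt (by simp)).hasDerivAt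
  have hy2 : ∀ k, HasDerivAt (fun r ↦ deriv y r k) (deriv (fun r ↦ deriv y r k) s) s := fun k ↦ by
    have h2 : DifferentiableAt ℝ (deriv y) s :=
      ((hyV.deriv_of_isOpen (m := ∞) hVo (by simp)).contDiffAt (hVo.mem_nhds hsV)).differentiableAt
        (by simp)
    have h3 : DifferentiableAt ℝ (fun r ↦ deriv y r k) s := by
      have := (EuclideanSpace.proj k : Covec n).differentiableAt.comp s h2
      exact this
    exact h3.hasDerivAt
  have hyt : y s ∈ (extChartAt (𝓡 n) c).target := (extChartAt (𝓡 n) c).map_source hc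
  have ht := isOpen_extChartAt_target (I := 𝓡 n) c
  have hG : ∀ i j, HasDerivAt (fun r ↦ metricMatrix g c (y r) i j)
      (∑ l, partialDeriv l (fun z ↦ metricMatrix g c z i j) (y s) * deriv y s l) s := fun i j ↦ by
    have hGd : HasFDerivAt (fun z ↦ metricMatrix g c z i j)
        (fderiv ℝ (fun z ↦ metricMatrix g c z i j) (y s)) (y s) :=
      (((contDiffOn_metricMatrix g c i j).contDiffAt (ht.mem_nhds hyt)).differentiableAt
        (by simp)).hasFDerivAt
    have := hGd.comp_hasDerivAt s hy1
    refine this.congr_deriv ?_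
    conv_lhs => rw [covec_eq_sum (fderiv ℝ (fun z ↦ metricMatrix g c z i j) (y s))]
    simp only [_root_.sum_apply, _root_.smul_apply, smul_eq_mul]
    rfl
  have hq : HasDerivAt (fun r ↦ ρ r ^ 2 * ∑ i, ∑ j, deriv y r i * deriv y r j * metricMatrix g c (y r) i j)
      0 s := by
    have hρ1 : HasDerivAt ρ (deriv ρ s) s :=
      ((hρs.contDiffAt (hJ.mem_nhds hs)).differentiableAt (by simp)).hasDerivAt
    refine ((hρ1.pow 2).mul (HasDerivAt.fun_sum fun i _ ↦ HasDerivAt.fun_sum fun j _ ↦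
      (((hy2 i).mul (hy2 j)).mul (hG i j)))).congr_deriv ?_
    have hODE := hρ c s hs hc
    rw [← hy] at hODE
    set w := deriv y s with hw
    set a : Fin n → ℝ := fun k ↦ deriv (fun r ↦ deriv y r k) s with ha
    set G := metricMatrix g c (y s) with hGdef
    set D : Fin n → Fin n → Fin n → ℝ := fun l i j ↦
      partialDeriv l (fun z ↦ metricMatrix g c z i j) (y s) with hD
    set A : Fin n → ℝ := fun k ↦ ∑ i, ∑ j, christoffel g c k i j (coordCurve γ c s) * w i * w j with hA
    have hcontr : ∑ m, ∑ k, w m * G m k * A k = 2⁻¹ * ∑ l, ∑ i, ∑ j, D l i j * w l * w i * w j :=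
      christoffel_contract (Matrix.mul_nonsing_inv _ (det_metricMatrix_ne_zero g hyt).isUnit) D w
    have hsymm : ∀ i j, G i j = G j i := metricMatrix_symm g c (y s)
    have hODE' : ∀ k, ρ s * a k = -deriv ρ s * w k - ρ s * A k := fun k ↦ by
      linear_combination hODE k
    have hE : ∑ i, ∑ j, w i * w j * ∑ l, D l i j * w l = ∑ l, ∑ i, ∑ j, D l i j * w l * w i * w j := by
      simp only [Finset.mul_sum]
      rw [Finset.sum_congr rfl fun i _ ↦ Finset.sum_comm, Finset.sum_comm]
      exact Finset.sum_congr rfl fun m _ ↦ Finset.sum_congr rfl fun i _ ↦ Finset.sum_congr rfl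
        fun j _ ↦ by ring
    have hF : ∑ i, ∑ j, a i * w j * G i j = ∑ i, ∑ j, w i * a j * G i j := by
      rw [Finset.sum_comm]
      exact Finset.sum_congr rfl fun m _ ↦ Finset.sum_congr rfl fun i _ ↦ by rw [hsymm i m]; ring
    have hB : ρ s * ∑ i, ∑ j, w i * a j * G i j = -deriv ρ s * ∑ i, ∑ j, w i * w j * G i j -
        ρ s * ∑ m, ∑ k, w m * G m k * A k := by
      simp only [Finset.mul_sum, ← Finset.sum_sub_distrib]
      refine Finset.sum_congr rfl fun m _ ↦ Finset.sum_congr rfl fun k _ ↦ ?_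
      linear_combination w m * G m k * hODE' k
    have hS : ∑ i, ∑ j, ((a i * w j + w i * a j) * G i j + w i * w j * ∑ l, D l i j * w l) =
        ∑ i, ∑ j, a i * w j * G i j + ∑ i, ∑ j, w i * a j * G i j +
          ∑ i, ∑ j, w i * w j * ∑ l, D l i j * w l := by
      simp only [← Finset.sum_add_distrib]
      exact Finset.sum_congr rfl fun m _ ↦ Finset.sum_congr rfl fun i _ ↦ by ring
    have hfin : 2 * ρ s * deriv ρ s * ∑ i, ∑ j, w i * w j * G i j + ρ s ^ 2 *
        ∑ i, ∑ j, ((a i * w j + w i * a j) * G i j + w i * w j * ∑ l, D l i j * w l) = 0 := by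
      rw [hS, hF, hE]
      linear_combination 2 * ρ s * hB - 2 * ρ s ^ 2 * hcontr
    have h2 : ((2 : ℕ) : ℝ) * ρ s ^ (2 - 1) * deriv ρ s = 2 * ρ s * deriv ρ s := by norm_num
    rw [h2]
    exact hfin
  refine hq.congr_of_eventuallyEq ?_
  filter_upwards [hVo.mem_nhds hsV] with r hr
  rw [h.alongCurve_eq g.val hr.1 hr.2, derivWithin_of_isOpen hJ hr.1, formMatrix_mulVec]
  rfl

lemma HasParallelMomentum.exists_sq_eq (hρ : HasParallelMomentum g γ J ρ)
    (h : IsEmbeddedCurve n γ J) (hJ : IsOpen J) (hρs : ContDiffOn ℝ ∞ ρ J) :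
    ∃ a, ∀ s ∈ J, ρ s ^ 2 * alongCurve γ J g.val s = a := by
  obtain ⟨s₀, hs₀⟩ := h.nontrivial.nonempty
  exact ⟨_, fun s hs ↦ hJ.is_const_of_deriv_eq_zero h.ordConnected.isPreconnected
    (fun r hr ↦ (hρ.hasDerivAt_sq h hJ hρs hr).differentiableAt.differentiableWithinAt)
    (fun r hr ↦ (hρ.hasDerivAt_sq h hJ hρs hr).deriv) hs hs₀⟩

end Transport

/-! ### Convergence to the curve -/

section Convergence

variable {n : ℕ} {M : Type*} [TopologicalSpace M] [ChartedSpace (EuclideanSpace ℝ (Fin n)) M]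
  [IsManifold (𝓡 n) ∞ M] {γ : ℝ → M} {J J₀ : Set ℝ} {g : LorentzMetric n M} {ρ r : ℝ → ℝ}

/-- All limits of a concentrating sequence along ultrafilters agree, so that the sequence converges. -/
theorem IsConcentrating.exists_tendsto [T2Space M] [SecondCountableTopology M]
    {L : ℕ → CovariantField n M → ℝ} {e : CovariantField n M}
    (hL : IsConcentrating g L (γ '' J) e)
    (hb : ∀ x, IsTestField x → (fun k ↦ L k x) =O[atTop] fun _ ↦ (1 : ℝ))
    (h : IsEmbeddedCurve n γ J) (hJ : IsOpen J) (hcausal : IsCausalCurve g γ J) (hJ₀ : J₀ ⊆ J)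
    (hJ₀m : MeasurableSet J₀)
    (hform : ∀ (Λ : CovariantField n M → ℝ) (ρ : ℝ → ℝ), IsCurveFunctional g Λ (γ '' J) →
      ContinuousOn ρ J →
      (∀ s ∈ J, ∃ ε > 0, ∃ N ∈ 𝓝 (γ s), IsDensityOn Λ γ J (Ioo (s - ε) (s + ε)) N ρ) →
      ∀ x, IsTestField x → Λ x = ∫ s in J₀, ρ s * alongCurve γ J x s) :
    ∃ ρ : ℝ → ℝ, ContDiffOn ℝ ∞ ρ J ∧ (∀ s ∈ J, 0 < ρ s) ∧ HasParallelMomentum g γ J ρ ∧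
      ∀ x, IsTestField x →
        Tendsto (fun k ↦ L k x) atTop (𝓝 (∫ s in J₀, ρ s * alongCurve γ J x s)) := by
  have key : ∀ U : Ultrafilter ℕ, (U : Filter ℕ) ≤ atTop →
      ∃ ρ : ℝ → ℝ, ContDiffOn ℝ ∞ ρ J ∧ (∀ s ∈ J, 0 < ρ s) ∧ HasParallelMomentum g γ J ρ ∧
        (∫ s in J₀, ρ s * alongCurve γ J e s = 1) ∧ ∀ x, IsTestField x →
          Tendsto (fun k ↦ L k x) U (𝓝 (∫ s in J₀, ρ s * alongCurve γ J x s)) := fun U hU ↦ by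
    obtain ⟨Λ, hΛ, hΛe, hlim⟩ := hL.exists_limit hb U hU
    obtain ⟨ρ, hρs, hρ0, hρd, hρp⟩ := hΛ.exists_global_density h hJ hcausal hL.isTestField
      (by rw [hΛe]; exact one_ne_zero)
    have hΛρ := hform Λ ρ hΛ hρs.continuousOn hρd
    refine ⟨ρ, hρs, hρ0, hρp, ?_, fun x hx ↦ ?_⟩
    · rw [← hΛρ e hL.isTestField, hΛe]
    · rw [← hΛρ x hx]
      exact hlim x hx
  obtain ⟨ρ, hρs, hρ0, hρp, hρe, -⟩ := key (hyperfilter ℕ) Nat.hyperfilter_le_atTop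
  refine ⟨ρ, hρs, hρ0, hρp, fun x hx ↦ tendsto_iff_ultrafilter _ _ _ |>.2 fun U hU ↦ ?_⟩
  obtain ⟨ρ', hρ's, -, hρ'p, hρ'e, hlim⟩ := key U hU
  obtain ⟨a, ha⟩ := hρp.exists_eq_mul hρ'p h hJ hcausal hρs hρ's hρ0
  have hint : ∀ y : CovariantField n M, ∫ s in J₀, ρ' s * alongCurve γ J y s = a * ∫ s in J₀, ρ s * alongCurve γ J y s := by
    intro y
    rw [← integral_const_mul]
    exact setIntegral_congr_fun hJ₀m fun s hs ↦ by rw [ha s (hJ₀ hs), mul_assoc]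
  -- the normalization fixes the constant factor
  have ha1 : a = 1 := by
    have := hint e
    rw [hρe, hρ'e, mul_one] at this
    exact this.symm
  have := hlim x hx
  rwa [hint, ha1, one_mul] at this

omit [IsManifold (𝓡 n) ∞ M] in
lemma IsEmbeddedCurve.vel_subset (h : IsEmbeddedCurve n γ J) (hJ₀ : J₀ ⊆ J)
    (hu : UniqueDiffOn ℝ J₀) {s : ℝ} (hs : s ∈ J₀) : (vel γ J₀ s : Vec n) = vel γ J s := by
  have := mfderivWithin_subset hJ₀ (uniqueMDiffWithinAt_iff_uniqueDiffWithinAt.2 (hu s hs))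
    ((h.contMDiffOn s (hJ₀ hs)).mdifferentiableWithinAt (by simp))
  rw [vel, vel, velocity, velocity, this]

/-- A curve with parallel momentum `ρ dγ/ds` is a geodesic, with an affine parameter of rate `a / ρ`.
At boundary points of `J₀` the derivatives within `J₀` are those of the curve on the open set `J`. -/
lemma HasParallelMomentum.isAffineGeodesic (hρ : HasParallelMomentum g γ J ρ)
    (h : IsEmbeddedCurve n γ J) (hJ : IsOpen J) (hJ₀ : J₀ ⊆ J) (hu : UniqueDiffOn ℝ J₀)
    (hρs : ContDiffOn ℝ ∞ ρ J) (hρ0 : ∀ s ∈ J, 0 < ρ s) {a : ℝ} (ha : 0 < a)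
    (hr : ∀ s ∈ J₀, r s = a / ρ s) : IsAffineGeodesic g γ J₀ r := by
  intro c s hs hc k
  have hVo : IsOpen (J ∩ γ ⁻¹' (extChartAt (𝓡 n) c).source) :=
    h.contMDiffOn.continuousOn.isOpen_inter_preimage hJ (isOpen_extChartAt_source c)
  have hsV : s ∈ J ∩ γ ⁻¹' (extChartAt (𝓡 n) c).source := ⟨hJ₀ hs, hc⟩
  set V := J ∩ γ ⁻¹' (extChartAt (𝓡 n) c).source with hV
  have hyV : ContDiffOn ℝ ∞ (coordCurve (n := n) γ c) V := h.contDiffOn_coordCurve c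
  have hy1 : ∀ t ∈ V ∩ J₀, derivWithin (coordCurve (n := n) γ c) J₀ t =
      deriv (coordCurve (n := n) γ c) t := fun t ht ↦
    ((hyV.contDiffAt (hVo.mem_nhds ht.1)).differentiableAt (by simp)).derivWithin (hu t ht.2)
  have hdd : DifferentiableAt ℝ (deriv (coordCurve (n := n) γ c)) s :=
    ((hyV.deriv_of_isOpen (m := ∞) hVo (by simp)).contDiffAt (hVo.mem_nhds hsV)).differentiableAt
      (by simp)
  have hy2 : derivWithin (derivWithin (coordCurve (n := n) γ c) J₀) J₀ s =
      deriv (deriv (coordCurve (n := n) γ c)) s := by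
    rw [Filter.EventuallyEq.derivWithin_eq (f := deriv (coordCurve (n := n) γ c)) _
      (hy1 s ⟨hsV, hs⟩), hdd.derivWithin (hu s hs)]
    filter_upwards [mem_nhdsWithin_of_mem_nhds (hVo.mem_nhds hsV), self_mem_nhdsWithin] with t h1 h2
    exact hy1 t ⟨h1, h2⟩
  have hy2k : deriv (fun t ↦ deriv (coordCurve (n := n) γ c) t k) s =
      deriv (deriv (coordCurve (n := n) γ c)) s k := by
    have := (EuclideanSpace.proj k : Covec n).hasFDerivAt.comp_hasDerivAt s hdd.hasDerivAt
    exact this.deriv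
  have hρd : HasDerivAt ρ (deriv ρ s) s :=
    ((hρs.contDiffAt (hJ.mem_nhds (hJ₀ hs))).differentiableAt (by simp)).hasDerivAt
  have hρ0 := hρ0 s (hJ₀ hs)
  have hrd : derivWithin r J₀ s = a * (-deriv ρ s / ρ s ^ 2) := by
    rw [derivWithin_congr (f := fun t ↦ a * (ρ t)⁻¹) (fun t ht ↦ by rw [hr t ht, div_eq_mul_inv])
      (by rw [hr s hs, div_eq_mul_inv])]
    exact ((hρd.fun_inv hρ0.ne').const_mul a).hasDerivWithinAt.derivWithin (hu s hs)
  have hODE := hρ c s (hJ₀ hs) hc k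
  rw [hy2k] at hODE
  rw [acceleration, hy2, hy1 s ⟨hsV, hs⟩, hrd, hr s hs]
  have e1 : a * (-deriv ρ s / ρ s ^ 2) / (a / ρ s) = -deriv ρ s / ρ s := by
    field_simp
  rw [e1, div_mul_eq_mul_div, eq_div_iff hρ0.ne']
  linear_combination hODE

omit [IsManifold (𝓡 n) ∞ M] in
/-- With respect to a parameter of rate `a / ρ`, the functional of the curve has the density `ρ / a`. -/
lemma deltaAction_eq (h : IsEmbeddedCurve n γ J) (hJ₀ : J₀ ⊆ J) (hu : UniqueDiffOn ℝ J₀)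
    (hJ₀m : MeasurableSet J₀) {a : ℝ} (ha : 0 < a) (hρ0 : ∀ s ∈ J, 0 < ρ s)
    (hr : ∀ s ∈ J₀, r s = a / ρ s) (x : CovariantField n M) :
    deltaAction γ J₀ r x = a⁻¹ * ∫ s in J₀, ρ s * alongCurve γ J x s := by
  have h1 : deltaAction γ J₀ r x = ∫ s in J₀,
      formAt x (γ s) ((r s)⁻¹ • vel γ J₀ s) ((r s)⁻¹ • vel γ J₀ s) * r s := rfl
  rw [h1, ← integral_const_mul]
  refine setIntegral_congr_fun hJ₀m fun s hs ↦ ?_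
  beta_reduce
  have := hρ0 s (hJ₀ hs)
  rw [alongCurve, ← h.vel_subset hJ₀ hu hs, hr s hs]
  simp only [map_smul, _root_.smul_apply, smul_eq_mul]
  field_simp

lemma HasMultiplesConvergingTo.const_mul [MeasurableSpace M] {C : Set (ContravariantField n M)}
    {D : CovariantField n M → ℝ} (hD : HasMultiplesConvergingTo g C D) {b : ℝ} (hb : 0 < b) :
    HasMultiplesConvergingTo g C fun x ↦ b * D x := by
  obtain ⟨a, T, haT, hlim⟩ := hD
  refine ⟨fun k ↦ b * a k, T, fun k ↦ ⟨mul_pos hb (haT k).1, (haT k).2⟩, fun x hx ↦ ?_⟩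
  refine ((hlim x hx).const_mul b).congr fun k ↦ ?_
  rw [smul_action, smul_action, mul_assoc]

/-- The density of the limit, for a tracked causal curve. The open set `J'` is `J` for an arc and the
whole line for a loop. -/
theorem exists_density_of_tracks [T2Space M] [SecondCountableTopology M] [MeasurableSpace M]
    [BorelSpace M] (hγ : IsProperArc (n := n) γ J ∨ IsSimpleLoop (n := n) γ J)
    {C : Set (ContravariantField n M)}
    (hsmooth : ∀ T ∈ C, IsSmoothContra T) (hsymm : ∀ T ∈ C, ∀ p ξ η, T p ξ η = T p η ξ)
    (hdec : ∀ T ∈ C, ∀ p, DominantEnergyAt g p (T p)) (hcons : ∀ T ∈ C, IsConserved g T)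
    (htracks : Tracks g C γ J) (hcausal : IsCausalCurve g γ J) :
    ∃ J', IsOpen J' ∧ J ⊆ J' ∧ J.Nonempty ∧ MeasurableSet J ∧ UniqueDiffOn ℝ J ∧ IsEmbeddedCurve n γ J' ∧
      ∃ ρ : ℝ → ℝ, ContDiffOn ℝ ∞ ρ J' ∧ (∀ s ∈ J', 0 < ρ s) ∧ HasParallelMomentum g γ J' ρ ∧
        HasMultiplesConvergingTo g C fun x ↦ ∫ s in J, ρ s * alongCurve γ J' x s := by
  have main : ∀ J', J ⊆ J' → J.Nonempty → γ '' J' = γ '' J → IsEmbeddedCurve n γ J' →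
      IsCausalCurve g γ J' → (IsOpen J' → MeasurableSet J ∧
        ∀ (Λ : CovariantField n M → ℝ) (ρ : ℝ → ℝ), IsCurveFunctional g Λ (γ '' J') →
        ContinuousOn ρ J' →
        (∀ s ∈ J', ∃ ε > 0, ∃ N ∈ 𝓝 (γ s), IsDensityOn Λ γ J' (Ioo (s - ε) (s + ε)) N ρ) →
        ∀ x, IsTestField x → Λ x = ∫ s in J, ρ s * alongCurve γ J' x s) →
      IsOpen J' ∧ MeasurableSet J ∧
      ∃ ρ : ℝ → ℝ, ContDiffOn ℝ ∞ ρ J' ∧ (∀ s ∈ J', 0 < ρ s) ∧ HasParallelMomentum g γ J' ρ ∧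
        HasMultiplesConvergingTo g C fun x ↦ ∫ s in J, ρ s * alongCurve γ J' x s := by
    intro J' hJJ' ⟨s, hs⟩ him h hcausal hform
    obtain ⟨e, T, hT, hL, hen, hdom⟩ := htracks.exists_isConcentrating hsmooth hsymm hdec hcons
      (him ▸ h.isClosed) hs
    rw [← him] at hL
    have hJ' := hL.isOpen h hcausal
    obtain ⟨hJm, hform⟩ := hform hJ'
    obtain ⟨ρ, hρs, hρ0, hρp, hlim⟩ := hL.exists_tendsto
      (hL.isBigO_one h hcausal (hJJ' hs) hen hdom) h hJ' hcausal hJJ' hJm hform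
    refine ⟨hJ', hJm, ρ, hρs, hρ0, hρp, fun k ↦ (action g (T k) e)⁻¹, T,
      fun k ↦ ⟨inv_pos.2 (hT k).2, (hT k).1⟩, fun x hx ↦ (hlim x hx).congr fun k ↦ ?_⟩
    rw [smul_action]
  rcases hγ with hγ | ⟨L, hL, rfl, hs, hp, hinj⟩
  · have h := hγ.isEmbeddedCurve
    have hinj : InjOn γ J := injOn_iff_injective.2 hγ.2.2.2.injective
    obtain ⟨hJ, hJm, hρ⟩ := main J subset_rfl h.nontrivial.nonempty rfl h hcausal fun hJ ↦
      ⟨hJ.measurableSet, fun Λ ρ hΛ hρ hd x hx ↦ hΛ.eq_integral_of_injOn h hJ hinj hρ hd hx⟩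
    exact ⟨J, hJ, subset_rfl, h.nontrivial.nonempty, hJm, h.uniqueDiffOn, h, hρ⟩
  · have h := isEmbeddedCurve_univ_of_loop hL hs hp hinj
    have hu : UniqueDiffOn ℝ (Ico 0 L) := uniqueDiffOn_Ico 0 L
    have hper : Function.Periodic (fun s ↦ (γ s, (vel γ univ s : Vec n))) L := fun s ↦ by
      beta_reduce
      rw [hp, h.vel_add_period hp]
    have hcausal' : IsCausalCurve g γ univ := fun s _ ↦ by
      obtain ⟨s', hs', hss'⟩ := hper.exists_mem_Ico₀ hL s
      obtain ⟨h1, h2⟩ := Prod.mk.inj hss'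
      have := hcausal s' hs'
      rw [h.vel_subset (subset_univ _) hu hs', ← h2, ← h1] at this
      exact this
    have him : γ '' univ = γ '' Ico 0 L := by
      refine (image_subset_iff.2 fun s _ ↦ ?_).antisymm (image_mono (subset_univ _))
      obtain ⟨s', hs', hss'⟩ := hp.exists_mem_Ico₀ hL s
      exact ⟨s', hs', hss'.symm⟩
    obtain ⟨hJ, hJm, hρ⟩ := main univ (subset_univ _) ⟨0, le_rfl, hL⟩ him h hcausal' fun _ ↦
      ⟨measurableSet_Ico, fun Λ ρ hΛ hρ hd x hx ↦
        hΛ.eq_integral_of_periodic h hcausal' hL hp hinj hρ hd hx⟩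
    exact ⟨univ, isOpen_univ, subset_univ _, ⟨0, le_rfl, hL⟩, hJm, hu, h, hρ⟩

end Convergence

end Tracking

end

theorem theorem1 {n : ℕ} {M : Type*} [TopologicalSpace M] [T2Space M] [SecondCountableTopology M]
    [ChartedSpace (EuclideanSpace ℝ (Fin n)) M] [IsManifold (𝓡 n) ∞ M]
    [MeasurableSpace M] [BorelSpace M]
    (g : Tracking.LorentzMetric n M)
    (γ : ℝ → M) (J : Set ℝ)
    (hγ : Tracking.IsProperArc (n := n) γ J ∨ Tracking.IsSimpleLoop (n := n) γ J)
    (C : Set (Tracking.ContravariantField n M))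
    (hsmooth : ∀ T ∈ C, Tracking.IsSmoothContra T)
    (hsymm : ∀ T ∈ C, ∀ p ξ η, T p ξ η = T p η ξ)
    (hdec : ∀ T ∈ C, ∀ p, Tracking.DominantEnergyAt g p (T p))
    (hcons : ∀ T ∈ C, Tracking.IsConserved g T)
    (htracks : Tracking.Tracks g C γ J) :
    (Tracking.IsTimelike g γ J →
      Tracking.HasMultiplesConvergingTo g C
        (Tracking.deltaAction γ J (Tracking.properTimeRate g γ J)) ∧
      Tracking.IsAffineGeodesic g γ J (Tracking.properTimeRate g γ J)) ∧
    (Tracking.IsNull g γ J →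
      ∃ r : ℝ → ℝ, ContDiffOn ℝ ∞ r J ∧ (∀ s ∈ J, 0 < r s) ∧
        Tracking.HasMultiplesConvergingTo g C (Tracking.deltaAction γ J r) ∧
        Tracking.IsAffineGeodesic g γ J r) := by
  constructor
  · intro htl
    have hcausal : Tracking.IsCausalCurve g γ J := fun s hs ↦
      ⟨fun h0 ↦ (htl s hs).ne' (by
        change Tracking.formAt g.val (γ s) (Tracking.vel γ J s) (Tracking.vel γ J s) = 0
        rw [h0, map_zero]), (htl s hs).le⟩
    obtain ⟨J', hJ', hJJ', ⟨s₀, hs₀⟩, hJm, hu, h, ρ, hρs, hρ0, hρp, hlim⟩ :=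
      Tracking.exists_density_of_tracks hγ hsmooth hsymm hdec hcons htracks hcausal
    -- `ρ² g(u, u)` is constant, so that proper time has the rate `const / ρ` of an affine parameter
    obtain ⟨b, hb⟩ := hρp.exists_sq_eq h hJ' hρs
    have hq : ∀ s ∈ J, 0 < Tracking.alongCurve γ J' g.val s ∧
        Tracking.properTimeRate g γ J s = √(Tracking.alongCurve γ J' g.val s) := fun s hs ↦ by
      have h1 : Tracking.alongCurve γ J' g.val s = Tracking.alongCurve γ J g.val s := by
        rw [Tracking.alongCurve, Tracking.alongCurve, h.vel_subset hJJ' hu hs]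
      rw [h1]
      exact ⟨htl s hs, rfl⟩
    have hb0 : 0 < b := by
      rw [← hb s₀ (hJJ' hs₀)]
      exact mul_pos (pow_pos (hρ0 s₀ (hJJ' hs₀)) 2) (hq s₀ hs₀).1
    have hr : ∀ s ∈ J, Tracking.properTimeRate g γ J s = √b / ρ s := fun s hs ↦ by
      have hρ := hρ0 s (hJJ' hs)
      rw [(hq s hs).2, ← hb s (hJJ' hs), Real.sqrt_mul (sq_nonneg _), Real.sqrt_sq hρ.le,
        mul_div_cancel_left₀ _ hρ.ne']
    refine ⟨?_, hρp.isAffineGeodesic h hJ' hJJ' hu hρs hρ0 (Real.sqrt_pos.2 hb0) hr⟩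
    rw [funext (Tracking.deltaAction_eq h hJJ' hu hJm (Real.sqrt_pos.2 hb0) hρ0 hr)]
    exact hlim.const_mul (inv_pos.2 (Real.sqrt_pos.2 hb0))
  · intro hnull
    have hcausal : Tracking.IsCausalCurve g γ J := fun s hs ↦ ⟨(hnull s hs).1, (hnull s hs).2.ge⟩
    obtain ⟨J', hJ', hJJ', -, hJm, hu, h, ρ, hρs, hρ0, hρp, hlim⟩ :=
      Tracking.exists_density_of_tracks hγ hsmooth hsymm hdec hcons htracks hcausal
    have hr : ∀ s ∈ J, (fun s ↦ 1 / ρ s) s = 1 / ρ s := fun _ _ ↦ rfl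
    refine ⟨fun s ↦ 1 / ρ s,
      contDiffOn_const.div (hρs.mono hJJ') fun s hs ↦ (hρ0 s (hJJ' hs)).ne',
      fun s hs ↦ one_div_pos.2 (hρ0 s (hJJ' hs)), ?_,
      hρp.isAffineGeodesic h hJ' hJJ' hu hρs hρ0 one_pos hr⟩
    rw [funext (Tracking.deltaAction_eq h hJJ' hu hJm one_pos hρ0 hr)]
    exact hlim.const_mul (inv_pos.2 one_pos)
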